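/- Let $d\ge 1$, let $\mathbb R^{d,1}=\mathbb R^d\times\mathbb R$ carry $\langle x,y\rangle_{d,1}=x_1y_1+\dots+x_dy_d-x_{d+1}y_{d+1}$, and let $O_+(d,1)$ be the group of linear isometries preserving the future sheet of the hyperboloid $\{\langle x,x\rangle_{d,1}=-1\}$. It acts on the Klein model $\mathbb H^d=B^d$ (open unit ball) by $A\binom{x}{1}=\frac{L(x)}{L(A\cdot x)}\binom{A\cdot x}{1}$, where $L(x)=\sqrt{1-\|x\|^2}$. Let $\Gamma\subset O_+(d,1)$ be a subgroup such that $\mathbb H^d/\Gamma$ is a compact oriented hyperbolic manifold. Co-Minkowski space is ${}^*\mathbb R^{d,1}=B^d\times\mathbb R$, where $(x,h)$ represents the spacelike hyperplane $\{y:\langle\binom{x}{1},y\rangle_{d,1}=h\}$. The pairs $(A,v)\in O_+(d,1)\ltimes\mathbb R^{d,1}$ act on it by $(A,v)(x,h)=\big(A\cdot x,\ \tfrac{L(A\cdot x)}{L(x)}h+\langle\binom{A\cdot x}{1},v\rangle_{d,1}\big)$. Via the embedding $(x,h)\mapsto L(x)^{-1}(x,1,h)$ into $\mathbb R^{d+2}$,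 its geodesics are the curves $c$ with $c''=\langle c',c'\rangle c$, where $\langle\cdot,\cdot\rangle$ is $\langle\cdot,\cdot\rangle_{d,1}$ in the first $d+1$ coordinates. Its volume is the product of the hyperbolic volume of $B^d$ with $L(x)^{-1}dh$. For a cocycle $\tau\in Z^1(\Gamma,\mathbb R^{d,1})$ let $\Gamma_\tau=\{(A,\tau(A)):A\in\Gamma\}$. A continuous $h:B^d\to\mathbb R$ is $\tau$-equivariant if its graph is $\Gamma_\tau$-invariant. A function $f$ on $B^d$ is called $\Gamma$-invariant if its graph is invariant under $\{(A,0):A\in\Gamma\}$, i.e. if $L^{-1}f$ is invariant under the action of $\Gamma$ on $B^d$; then $\int_{\mathbb H^d/\Gamma}f$ denotes the integral of the function induced by $L^{-1}f$ on $\mathbb H^d/\Gamma$, with respect to the hyperbolic volume. For every $\tau\in Z^1(\Gamma,\mathbb R^{d,1})$: (a) There are $\tau$-equivariant maps, and there is a unique $b_\tau:\partial B^d\to\mathbb R$, which is continuous, such that all of them extend continuously to $\partial B^d$ by $b_\tau$. There is a unique $C^\infty$ $\tau$-equivariant map $h^{\mathrm{mean}}_\tau$ with vanishing mean curvature, i.e.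 such that the trace of $L^{-1}\operatorname{Hess}h^{\mathrm{mean}}_\tau$ with respect to the hyperbolic metric is $0$. Let $h^-_\tau(x)$ be the supremum of $a(x)$ over the affine functions $a$ on $\mathbb R^d$ with $a\le b_\tau$ on $\partial B^d$, and let $h^+_\tau(x)$ be the infimum of $a(x)$ over those with $a\ge b_\tau$ on $\partial B^d$. (b) The quotient ${}^*\mathbb R^{d,1}/\Gamma_\tau$ has a smallest non-empty closed geodesically convex subset, the convex core $\mathrm{CC}(\tau)$. The functions $h^+_\tau-h^-_\tau$ and $h^{\mathrm{mean}}_\tau-h^-_\tau$ are $\Gamma$-invariant and integrable over $\mathbb H^d/\Gamma$, and $$\operatorname{Vol}(\mathrm{CC}(\tau))=\int_{\mathbb H^d/\Gamma}(h^+_\tau-h^-_\tau).$$ Moreover, $\operatorname{Vol}(\mathrm{CC}(\tau))$ and $\|\tau\|_{S_1}:=\int_{\mathbb H^d/\Gamma}(h^{\mathrm{mean}}_\tau-h^-_\tau)$ depend only on the class $[\tau]\in H^1(\Gamma,\mathbb R^{d,1})$. The function $\mathbf{vol}([\tau]):=\operatorname{Vol}(\mathrm{CC}(\tau))$ is a norm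 on the real vector space $H^1(\Gamma,\mathbb R^{d,1})$, and it is the symmetrization of the $S_1$ norm: $$\mathbf{vol}([\tau])=\|[\tau]\|_{S_1}+\|-[\tau]\|_{S_1}.$$ -/

import Mathlib

open MeasureTheory Topology Filter
open scoped ContDiff

noncomputable section

namespace CoMinkowski

/-! ## Minkowski space and its linear isometries -/

/-- Euclidean space `ℝ^d`. -/
abbrev E (d : ℕ) := EuclideanSpace ℝ (Fin d)

/-- Minkowski space `ℝ^{d,1}`: horizontal component in `ℝ^d`, vertical component in `ℝ`. -/
abbrev Mink (d : ℕ) := E d × ℝ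

/-- The Lorentzian bilinear form `x₁y₁ + ⋯ + x_d y_d - x_{d+1} y_{d+1}`. -/
def lor {d : ℕ} (x y : Mink d) : ℝ := inner ℝ x.1 y.1 - x.2 * y.2

/-- The future sheet `{⟨x, x⟩ = -1, x_{d+1} > 0}`, the hyperboloid model of hyperbolic space. -/
def hyperboloid (d : ℕ) : Set (Mink d) := {x | lor x x = -1 ∧ 0 < x.2}

/-- `O₊(d,1)`: linear automorphisms preserving the Lorentzian form and the future sheet. -/
def OPlus (d : ℕ) : Subgroup (Mink d ≃ₗ[ℝ] Mink d) where
  carrier := {A | (∀ x y, lor (A x) (A y) = lor x y) ∧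
    ∀ x, A x ∈ hyperboloid d ↔ x ∈ hyperboloid d}
  mul_mem' := by
    rintro A B ⟨hA, hA'⟩ ⟨hB, hB'⟩
    exact ⟨fun x y => by rw [LinearEquiv.mul_apply, LinearEquiv.mul_apply, hA, hB],
      fun x => by rw [LinearEquiv.mul_apply, hA', hB']⟩
  one_mem' := ⟨fun _ _ => rfl, fun _ => Iff.rfl⟩
  inv_mem' := by
    rintro A ⟨hA, hA'⟩
    have h : ∀ x, A (A⁻¹ x) = x := fun x => A.apply_symm_apply x
    exact ⟨fun x y => by rw [← hA, h, h], fun x => by rw [← hA', h]⟩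

/-! ## The Klein ball model -/

/-- The open unit ball `B^d` of `ℝ^d`. -/
abbrev Ball (d : ℕ) := Metric.ball (0 : E d) 1

/-- The unit sphere `∂B^d`. -/
abbrev Sphere (d : ℕ) := Metric.sphere (0 : E d) 1

/-- `L(x) = √(1 - ‖x‖²)`. -/
def L {d : ℕ} (x : E d) : ℝ := √(1 - ‖x‖ ^ 2)

theorem L_pos {d : ℕ} (x : Ball d) : 0 < L (x : E d) := by
  have h : ‖(x : E d)‖ < 1 := mem_ball_zero_iff.1 x.2
  exact Real.sqrt_pos.2 (by nlinarith [norm_nonneg (x : E d)])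

theorem L_sq {d : ℕ} (x : Ball d) : L (x : E d) ^ 2 = 1 - ‖(x : E d)‖ ^ 2 := by
  have h : ‖(x : E d)‖ < 1 := mem_ball_zero_iff.1 x.2
  exact Real.sq_sqrt (by nlinarith [norm_nonneg (x : E d)])

/-- The vector `(x, 1)` of Minkowski space. -/
def hom {d : ℕ} (x : E d) : Mink d := (x, 1)

theorem lor_smul_smul {d : ℕ} (a b : ℝ) (x y : Mink d) :
    lor (a • x) (b • y) = a * b * lor x y := by
  simp [lor, real_inner_smul_left, real_inner_smul_right]
  ring

theorem lor_hom_self {d : ℕ} (x : E d) : lor (hom x) (hom x) = ‖x‖ ^ 2 - 1 := by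
  simp [lor, hom]

theorem hom_mem_hyperboloid {d : ℕ} (x : Ball d) :
    (L (x : E d))⁻¹ • hom (x : E d) ∈ hyperboloid d := by
  have h := L_pos x
  refine ⟨?_, by simpa [hom] using h⟩
  rw [lor_smul_smul, lor_hom_self]
  have := L_sq x
  field_simp
  linarith

theorem snd_apply_hom_pos {d : ℕ} (A : OPlus d) (x : Ball d) : 0 < (A.1 (hom (x : E d))).2 := by
  have h := ((A.2.2 _).2 (hom_mem_hyperboloid x)).2
  rw [map_smul] at h
  have h' := L_pos x
  have : 0 < (L (x : E d))⁻¹ := inv_pos.2 h'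
  simpa [this] using h

/-- The action of `O₊(d,1)` on `B^d`: `A (x,1) = (A (x,1))_{d+1} (A · x, 1)`. -/
def kleinAct {d : ℕ} (A : OPlus d) (x : Ball d) : Ball d :=
  ⟨(A.1 (hom (x : E d))).2⁻¹ • (A.1 (hom (x : E d))).1, by
    have h := snd_apply_hom_pos A x
    have h1 := A.2.1 (hom (x : E d)) (hom (x : E d))
    rw [lor_hom_self, ← sub_eq_zero] at h1
    have h2 : ‖(x : E d)‖ < 1 := mem_ball_zero_iff.1 x.2
    have h3 : ‖(A.1 (hom (x : E d))).1‖ < (A.1 (hom (x : E d))).2 := by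
      simp only [lor, real_inner_self_eq_norm_sq] at h1
      nlinarith [norm_nonneg (x : E d), norm_nonneg (A.1 (hom (x : E d))).1]
    rw [mem_ball_zero_iff, norm_smul, norm_inv, Real.norm_of_nonneg h.le]
    rw [inv_mul_lt_iff₀ h]
    simpa using h3⟩

theorem apply_hom {d : ℕ} (A : OPlus d) (x : Ball d) :
    A.1 (hom (x : E d)) = (A.1 (hom (x : E d))).2 • hom (kleinAct A x : E d) := by
  have h := (snd_apply_hom_pos A x).ne'
  refine Prod.ext ?_ ?_
  · change _ = _ • (_⁻¹ • _)
    rw [smul_smul, mul_inv_cancel₀ h, one_smul]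
  · simp [hom]

instance (d : ℕ) : MulAction (OPlus d) (Ball d) where
  smul := kleinAct
  one_smul x := by
    change kleinAct 1 x = x
    apply Subtype.ext
    simp [kleinAct, hom]
  mul_smul A B x := by
    change kleinAct (A * B) x = kleinAct A (kleinAct B x)
    have hB := (snd_apply_hom_pos B x).ne'
    have hA := (snd_apply_hom_pos A (kleinAct B x)).ne'
    have key : (A * B).1 (hom (x : E d)) =
        (B.1 (hom (x : E d))).2 • A.1 (hom (kleinAct B x : E d)) := by
      rw [← map_smul, ← apply_hom]; rfl
    apply Subtype.ext
    change ((A * B).1 (hom (x : E d))).2⁻¹ • ((A * B).1 (hom (x : E d))).1 =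
      (A.1 (hom (kleinAct B x : E d))).2⁻¹ • (A.1 (hom (kleinAct B x : E d))).1
    rw [key]
    simp only [Prod.smul_fst, Prod.smul_snd, smul_smul, smul_eq_mul]
    congr 1
    field_simp

theorem apply_hom_eq {d : ℕ} (A : OPlus d) (x : Ball d) :
    A.1 (hom (x : E d)) = (L (x : E d) / L ((A • x : Ball d) : E d)) • hom ((A • x : Ball d) : E d) := by
  change _ = (L (x : E d) / L (kleinAct A x : E d)) • hom (kleinAct A x : E d)
  have h := snd_apply_hom_pos A x
  have h1 := A.2.1 (hom (x : E d)) (hom (x : E d))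
  rw [apply_hom A x, lor_smul_smul, lor_hom_self, lor_hom_self] at h1
  have hx := L_sq x
  have hy := L_sq (kleinAct A x)
  have hx0 := L_pos x
  have hy0 := L_pos (kleinAct A x)
  have e : (A.1 (hom (x : E d))).2 * L (kleinAct A x : E d) = L (x : E d) := by
    have : ((A.1 (hom (x : E d))).2 * L (kleinAct A x : E d)) ^ 2 = L (x : E d) ^ 2 := by
      rw [mul_pow, hx, hy]; linarith
    exact (pow_left_inj₀ (by positivity) hx0.le two_ne_zero).1 this
  rw [apply_hom A x, ← e]
  congr 1
  field_simp

/-- The hyperbolic metric of the Klein model,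
`L⁻² ⟨X,Y⟩ + L⁻⁴ ⟨x,X⟩ ⟨x,Y⟩`, as a Gram matrix in the standard basis. -/
def hypMetric {d : ℕ} (x : E d) : Matrix (Fin d) (Fin d) ℝ :=
  fun i j => (L x ^ 2)⁻¹ * (if i = j then 1 else 0) + (L x ^ 4)⁻¹ * (x i * x j)

/-- The hyperbolic volume on `B^d`: density `√(det hypMetric) = L^{-(d+1)}` with respect to
Lebesgue measure. -/
def hypVolume (d : ℕ) : Measure (Ball d) :=
  (Measure.comap Subtype.val (volume : Measure (E d))).withDensity
    fun x => ENNReal.ofReal (L (x : E d) ^ (d + 1))⁻¹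

/-! ## Co-Minkowski space in cylindrical coordinates -/

/-- Co-Minkowski space: `(x, h)` stands for the spacelike hyperplane
`{y | ⟨(x,1), y⟩ = h}` of Minkowski space. -/
abbrev CoMink (d : ℕ) := Ball d × ℝ

/-- The group `O₊(d,1) ⋉ ℝ^{d,1}`; the pair `(A, v)` stands for `y ↦ A y + v`. -/
@[ext]
structure CoIsom (d : ℕ) where
  /-- linear part -/
  lin : OPlus d
  /-- translation part -/
  trans : Mink d

instance (d : ℕ) : Group (CoIsom d) where
  mul g g' := ⟨g.lin * g'.lin, g.trans + g.lin.1 g'.trans⟩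
  one := ⟨1, 0⟩
  inv g := ⟨g.lin⁻¹, -(g.lin⁻¹).1 g.trans⟩
  mul_assoc a b c := CoIsom.ext (mul_assoc _ _ _) (by
    change (a.trans + a.lin.1 b.trans) + a.lin.1 (b.lin.1 c.trans) =
      a.trans + a.lin.1 (b.trans + b.lin.1 c.trans)
    rw [map_add, add_assoc])
  one_mul a := CoIsom.ext (one_mul _) (by
    change (0 : Mink d) + a.trans = a.trans
    exact zero_add _)
  mul_one a := CoIsom.ext (mul_one _) (by
    change a.trans + a.lin.1 0 = a.trans
    rw [map_zero, add_zero])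
  inv_mul_cancel a := CoIsom.ext (inv_mul_cancel _) (by
    change -(a.lin⁻¹).1 a.trans + (a.lin⁻¹).1 a.trans = 0
    exact neg_add_cancel _)

theorem CoIsom.mul_lin {d : ℕ} (g g' : CoIsom d) : (g * g').lin = g.lin * g'.lin := rfl

theorem CoIsom.mul_trans {d : ℕ} (g g' : CoIsom d) :
    (g * g').trans = g.trans + g.lin.1 g'.trans := rfl

/-- The action on hyperplanes:
`(A,v)(x,h) = (A·x, L(A·x)/L(x) h + ⟨A·x, v̄⟩ - v_{d+1})`. -/
def coAct {d : ℕ} (g : CoIsom d) (p : CoMink d) : CoMink d :=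
  (g.lin • p.1, L ((g.lin • p.1 : Ball d) : E d) / L (p.1 : E d) * p.2
    + lor (hom ((g.lin • p.1 : Ball d) : E d)) g.trans)

instance (d : ℕ) : MulAction (CoIsom d) (CoMink d) where
  smul := coAct
  one_smul p := by
    change coAct 1 p = p
    have e : (1 : CoIsom d).lin • p.1 = p.1 := one_smul (OPlus d) p.1
    have e' : (1 : CoIsom d).trans = 0 := rfl
    have h := (L_pos p.1).ne'
    refine Prod.ext e ?_
    simp only [coAct, e, e']
    simp [lor, h]
  mul_smul g g' p := by
    change coAct (g * g') p = coAct g (coAct g' p)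
    have e : (g * g').lin • p.1 = g.lin • g'.lin • p.1 := mul_smul g.lin g'.lin p.1
    refine Prod.ext e ?_
    simp only [coAct, e, CoIsom.mul_trans]
    set y : Ball d := g'.lin • p.1
    set z : Ball d := g.lin • y with hz
    have h1 := (L_pos p.1).ne'
    have h2 := (L_pos y).ne'
    have h3 := (L_pos z).ne'
    have key : lor (hom (z : E d)) (g.lin.1 g'.trans) =
        L (z : E d) / L (y : E d) * lor (hom (y : E d)) g'.trans := by
      rw [← g.lin.2.1 (hom (y : E d)) g'.trans, apply_hom_eq g.lin y, ← hz]
      have := lor_smul_smul (L (y : E d) / L (z : E d)) 1 (hom (z : E d)) (g.lin.1 g'.trans)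
      rw [one_smul, mul_one] at this
      rw [this]
      field_simp
    have hadd : ∀ a b c : Mink d, lor a (b + c) = lor a b + lor a c := by
      intro a b c
      simp only [lor, Prod.fst_add, Prod.snd_add, inner_add_right]
      ring
    rw [hadd, key]
    field_simp
    ring

/-- The central projection of a point `(x, h)` of the cylinder onto the degenerate quadric
`{(n, h) | ⟨n, n⟩ = -1, n_{d+1} > 0}` in `ℝ^{d+1} × ℝ`. -/
def toQuadric {d : ℕ} (p : CoMink d) : Mink d × ℝ :=
  ((L (p.1 : E d))⁻¹ • hom (p.1 : E d), (L (p.1 : E d))⁻¹ * p.2)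

/-- Affinely parametrized geodesics of co-Minkowski space, for the connection on the quadric
given by `D_Y X = ∇_Y X + ⟨X, Y⟩_{d,1,0} N` with `N(x) = x`; that is, `c'' = ⟨c', c'⟩ c`. -/
def IsGeodesic {d : ℕ} (γ : ℝ → CoMink d) : Prop :=
  ContDiff ℝ 2 (fun t => toQuadric (γ t)) ∧
    ∀ t, deriv (deriv fun s => toQuadric (γ s)) t =
      lor (deriv (fun s => toQuadric (γ s)) t).1 (deriv (fun s => toQuadric (γ s)) t).1 •
        toQuadric (γ t)

/-- The volume of co-Minkowski space: the volume form takes the value `1` on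
`(v₁, …, v_d, T)` with `v₁, …, v_d` hyperbolic-orthonormal and `T = L ∂/∂x_t`, so it is
the product of the hyperbolic volume with `L⁻¹ dx_t`. -/
def coVolume (d : ℕ) : Measure (CoMink d) :=
  ((hypVolume d).prod (volume : Measure ℝ)).withDensity
    fun p => ENNReal.ofReal (L (p.1 : E d))⁻¹

/-! ## Quotients -/

/-- The measure induced by `μ` on the quotient by a group action: the least measure `ν` such that
`μ U ≤ ν (π U)`, in the strong sense `π_*(μ|U) ≤ ν`, for all measurable `U` on which the projection
`π` is injective. For a measure-preserving, free and properly discontinuous action it is the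
measure which makes `π` locally measure preserving. -/
def quotientMeasure (G : Type) {X : Type} [Group G] [MulAction G X] [MeasurableSpace X]
    (μ : Measure X) : Measure (MulAction.orbitRel.Quotient G X) :=
  ⨆ (U : Set X) (_ : MeasurableSet U ∧
      Set.InjOn (fun x => (Quotient.mk _ x : MulAction.orbitRel.Quotient G X)) U),
    (μ.restrict U).map (fun x => (Quotient.mk _ x : MulAction.orbitRel.Quotient G X))

/-- `Γ` acts on hyperbolic space freely and properly discontinuously, with compact quotient, and
preserves orientation: `ℍ^d / Γ` is a compact oriented hyperbolic manifold. -/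
structure IsCompactOrientedQuotient {d : ℕ} (Γ : Subgroup (OPlus d)) : Prop where
  orientation : ∀ A ∈ Γ, LinearMap.det (A.1 : Mink d →ₗ[ℝ] Mink d) = 1
  free : ∀ A ∈ Γ, ∀ x : Ball d, A • x = x → A = 1
  properlyDiscontinuous : ProperlyDiscontinuousSMul Γ (Ball d)
  compact : CompactSpace (MulAction.orbitRel.Quotient Γ (Ball d))

/-- The compact hyperbolic manifold `ℍ^d / Γ`. -/
abbrev HypQuotient {d : ℕ} (Γ : Subgroup (OPlus d)) := MulAction.orbitRel.Quotient Γ (Ball d)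

/-- The function on `ℍ^d / Γ` corresponding to a function `h` on `B^d` whose graph is invariant
under the linear action of `Γ`, that is, such that `L⁻¹ h` is a `Γ`-invariant function. -/
def descend {d : ℕ} (Γ : Subgroup (OPlus d)) (h : Ball d → ℝ) : HypQuotient Γ → ℝ :=
  fun q => (L (q.out : E d))⁻¹ * h q.out

/-- `h` is `Γ`-invariant: `L⁻¹ h` is invariant under the action of `Γ` on `B^d`. -/
def IsGammaInvariant {d : ℕ} (Γ : Subgroup (OPlus d)) (h : Ball d → ℝ) : Prop :=
  ∀ A ∈ Γ, ∀ x : Ball d,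
    (L ((A • x : Ball d) : E d))⁻¹ * h (A • x) = (L (x : E d))⁻¹ * h x

/-! ## Cocycles and the deformed groups -/

/-- The representation of `Γ` on `ℝ^{d,1}`. -/
def minkRep {d : ℕ} (Γ : Subgroup (OPlus d)) : Representation ℝ Γ (Mink d) where
  toFun A := (A.1.1 : Mink d →ₗ[ℝ] Mink d)
  map_one' := rfl
  map_mul' _ _ := rfl

/-- `Z¹(Γ, ℝ^{d,1})`. -/
abbrev Z1 {d : ℕ} (Γ : Subgroup (OPlus d)) := groupCohomology.cocycles₁ (Rep.of (minkRep Γ))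

/-- `H¹(Γ, ℝ^{d,1})`. -/
abbrev H1 {d : ℕ} (Γ : Subgroup (OPlus d)) := groupCohomology.H1 (Rep.of (minkRep Γ))

/-- The class in `H¹(Γ, ℝ^{d,1})` of a cocycle. -/
def cls {d : ℕ} {Γ : Subgroup (OPlus d)} (τ : Z1 Γ) : H1 Γ :=
  groupCohomology.H1π (Rep.of (minkRep Γ)) τ

/-- The value `τ(A) ∈ ℝ^{d,1}` of a cocycle. -/
def Z1.val {d : ℕ} {Γ : Subgroup (OPlus d)} (τ : Z1 Γ) (A : Γ) : Mink d := τ A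

theorem Z1.val_mul {d : ℕ} {Γ : Subgroup (OPlus d)} (τ : Z1 Γ) (A B : Γ) :
    Z1.val τ (A * B) = Z1.val τ A + A.1.1 (Z1.val τ B) := by
  have h := (groupCohomology.mem_cocycles₁_iff (A := Rep.of (minkRep Γ)) τ).1 τ.2 A B
  rw [add_comm]
  exact h

theorem Z1.val_one {d : ℕ} {Γ : Subgroup (OPlus d)} (τ : Z1 Γ) : Z1.val τ 1 = 0 := by
  have h := Z1.val_mul τ 1 1
  rw [mul_one] at h
  change Z1.val τ 1 = Z1.val τ 1 + Z1.val τ 1 at h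
  simpa using h

/-- `Γ_τ = {(A, τ(A)) | A ∈ Γ}`. -/
def deformed {d : ℕ} {Γ : Subgroup (OPlus d)} (τ : Z1 Γ) : Subgroup (CoIsom d) where
  carrier := {g | ∃ A : Γ, g = ⟨A.1, Z1.val τ A⟩}
  mul_mem' := by
    rintro _ _ ⟨A, rfl⟩ ⟨B, rfl⟩
    exact ⟨A * B, CoIsom.ext rfl (Z1.val_mul τ A B).symm⟩
  one_mem' := ⟨1, CoIsom.ext rfl (Z1.val_one τ).symm⟩
  inv_mem' := by
    rintro _ ⟨A, rfl⟩
    refine ⟨A⁻¹, CoIsom.ext rfl ?_⟩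
    have h := Z1.val_mul τ A⁻¹ A
    rw [inv_mul_cancel, Z1.val_one] at h
    exact (eq_neg_of_add_eq_zero_left h.symm).symm

/-- The quotient of co-Minkowski space by `Γ_τ`. -/
abbrev CoQuotient {d : ℕ} {Γ : Subgroup (OPlus d)} (τ : Z1 Γ) :=
  MulAction.orbitRel.Quotient (deformed τ) (CoMink d)

/-- The projection of co-Minkowski space onto its quotient by `Γ_τ`. -/
def proj {d : ℕ} {Γ : Subgroup (OPlus d)} (τ : Z1 Γ) (p : CoMink d) : CoQuotient τ :=
  Quotient.mk _ p

/-- A subset `C` of the quotient is geodesically convex if every geodesic segment of the quotient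
with endpoints in `C` lies in `C`. The geodesics of the quotient are the projections of those of
co-Minkowski space. -/
def IsGeodConvex {d : ℕ} {Γ : Subgroup (OPlus d)} (τ : Z1 Γ) (C : Set (CoQuotient τ)) : Prop :=
  ∀ γ : ℝ → CoMink d, IsGeodesic γ → proj τ (γ 0) ∈ C → proj τ (γ 1) ∈ C →
    ∀ t ∈ Set.Icc (0 : ℝ) 1, proj τ (γ t) ∈ C

/-- The non-empty closed convex subsets of the quotient by `Γ_τ`. -/
def convexSets {d : ℕ} {Γ : Subgroup (OPlus d)} (τ : Z1 Γ) : Set (Set (CoQuotient τ)) :=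
  {C | C.Nonempty ∧ IsClosed C ∧ IsGeodConvex τ C}

/-- The convex core `CC(τ)`, the smallest non-empty closed convex subset. -/
def convexCore {d : ℕ} {Γ : Subgroup (OPlus d)} (τ : Z1 Γ) : Set (CoQuotient τ) :=
  ⋂₀ convexSets τ

/-- `Vol(CC(τ))`. -/
def coreVolume {d : ℕ} {Γ : Subgroup (OPlus d)} (τ : Z1 Γ) : ENNReal :=
  quotientMeasure (deformed τ) (coVolume d) (convexCore τ)

/-! ## Equivariant maps, boundary maps, convex hulls, mean maps -/

/-- The action on functions:
`(A,v)h (x) = L(x)/L(A⁻¹·x) h(A⁻¹·x) + ⟨x, v̄⟩ - v_{d+1}`. -/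
def actFun {d : ℕ} (g : CoIsom d) (h : Ball d → ℝ) (x : Ball d) : ℝ :=
  L (x : E d) / L ((g.lin⁻¹ • x : Ball d) : E d) * h (g.lin⁻¹ • x) + lor (hom (x : E d)) g.trans

/-- `h` is `τ`-equivariant: it is continuous and its graph is invariant under `Γ_τ`. -/
def IsEquivariant {d : ℕ} {Γ : Subgroup (OPlus d)} (τ : Z1 Γ) (h : Ball d → ℝ) : Prop :=
  Continuous h ∧ ∀ g ∈ deformed τ, actFun g h = h

/-- `h` extends continuously as `b` on `∂B^d`. -/
def ExtendsBy {d : ℕ} (h : Ball d → ℝ) (b : Sphere d → ℝ) : Prop :=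
  ∀ ξ : Sphere d, Tendsto h (comap (Subtype.val : Ball d → E d) (𝓝 (ξ : E d))) (𝓝 (b ξ))

/-- `b` is continuous, `τ`-equivariant maps exist, and all of them extend continuously as `b`. -/
def IsBoundaryMap {d : ℕ} {Γ : Subgroup (OPlus d)} (τ : Z1 Γ) (b : Sphere d → ℝ) : Prop :=
  Continuous b ∧ (∃ h, IsEquivariant τ h) ∧ ∀ h, IsEquivariant τ h → ExtendsBy h b

/-- The boundary map `b_τ`. -/
def boundaryMap {d : ℕ} {Γ : Subgroup (OPlus d)} (τ : Z1 Γ) : Sphere d → ℝ :=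
  Classical.epsilon (IsBoundaryMap τ)

/-- `h_b^-`, the supremum of the affine functions that are at most `b` on `∂B^d`. -/
def lowerHull {d : ℕ} (b : Sphere d → ℝ) (x : Ball d) : ℝ :=
  sSup {r | ∃ a : E d →ᵃ[ℝ] ℝ, (∀ ξ : Sphere d, a ξ ≤ b ξ) ∧ r = a x}

/-- `h_b^+ = - h_{-b}^-`. -/
def upperHull {d : ℕ} (b : Sphere d → ℝ) (x : Ball d) : ℝ := -lowerHull (-b) x

/-- `h_τ^-`. -/
def hMinus {d : ℕ} {Γ : Subgroup (OPlus d)} (τ : Z1 Γ) : Ball d → ℝ := lowerHull (boundaryMap τ)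

/-- `h_τ^+`. -/
def hPlus {d : ℕ} {Γ : Subgroup (OPlus d)} (τ : Z1 Γ) : Ball d → ℝ := upperHull (boundaryMap τ)

open Classical in
/-- Extension of a function on `B^d` by zero. -/
def ext0 {d : ℕ} (h : Ball d → ℝ) (x : E d) : ℝ :=
  if hx : x ∈ Metric.ball (0 : E d) 1 then h ⟨x, hx⟩ else 0

/-- The second fundamental form `L⁻¹ Hess h` of the graph of `h`, as a matrix. -/
def secondForm {d : ℕ} (h : Ball d → ℝ) (x : Ball d) : Matrix (Fin d) (Fin d) ℝ :=
  fun i j => (L (x : E d))⁻¹ * fderiv ℝ (fderiv ℝ (ext0 h)) x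
    (EuclideanSpace.single i 1) (EuclideanSpace.single j 1)

/-- The mean curvature: `1/d` times the trace of the second fundamental form with respect to the
hyperbolic metric. -/
def meanCurv {d : ℕ} (h : Ball d → ℝ) (x : Ball d) : ℝ :=
  (1 / d) * ((hypMetric (x : E d))⁻¹ * secondForm h x).trace

/-- `h` is a smooth `τ`-equivariant map with vanishing mean curvature. -/
def IsMeanMap {d : ℕ} {Γ : Subgroup (OPlus d)} (τ : Z1 Γ) (h : Ball d → ℝ) : Prop :=
  ContDiffOn ℝ ∞ (ext0 h) (Metric.ball 0 1) ∧ IsEquivariant τ h ∧ ∀ x, meanCurv h x = 0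

/-- `h_τ^mean`. -/
def hMean {d : ℕ} {Γ : Subgroup (OPlus d)} (τ : Z1 Γ) : Ball d → ℝ :=
  Classical.epsilon (IsMeanMap τ)

/-- The `S₁` norm of a cocycle, `∫_{ℍ^d/Γ} (h_τ^mean - h_τ^-)`. -/
def S1 {d : ℕ} {Γ : Subgroup (OPlus d)} (τ : Z1 Γ) : ℝ :=
  ∫ q, descend Γ (fun x => hMean τ x - hMinus τ x) q ∂(quotientMeasure Γ (hypVolume d))

end CoMinkowski

end

open CoMinkowski MeasureTheory

namespace CoMinkowski

/-! ## The Lorentzian form and affine functions -/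

section Lorentz

variable {d : ℕ}

/-! Everything is governed by the functions `x ↦ lor (hom x) w`, which are exactly the affine
functions on `ℝ^d`. They carry the weight `L` under the group (`lor_hom_smul`), so an equivariant
map is a section whose graph is moved by affine functions, and coboundaries correspond to
equivariant affine maps.

Boundary values. Averaging affine functions with a locally finite bump family gives an equivariant
map (`exists_isEquivariant`). Two equivariant maps differ by an invariant function, which
cocompactness bounds by a multiple of `L`; hence they share their boundary values. These exist
because, for `u = L⁻¹ h`, the combination `u (t + a) + u (t - a) - 2 cosh a * u t` along a ray
annihilates the linear terms added by the group. It is therefore bounded uniformly, and `exp (-t) *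
u` converges uniformly in the direction (`exists_abs_exp_mul_sub_le`).

Mean map. Vanishing mean curvature is the linear equation `∑ (δ_ij - x_i x_j) ∂_i ∂_j h = 0`
(`meanCurv_eq`). It has a maximum principle, and the explicit kernel `L ^ (d + 1) / (1 - ⟨η, x⟩) ^
d` solves its Dirichlet problem at infinity. Uniqueness for given boundary values turns the
equivariance of `b_τ` into equivariance of the solution.

Convex core. Geodesics trace the straight segments of the cylinder, so the region between the two
hulls, an intersection of half-spaces, is convex. Conversely, every orbit accumulates at every point
at infinity, so the closure in `ℝ^d × ℝ` of a nonempty closed convex invariant set contains the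
graph of `b_τ`; Hahn-Banach separation then puts the whole region inside the set
(`hullRegion_subset_preimage`). A strict fundamental domain and Fubini give the volume
(`coreVolume_eq`).

Norm. The lower hull is superadditive and positively homogeneous in the boundary map, and `h⁺_τ =
-h⁻_{-τ}`, whence the triangle inequality and homogeneity. Zero volume makes the hulls coincide;
they are then convex and concave, hence affine, and `τ` is a coboundary. In the `S₁` norms of `τ`
and `-τ` the mean maps cancel, being odd in `τ`. -/

theorem lor_add_right (x y z : Mink d) : lor x (y + z) = lor x y + lor x z := by
  simp only [lor, Prod.fst_add, Prod.snd_add, inner_add_right]; ring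

theorem lor_add_left (x y z : Mink d) : lor (x + y) z = lor x z + lor y z := by
  simp only [lor, Prod.fst_add, Prod.snd_add, inner_add_left]; ring

theorem lor_smul_right (a : ℝ) (x y : Mink d) : lor x (a • y) = a * lor x y := by
  simpa using lor_smul_smul 1 a x y

theorem lor_smul_left (a : ℝ) (x y : Mink d) : lor (a • x) y = a * lor x y := by
  simpa using lor_smul_smul a 1 x y

theorem lor_neg_right (x y : Mink d) : lor x (-y) = -lor x y := by
  simpa using lor_smul_right (-1) x y

theorem lor_sub_right (x y z : Mink d) : lor x (y - z) = lor x y - lor x z := by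
  rw [sub_eq_add_neg, lor_add_right, lor_neg_right, sub_eq_add_neg]

theorem lor_zero_right (x : Mink d) : lor x 0 = 0 := by simp [lor]

theorem lor_comm (x y : Mink d) : lor x y = lor y x := by
  simp only [lor, real_inner_comm, mul_comm]

theorem lor_hom (x : E d) (w : Mink d) : lor (hom x) w = inner ℝ x w.1 - w.2 := by
  simp [lor, hom]

theorem continuous_lor_hom (w : Mink d) : Continuous fun x : E d => lor (hom x) w := by
  simp only [lor_hom]; fun_prop

/-- The affine function `x ↦ ⟨(x, 1), w⟩`. -/
noncomputable def affOf (w : Mink d) : E d →ᵃ[ℝ] ℝ :=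
  (innerSL ℝ w.1 : E d →ₗ[ℝ] ℝ).toAffineMap - AffineMap.const ℝ (E d) w.2

theorem affOf_apply (w : Mink d) (x : E d) : affOf w x = lor (hom x) w := by
  simp [affOf, lor_hom, real_inner_comm]

theorem exists_eq_affOf (a : E d →ᵃ[ℝ] ℝ) : ∃ w, a = affOf w := by
  refine ⟨((InnerProductSpace.toDual ℝ (E d)).symm a.linear.toContinuousLinearMap, -a 0), ?_⟩
  ext x
  rw [affOf_apply, lor_hom, real_inner_comm, InnerProductSpace.toDual_symm_apply]
  have := congrFun a.decomp x
  simp only [Pi.add_apply] at this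
  simp [this]

theorem eq_zero_of_lor_hom_eq_zero {w : Mink d} (h : ∀ x : Ball d, lor (hom (x : E d)) w = 0) :
    w = 0 := by
  have h0 := h ⟨0, by simp⟩
  rw [lor_hom] at h0
  simp only [inner_zero_left, zero_sub, neg_eq_zero] at h0
  have h1 : w.1 = 0 := by
    by_contra hne
    have hpos : 0 < ‖w.1‖ := norm_pos_iff.2 hne
    -- The point of norm `1/2` in the direction of `w.1`, where the pairing is `‖w.1‖ / 2`.
    have := h ⟨(2 * ‖w.1‖)⁻¹ • w.1, by
      rw [mem_ball_zero_iff, norm_smul, norm_inv, norm_mul, norm_norm]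
      simp only [Real.norm_ofNat]
      field_simp
      norm_num⟩
    rw [lor_hom, h0, real_inner_smul_left, real_inner_self_eq_norm_sq] at this
    field_simp at this
    simp at this
    exact hne this
  exact Prod.ext h1 h0

end Lorentz

/-! ## The projective action on the closed ball -/

section Action

variable {d : ℕ}

/-- The last coordinate of `A (x, 1)`. -/
noncomputable def factor (A : OPlus d) (x : E d) : ℝ := (A.1 (hom x)).2

/-- The projective action of `A` on `ℝ^d`, where defined. -/
noncomputable def projAct (A : OPlus d) (x : E d) : E d := (factor A x)⁻¹ • (A.1 (hom x)).1

theorem factor_pos (A : OPlus d) (x : Ball d) : 0 < factor A x := snd_apply_hom_pos A x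

theorem factor_eq (A : OPlus d) (x : Ball d) :
    factor A x = L (x : E d) / L ((A • x : Ball d) : E d) := by
  rw [factor, apply_hom_eq]; simp [hom]

theorem continuous_apply (A : OPlus d) : Continuous (A.1 : Mink d → Mink d) :=
  (A.1 : Mink d →ₗ[ℝ] Mink d).continuous_of_finiteDimensional

theorem continuous_hom : Continuous (hom : E d → Mink d) := by
  unfold hom; fun_prop

theorem continuous_factor (A : OPlus d) : Continuous (factor A) :=
  continuous_snd.comp ((continuous_apply A).comp continuous_hom)

/-- Nonnegative as a radial limit of positive factors. If it vanished, the lightlike vector `A (ξ,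
1)` would have last coordinate zero, hence be zero, against injectivity of `A`. -/
theorem factor_sphere_pos (A : OPlus d) (ξ : Sphere d) : 0 < factor A ξ := by
  have hn : ‖(ξ : E d)‖ = 1 := by simp
  have hnn : 0 ≤ factor A ξ := by
    have hlim : Tendsto (fun t : ℝ => factor A (t • (ξ : E d))) (𝓝[<] 1) (𝓝 (factor A ξ)) := by
      have : Continuous fun t : ℝ => factor A (t • (ξ : E d)) :=
        (continuous_factor A).comp (by fun_prop)
      simpa using (this.tendsto 1).mono_left nhdsWithin_le_nhds
    refine ge_of_tendsto hlim ?_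
    filter_upwards [Ioo_mem_nhdsLT (show (0 : ℝ) < 1 by norm_num)] with t ht
    refine (factor_pos A ⟨t • (ξ : E d), ?_⟩).le
    rw [mem_ball_zero_iff, norm_smul, hn, mul_one, Real.norm_of_nonneg ht.1.le]
    exact ht.2
  refine lt_of_le_of_ne hnn fun h0 => ?_
  have h1 := A.2.1 (hom (ξ : E d)) (hom (ξ : E d))
  rw [lor_hom_self, hn] at h1
  simp only [lor, real_inner_self_eq_norm_sq] at h1
  change _ - factor A ξ * factor A ξ = _ at h1
  rw [← h0] at h1
  have h2 : (A.1 (hom (ξ : E d))).1 = 0 := by simpa using h1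
  have h3 : A.1 (hom (ξ : E d)) = 0 := Prod.ext h2 h0.symm
  have h4 : hom (ξ : E d) = 0 := by simpa using h3
  simpa [hom] using congrArg Prod.snd h4

theorem apply_hom_eq_smul (A : OPlus d) {x : E d} (h : 0 < factor A x) :
    A.1 (hom x) = factor A x • hom (projAct A x) := by
  refine Prod.ext ?_ ?_
  · change _ = _ • (_⁻¹ • _)
    rw [smul_smul, mul_inv_cancel₀ h.ne', one_smul]
  · simp [hom, factor]

theorem continuousAt_projAct (A : OPlus d) {x : E d} (h : 0 < factor A x) :
    ContinuousAt (projAct A) x :=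
  ((continuous_factor A).continuousAt.inv₀ h.ne').smul
    (continuous_fst.comp ((continuous_apply A).comp continuous_hom)).continuousAt

theorem norm_projAct_sphere (A : OPlus d) (ξ : Sphere d) : ‖projAct A ξ‖ = 1 := by
  have h := factor_sphere_pos A ξ
  have h1 := A.2.1 (hom (ξ : E d)) (hom (ξ : E d))
  rw [apply_hom_eq_smul A h, lor_smul_smul, lor_hom_self, lor_hom_self] at h1
  have h2 : ‖(ξ : E d)‖ = 1 := by simp
  rw [h2] at h1
  have h3 : ‖projAct A ξ‖ ^ 2 = 1 := by
    have : (factor A ξ * factor A ξ) * (‖projAct A (ξ : E d)‖ ^ 2 - 1) = 0 := by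
      rw [h1]; norm_num
    rcases mul_eq_zero.1 this with h' | h'
    · exact absurd h' (by positivity)
    · linarith
  nlinarith [norm_nonneg (projAct A (ξ : E d))]

/-- The action of `A` on the sphere at infinity. -/
noncomputable def sphereAct (A : OPlus d) (ξ : Sphere d) : Sphere d :=
  ⟨projAct A ξ, mem_sphere_zero_iff_norm.2 (norm_projAct_sphere A ξ)⟩

theorem sphereAct_mul (A B : OPlus d) (ξ : Sphere d) :
    sphereAct (A * B) ξ = sphereAct A (sphereAct B ξ) := by
  apply Subtype.ext
  change projAct (A * B) ξ = projAct A (projAct B ξ)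
  have hB := factor_sphere_pos B ξ
  have h : (A * B).1 (hom (ξ : E d)) = factor B ξ • A.1 (hom (projAct B ξ)) := by
    rw [← map_smul, ← apply_hom_eq_smul B hB]; rfl
  simp only [projAct, factor] at h ⊢
  rw [h]
  simp only [Prod.smul_fst, Prod.smul_snd, smul_smul, smul_eq_mul]
  congr 1
  have := hB.ne'
  simp only [factor] at this
  field_simp

theorem sphereAct_one (ξ : Sphere d) : sphereAct 1 ξ = ξ := by
  apply Subtype.ext
  change projAct 1 (ξ : E d) = ξ
  simp [projAct, factor, hom]

instance : ContinuousConstSMul (OPlus d) (Ball d) where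
  continuous_const_smul A := by
    refine Continuous.subtype_mk (continuous_iff_continuousAt.2 fun x => ?_) _
    exact (continuousAt_projAct A (factor_pos A x)).comp continuous_subtype_val.continuousAt

/-- Invariance of the form. Affine functions thus carry the same weight as heights in co-Minkowski
space, which lets translation parts pass through the action. -/
theorem lor_hom_smul (A : OPlus d) (x : Ball d) (w : Mink d) :
    lor (hom ((A • x : Ball d) : E d)) (A.1 w) =
      L ((A • x : Ball d) : E d) / L (x : E d) * lor (hom (x : E d)) w := by
  have h1 := (L_pos x).ne'
  have h2 := (L_pos (A • x)).ne'
  rw [← A.2.1 (hom (x : E d)) w, apply_hom_eq A x, lor_smul_left]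
  field_simp

theorem lor_hom_sphereAct (A : OPlus d) (ξ : Sphere d) (w : Mink d) :
    lor (hom (sphereAct A ξ : E d)) (A.1 w) = (factor A ξ)⁻¹ * lor (hom (ξ : E d)) w := by
  have h := factor_sphere_pos A ξ
  rw [← A.2.1 (hom (ξ : E d)) w, apply_hom_eq_smul A h, lor_smul_left]
  have := h.ne'
  change _ = (factor A (ξ : E d))⁻¹ * (factor A (ξ : E d) * _)
  field_simp
  rfl

theorem continuous_L : Continuous (L : E d → ℝ) := by
  unfold L; fun_prop

theorem L_sphere (ξ : Sphere d) : L (ξ : E d) = 0 := by simp [L]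

theorem L_le_one (x : E d) : L x ≤ 1 := by
  refine Real.sqrt_le_one.2 ?_; nlinarith [sq_nonneg ‖x‖]

/-- The filter of neighbourhoods in the ball of a point at infinity. -/
theorem comap_neBot (ξ : Sphere d) :
    (comap (Subtype.val : Ball d → E d) (𝓝 (ξ : E d))).NeBot := by
  rw [comap_neBot_iff]
  intro s hs
  have : (ξ : E d) ∈ closure (Metric.ball (0 : E d) 1) := by
    rw [closure_ball _ one_ne_zero]; exact Metric.sphere_subset_closedBall ξ.2
  obtain ⟨y, hy, hy'⟩ := mem_closure_iff_nhds.1 this s hs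
  exact ⟨⟨y, hy'⟩, hy⟩

theorem tendsto_L_comap (ξ : Sphere d) :
    Tendsto (fun x : Ball d => L (x : E d)) (comap (Subtype.val : Ball d → E d) (𝓝 (ξ : E d)))
      (𝓝 0) := by
  rw [← L_sphere ξ]
  exact (continuous_L.tendsto _).comp tendsto_comap

theorem tendsto_smul_comap (A : OPlus d) (ξ : Sphere d) :
    Tendsto (fun x : Ball d => A • x) (comap (Subtype.val : Ball d → E d) (𝓝 (ξ : E d)))
      (comap (Subtype.val : Ball d → E d) (𝓝 (sphereAct A ξ : E d))) := by
  rw [tendsto_comap_iff]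
  exact (continuousAt_projAct A (factor_sphere_pos A ξ)).tendsto.comp tendsto_comap

end Action

/-! ## Equivariant maps -/

section Equivariant

variable {d : ℕ} {Γ : Subgroup (OPlus d)}

/-- Evaluating at `A • x` removes the inverse from `actFun`; this is the form of equivariance used
from here on. -/
theorem isEquivariant_iff {τ : Z1 Γ} {h : Ball d → ℝ} :
    IsEquivariant τ h ↔ Continuous h ∧ ∀ (A : Γ) (x : Ball d),
      h (A.1 • x) = L ((A.1 • x : Ball d) : E d) / L (x : E d) * h x +
        lor (hom ((A.1 • x : Ball d) : E d)) (Z1.val τ A) := by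
  refine and_congr_right fun _ => ⟨fun H A x => ?_, ?_⟩
  · have := congrFun (H ⟨A.1, Z1.val τ A⟩ ⟨A, rfl⟩) (A.1 • x)
    simp only [actFun, inv_smul_smul] at this
    exact this.symm
  · rintro H _ ⟨A, rfl⟩
    ext x
    have := H A (A.1⁻¹ • x)
    simp only [smul_inv_smul] at this
    exact this.symm

theorem IsEquivariant.smul_eq {τ : Z1 Γ} {h : Ball d → ℝ} (H : IsEquivariant τ h) (A : Γ)
    (x : Ball d) : h (A.1 • x) = L ((A.1 • x : Ball d) : E d) / L (x : E d) * h x +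
        lor (hom ((A.1 • x : Ball d) : E d)) (Z1.val τ A) :=
  (isEquivariant_iff.1 H).2 A x

theorem IsEquivariant.sub_isGammaInvariant {τ : Z1 Γ} {h h' : Ball d → ℝ}
    (H : IsEquivariant τ h) (H' : IsEquivariant τ h') :
    IsGammaInvariant Γ fun x => h x - h' x := by
  intro A hA x
  have h1 := (L_pos x).ne'
  have h2 := (L_pos (A • x)).ne'
  have e := H.smul_eq ⟨A, hA⟩ x
  have e' := H'.smul_eq ⟨A, hA⟩ x
  simp only at e e' ⊢
  rw [e, e']
  field_simp
  ring

/-- The graph of `L` is invariant under the linear action. Varying `c` gives an equivariant graph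
through any prescribed point. -/
theorem IsEquivariant.add_mul_L {τ : Z1 Γ} {h : Ball d → ℝ} (H : IsEquivariant τ h) (c : ℝ) :
    IsEquivariant τ fun x => h x + c * L (x : E d) := by
  refine isEquivariant_iff.2 ⟨H.1.add (continuous_const.mul
    (continuous_L.comp continuous_subtype_val)), fun A x => ?_⟩
  simp only [H.smul_eq A x]
  have h1 := (L_pos x).ne'
  field_simp
  ring

theorem Z1.val_add (τ τ' : Z1 Γ) (A : Γ) : Z1.val (τ + τ') A = Z1.val τ A + Z1.val τ' A := rfl

theorem Z1.val_smul (c : ℝ) (τ : Z1 Γ) (A : Γ) : Z1.val (c • τ) A = c • Z1.val τ A := rfl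

theorem IsEquivariant.add {τ τ' : Z1 Γ} {h h' : Ball d → ℝ} (H : IsEquivariant τ h)
    (H' : IsEquivariant τ' h') : IsEquivariant (τ + τ') fun x => h x + h' x := by
  refine isEquivariant_iff.2 ⟨H.1.add H'.1, fun A x => ?_⟩
  simp only [H.smul_eq A x, H'.smul_eq A x, Z1.val_add, lor_add_right]
  ring

theorem IsEquivariant.const_mul {τ : Z1 Γ} {h : Ball d → ℝ} (H : IsEquivariant τ h) (c : ℝ) :
    IsEquivariant (c • τ) fun x => c * h x := by
  refine isEquivariant_iff.2 ⟨continuous_const.mul H.1, fun A x => ?_⟩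
  simp only [H.smul_eq A x, Z1.val_smul, lor_smul_right]
  ring

/-- The affine function of `w` is equivariant for the cocycle `A ↦ w - A w`. -/
theorem isEquivariant_lor_hom_iff {τ : Z1 Γ} {w : Mink d} :
    IsEquivariant τ (fun x => lor (hom (x : E d)) w) ↔ ∀ A : Γ, Z1.val τ A = w - A.1.1 w := by
  rw [isEquivariant_iff]
  constructor
  · rintro ⟨-, H⟩ A
    have : Z1.val τ A - (w - A.1.1 w) = 0 := by
      refine eq_zero_of_lor_hom_eq_zero fun x => ?_
      have := H A (A.1⁻¹ • x)
      rw [← lor_hom_smul] at this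
      simp only [smul_inv_smul] at this
      rw [lor_sub_right, lor_sub_right, this]
      ring
    exact sub_eq_zero.1 this
  · refine fun H => ⟨(continuous_lor_hom w).comp continuous_subtype_val, fun A x => ?_⟩
    rw [H A, ← lor_hom_smul, lor_sub_right]
    ring

end Equivariant

end CoMinkowski

namespace CoMinkowski

/-! ## Compactness of the quotient -/

section Compactness

variable {d : ℕ} {Γ : Subgroup (OPlus d)}

instance : ContinuousConstSMul Γ (Ball d) where
  continuous_const_smul A := continuous_const_smul A.1

/-- These sets are closed in `ℝ^d`, as `L` vanishes on and outside the sphere. They play the role of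
closed hyperbolic balls around the origin and exhaust `B^d`. -/
theorem isCompact_superlevel_L {l : ℝ} (hl : 0 < l) :
    IsCompact {x : Ball d | l ≤ L (x : E d)} := by
  rw [Subtype.isCompact_iff]
  have : Subtype.val '' {x : Ball d | l ≤ L (x : E d)} = {x : E d | l ≤ L x} := by
    ext x
    constructor
    · rintro ⟨y, hy, rfl⟩; exact hy
    · intro hx
      have h1 : 0 < 1 - ‖x‖ ^ 2 := Real.sqrt_pos.1 (hl.trans_le hx)
      exact ⟨⟨x, by rw [mem_ball_zero_iff]; nlinarith [norm_nonneg x]⟩, hx, rfl⟩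
  rw [this]
  refine (isCompact_closedBall (0 : E d) 1).of_isClosed_subset
    (isClosed_le continuous_const continuous_L) fun x hx => ?_
  have h1 : 0 < 1 - ‖x‖ ^ 2 := Real.sqrt_pos.1 (hl.trans_le hx)
  rw [mem_closedBall_zero_iff]; nlinarith [norm_nonneg x]

/-- The images of the sets `{1 / (n + 1) < L}` form an increasing open cover of the compact
quotient, so one of them is everything: each orbit meets a fixed compact set. -/
theorem IsCompactOrientedQuotient.exists_le_L (hΓ : IsCompactOrientedQuotient Γ) :
    ∃ l : ℝ, 0 < l ∧ ∀ x : Ball d, ∃ A : Γ, l < L ((A.1 • x : Ball d) : E d) := by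
  have := hΓ.compact
  let π : Ball d → HypQuotient Γ := fun x => Quotient.mk _ x
  have hπ : IsOpenMap π := isOpenMap_quotient_mk'_mul
  let V : ℕ → Set (HypQuotient Γ) := fun n => π '' {x : Ball d | (1 : ℝ) / (n + 1) < L (x : E d)}
  have hV : ∀ n, IsOpen (V n) := fun n =>
    hπ _ (isOpen_lt continuous_const (continuous_L.comp continuous_subtype_val))
  have hcov : (Set.univ : Set (HypQuotient Γ)) ⊆ ⋃ n, V n := by
    intro q _
    induction q using Quotient.inductionOn with
    | h x =>
      obtain ⟨n, hn⟩ := exists_nat_one_div_lt (L_pos x)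
      exact Set.mem_iUnion.2 ⟨n, x, hn, rfl⟩
  have hdir : Directed (· ⊆ ·) V := by
    refine Monotone.directed_le fun m n hmn => Set.image_mono fun x hx => ?_
    have : (1 : ℝ) / (n + 1) ≤ 1 / (m + 1) := by gcongr
    exact this.trans_lt hx
  obtain ⟨n, hn⟩ := isCompact_univ.elim_directed_cover V hV hcov hdir
  refine ⟨1 / (n + 1), by positivity, fun x => ?_⟩
  obtain ⟨y, hy, hyx⟩ := hn (Set.mem_univ (π x))
  obtain ⟨A, hA⟩ := Quotient.exact hyx
  exact ⟨A, by rw [show A.1 • x = y from hA]; exact hy⟩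

/-- The invariant function `L⁻¹ f` is determined by its values on a compact set, where it is
bounded. -/
theorem IsGammaInvariant.exists_abs_le (hΓ : IsCompactOrientedQuotient Γ) {f : Ball d → ℝ}
    (hf : Continuous f) (H : IsGammaInvariant Γ f) :
    ∃ C : ℝ, 0 ≤ C ∧ ∀ x : Ball d, |f x| ≤ C * L (x : E d) := by
  obtain ⟨l, hl, hA⟩ := hΓ.exists_le_L
  have hc : Continuous fun x : Ball d => (L (x : E d))⁻¹ * f x :=
    ((continuous_L.comp continuous_subtype_val).inv₀ fun x => (L_pos x).ne').mul hf
  obtain ⟨C, hC⟩ := (isCompact_superlevel_L (d := d) hl).exists_bound_of_continuousOn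
    hc.continuousOn
  refine ⟨|C|, abs_nonneg _, fun x => ?_⟩
  obtain ⟨A, hAx⟩ := hA x
  have h1 := hC (A.1 • x) hAx.le
  rw [H A.1 A.2 x, norm_mul, norm_inv, Real.norm_eq_abs, Real.norm_eq_abs, abs_of_pos (L_pos x),
    inv_mul_le_iff₀ (L_pos x)] at h1
  nlinarith [le_abs_self C, L_pos x]

/-- The difference of the two maps is invariant, hence `O(L)`, and `L` tends to `0` at infinity. -/
theorem IsEquivariant.extendsBy_of (hΓ : IsCompactOrientedQuotient Γ) {τ : Z1 Γ}
    {h h' : Ball d → ℝ} (H : IsEquivariant τ h) (H' : IsEquivariant τ h') {b : Sphere d → ℝ}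
    (hb : ExtendsBy h b) : ExtendsBy h' b := by
  intro ξ
  obtain ⟨C, -, hC⟩ := (H'.sub_isGammaInvariant H).exists_abs_le hΓ (H'.1.sub H.1)
  have h0 : Tendsto (fun x => h' x - h x) (comap (Subtype.val : Ball d → E d) (𝓝 (ξ : E d)))
      (𝓝 0) := by
    refine squeeze_zero_norm (fun x => hC x) ?_
    simpa using (tendsto_L_comap ξ).const_mul C
  simpa using h0.add (hb ξ)

end Compactness

/-! ## Existence of equivariant maps -/

section Existence

variable {d : ℕ} {Γ : Subgroup (OPlus d)}

/-- Proper discontinuity for the pair of compact sets `{l ≤ L}` and `{L x / 2 ≤ L}`, the latter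
being a neighbourhood of `x`. -/
theorem IsCompactOrientedQuotient.locallyFinite_bump (hΓ : IsCompactOrientedQuotient Γ) {l : ℝ}
    (hl : 0 < l) :
    LocallyFinite fun A : Γ => {x : Ball d | l ≤ L ((A.1⁻¹ • x : Ball d) : E d)} := by
  have := hΓ.properlyDiscontinuous
  intro x
  refine ⟨{y : Ball d | L (x : E d) / 2 < L (y : E d)}, ?_, ?_⟩
  · refine (isOpen_lt continuous_const (continuous_L.comp continuous_subtype_val)).mem_nhds ?_
    change L (x : E d) / 2 < L (x : E d)
    linarith [L_pos x]
  · refine (ProperlyDiscontinuousSMul.finite_disjoint_inter_image (Γ := Γ)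
      (isCompact_superlevel_L (d := d) hl)
      (isCompact_superlevel_L (d := d) (half_pos (L_pos x)))).subset ?_
    rintro A ⟨y, hy, hy'⟩
    have : y ∈ (A • ·) '' {x : Ball d | l ≤ L (x : E d)} ∩
        {x' : Ball d | L (x : E d) / 2 ≤ L (x' : E d)} :=
      ⟨⟨A.1⁻¹ • y, hy, smul_inv_smul A.1 y⟩, (show L (x : E d) / 2 < L (y : E d) from hy').le⟩
    exact ⟨y, this⟩

/-- The quotient `N / D` is the average of the affine functions of `τ(A)` with weights `φ (A⁻¹ •
x)`. Equivariance is an affine condition, so it survives averaging; `D` is positive because every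
orbit enters `{l < L}`. -/
theorem exists_isEquivariant (hΓ : IsCompactOrientedQuotient Γ) (τ : Z1 Γ) :
    ∃ h, IsEquivariant τ h := by
  obtain ⟨l, hl, hA⟩ := hΓ.exists_le_L
  let φ : Ball d → ℝ := fun x => max 0 (L (x : E d) - l)
  have hφc : Continuous φ :=
    continuous_const.max ((continuous_L.comp continuous_subtype_val).sub continuous_const)
  have hφ0 : ∀ x, 0 ≤ φ x := fun x => le_max_left _ _
  have hφs : ∀ x, φ x ≠ 0 → l ≤ L (x : E d) := by
    intro x hx
    by_contra hlt
    exact hx (max_eq_left (by linarith))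
  have hlf := hΓ.locallyFinite_bump hl
  have hpt : ∀ x : Ball d, {A : Γ | φ (A.1⁻¹ • x) ≠ 0}.Finite := fun x =>
    (hlf.point_finite x).subset fun A hA => hφs _ hA
  let N : Ball d → ℝ := fun x => ∑ᶠ A : Γ, φ (A.1⁻¹ • x) * lor (hom (x : E d)) (Z1.val τ A)
  let D : Ball d → ℝ := fun x => ∑ᶠ A : Γ, φ (A.1⁻¹ • x)
  have hc : ∀ A : Γ, Continuous fun x : Ball d => φ (A.1⁻¹ • x) := fun A =>
    hφc.comp (continuous_const_smul A.1⁻¹)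
  have hN : Continuous N := by
    refine continuous_finsum (fun A => (hc A).mul
      ((continuous_lor_hom _).comp continuous_subtype_val)) (hlf.subset fun A x hx => ?_)
    exact hφs _ (left_ne_zero_of_mul hx)
  have hD : Continuous D := continuous_finsum hc (hlf.subset fun A x hx => hφs _ hx)
  have hDpos : ∀ x, 0 < D x := by
    intro x
    obtain ⟨A, hAx⟩ := hA x
    refine finsum_pos (fun B => hφ0 _) ⟨A⁻¹, ?_⟩ (hpt x)
    refine lt_max_of_lt_right ?_
    simpa using hAx
  have hDinv : ∀ (B : Γ) (x : Ball d), D (B.1 • x) = D x := by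
    intro B x
    change ∑ᶠ A : Γ, φ (A.1⁻¹ • B.1 • x) = ∑ᶠ A : Γ, φ (A.1⁻¹ • x)
    rw [← finsum_comp_equiv (Equiv.mulLeft B)]
    refine finsum_congr fun A => ?_
    simp [mul_smul]
  have hNeq : ∀ (B : Γ) (x : Ball d), N (B.1 • x) =
      L ((B.1 • x : Ball d) : E d) / L (x : E d) * N x +
        D x * lor (hom ((B.1 • x : Ball d) : E d)) (Z1.val τ B) := by
    intro B x
    change ∑ᶠ A : Γ, φ (A.1⁻¹ • B.1 • x) * _ =
      _ * ∑ᶠ A : Γ, φ (A.1⁻¹ • x) * lor (hom (x : E d)) (Z1.val τ A) + (∑ᶠ A : Γ, φ (A.1⁻¹ • x)) * _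
    -- Reindexing by `A ↦ B * A` turns the weight into `φ (A⁻¹ • x)`, and the cocycle relation for
    -- `τ (B * A)` splits off the term `D x * ⟨B • x, τ B⟩`.
    rw [← finsum_comp_equiv (Equiv.mulLeft B), mul_finsum, finsum_mul,
      ← finsum_add_distrib]
    · refine finsum_congr fun A => ?_
      have e1 : ((B * A : Γ) : OPlus d)⁻¹ • B.1 • x = A.1⁻¹ • x := by simp [mul_smul]
      rw [Equiv.coe_mulLeft, e1, Z1.val_mul, lor_add_right, lor_hom_smul]
      ring
    all_goals exact (hpt x).subset fun A hA hz => hA (by simp [hz])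
  refine ⟨fun x => N x / D x, isEquivariant_iff.2 ⟨hN.div hD fun x => (hDpos x).ne', ?_⟩⟩
  intro B x
  have := (hDpos x).ne'
  simp only [hNeq, hDinv]
  field_simp

end Existence

/-! ## Almost solutions of a linear differential equation -/

/-- Induction over steps of length `a`: the increments of `exp (-t) * v t` contract by `exp (-2a)`
up to the error of the recursion. The constant `16` reproduces itself because `17 * 0.37 ≤ 16`,
where `exp (-a) ≤ 0.37` comes from `1 ≤ a`. The start of the induction needs `v` on `[0, 2a]`,
inside `[0, 4]`. -/
theorem abs_exp_mul_add_sub_le {v : ℝ → ℝ} {C a : ℝ} (ha : 1 ≤ a) (ha' : a ≤ 2)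
    (hv : ∀ t, |v (t + a) + v (t - a) - 2 * Real.cosh a * v t| ≤ C)
    (h0 : ∀ t, 0 ≤ t → t ≤ 4 → |v t| ≤ C) {t : ℝ} (ht : 0 ≤ t) :
    |Real.exp (-(t + a)) * v (t + a) - Real.exp (-t) * v t| ≤ 16 * C * Real.exp (-t) := by
  have hC : 0 ≤ C := (abs_nonneg _).trans (h0 0 le_rfl (by norm_num))
  have e1 : Real.exp (-a) ≤ 0.37 := by
    calc Real.exp (-a) ≤ Real.exp (-1) := Real.exp_le_exp.2 (by linarith)
      _ ≤ 0.37 := by have := Real.exp_neg_one_lt_d9; linarith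
  have key : ∀ n : ℕ, ∀ t, 0 ≤ t → t ≤ (n + 1) * a →
      |Real.exp (-(t + a)) * v (t + a) - Real.exp (-t) * v t| ≤ 16 * C * Real.exp (-t) := by
    have base : ∀ t, 0 ≤ t → t ≤ a →
        |Real.exp (-(t + a)) * v (t + a) - Real.exp (-t) * v t| ≤ 16 * C * Real.exp (-t) := by
      intro t ht hta
      have b1 := h0 t ht (by linarith)
      have b2 := h0 (t + a) (by linarith) (by linarith)
      have b3 : Real.exp (-(t + a)) ≤ Real.exp (-t) := Real.exp_le_exp.2 (by linarith)
      calc _ ≤ |Real.exp (-(t + a)) * v (t + a)| + |Real.exp (-t) * v t| := abs_sub _ _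
        _ = Real.exp (-(t + a)) * |v (t + a)| + Real.exp (-t) * |v t| := by
          rw [abs_mul, abs_mul, Real.abs_exp, Real.abs_exp]
        _ ≤ Real.exp (-t) * C + Real.exp (-t) * C := by gcongr
        _ ≤ _ := by nlinarith [Real.exp_pos (-t), mul_nonneg hC (Real.exp_pos (-t)).le]
    intro n
    induction n with
    | zero => intro t ht hta; exact base t ht (by simpa using hta)
    | succ n ih =>
      intro t ht hta
      rcases le_or_gt t a with hle | hgt
      · exact base t ht hle
      have ih' := ih (t - a) (by linarith) (by push_cast at hta; linarith)
      rw [sub_add_cancel] at ih'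
      have hvt := hv t
      set δ := Real.exp (-(t + a)) * v (t + a) - Real.exp (-t) * v t
      set δ' := Real.exp (-t) * v t - Real.exp (-(t - a)) * v (t - a)
      have p1 : Real.exp (-a) * Real.exp a = 1 := by rw [← Real.exp_add]; simp
      have e2 : Real.exp (-(t + a)) = Real.exp (-t) * Real.exp (-a) := by
        rw [← Real.exp_add]; congr 1; ring
      have e3 : Real.exp (-(t - a)) = Real.exp (-t) * Real.exp a := by
        rw [← Real.exp_add]; congr 1; ring
      -- The recursion has characteristic roots `exp a` and `exp (-a)`; after the factor `exp (-t)`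
      -- they become `1`, invisible to increments, and `exp (-2a)`.
      have hδ : δ = Real.exp (-a) ^ 2 * δ' + Real.exp (-t) * Real.exp (-a) *
          (v (t + a) + v (t - a) - 2 * Real.cosh a * v t) := by
        simp only [δ, δ', e2, e3, Real.cosh_eq]
        linear_combination (Real.exp (-t) * v t + Real.exp (-t) * Real.exp (-a) * v (t - a)) * p1
      rw [e3] at ih'
      rw [hδ]
      have hp := Real.exp_pos (-t)
      have hq := Real.exp_pos (-a)
      calc _ ≤ |Real.exp (-a) ^ 2 * δ'| + |Real.exp (-t) * Real.exp (-a) *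
          (v (t + a) + v (t - a) - 2 * Real.cosh a * v t)| := abs_add_le _ _
        _ = Real.exp (-a) ^ 2 * |δ'| + Real.exp (-t) * Real.exp (-a) *
          |v (t + a) + v (t - a) - 2 * Real.cosh a * v t| := by
          rw [abs_mul, abs_mul, abs_of_pos (by positivity : 0 < Real.exp (-a) ^ 2),
            abs_of_pos (mul_pos hp hq)]
        _ ≤ Real.exp (-a) ^ 2 * (16 * C * (Real.exp (-t) * Real.exp a)) +
            Real.exp (-t) * Real.exp (-a) * C := by gcongr
        _ = 17 * C * Real.exp (-t) * Real.exp (-a) := by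
          linear_combination (16 * C * Real.exp (-t) * Real.exp (-a)) * p1
        _ ≤ 17 * C * Real.exp (-t) * 0.37 := by gcongr
        _ ≤ _ := by nlinarith [mul_nonneg hC hp.le]
  obtain ⟨n, hn⟩ := exists_nat_ge t
  exact key n t ht (by nlinarith)

/-- An almost solution of the equation is asymptotic to a multiple of the exponential. -/
theorem exists_abs_exp_mul_sub_le {v : ℝ → ℝ} {C : ℝ}
    (hv : ∀ a, 1 ≤ a → a ≤ 2 → ∀ t, |v (t + a) + v (t - a) - 2 * Real.cosh a * v t| ≤ C)
    (h0 : ∀ t, 0 ≤ t → t ≤ 4 → |v t| ≤ C) :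
    ∃ c, ∀ t, 0 ≤ t → |Real.exp (-t) * v t - c| ≤ 32 * C * Real.exp (-t) := by
  have hC : 0 ≤ C := (abs_nonneg _).trans (h0 0 le_rfl (by norm_num))
  set y : ℝ → ℝ := fun t => Real.exp (-t) * v t with hy
  -- Summing the increments as a geometric series; `32 * 0.37 + 16 ≤ 32`.
  have step : ∀ a, 1 ≤ a → a ≤ 2 → ∀ n : ℕ, ∀ t, 0 ≤ t →
      |y (t + n * a) - y t| ≤ 32 * C * Real.exp (-t) := by
    intro a ha ha' n
    have e1 : Real.exp (-a) ≤ 0.37 := by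
      calc Real.exp (-a) ≤ Real.exp (-1) := Real.exp_le_exp.2 (by linarith)
        _ ≤ 0.37 := by have := Real.exp_neg_one_lt_d9; linarith
    induction n with
    | zero => intro t ht; simp; positivity
    | succ n ih =>
      intro t ht
      have h1 := ih (t + a) (by linarith)
      have h2 := abs_exp_mul_add_sub_le ha ha' (hv a ha ha') h0 ht
      have e2 : Real.exp (-(t + a)) = Real.exp (-t) * Real.exp (-a) := by
        rw [← Real.exp_add]; congr 1; ring
      have e3 : t + ((n + 1 : ℕ) : ℝ) * a = t + a + n * a := by push_cast; ring
      have hp := Real.exp_pos (-t)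
      rw [e3]
      calc |y (t + a + n * a) - y t| ≤ |y (t + a + n * a) - y (t + a)| + |y (t + a) - y t| :=
            abs_sub_le _ _ _
        _ ≤ 32 * C * Real.exp (-(t + a)) + 16 * C * Real.exp (-t) := add_le_add h1 h2
        _ = 32 * C * Real.exp (-t) * Real.exp (-a) + 16 * C * Real.exp (-t) := by rw [e2]; ring
        _ ≤ 32 * C * Real.exp (-t) * 0.37 + 16 * C * Real.exp (-t) := by gcongr
        _ ≤ _ := by nlinarith [mul_nonneg hC hp.le]
  -- A gap of length at least `1` is a whole number of equal steps of length in `[1, 2]`; this is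
  -- why `a` ranges over that interval. No regularity of `v` is needed.
  have far : ∀ t s, 0 ≤ t → t + 1 ≤ s → |y s - y t| ≤ 32 * C * Real.exp (-t) := by
    intro t s ht hs
    have hn : 0 < ⌊s - t⌋₊ := Nat.floor_pos.2 (by linarith)
    have hn' : (1 : ℝ) ≤ ⌊s - t⌋₊ := by exact_mod_cast hn
    have h1 := Nat.floor_le (show 0 ≤ s - t by linarith)
    have h2 := Nat.lt_floor_add_one (s - t)
    have := step ((s - t) / ⌊s - t⌋₊) ((one_le_div₀ (by linarith)).2 h1)
      ((div_le_iff₀ (by linarith)).2 (by linarith)) ⌊s - t⌋₊ t ht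
    rwa [mul_div_cancel₀ _ (by linarith : (⌊s - t⌋₊ : ℝ) ≠ 0), add_sub_cancel] at this
  have hexp : Tendsto (fun t : ℝ => 32 * C * Real.exp (-t)) atTop (𝓝 0) := by
    simpa using Real.tendsto_exp_neg_atTop_nhds_zero.const_mul (32 * C)
  have hcau : CauchySeq fun n : ℕ => y n := by
    refine cauchySeq_of_le_tendsto_0 (fun n : ℕ => 2 * (32 * C * Real.exp (-(n : ℝ)))) ?_ ?_
    · intro n m N hn hm
      have hf : ∀ k : ℕ, N ≤ k → dist (y k) (y N) ≤ 32 * C * Real.exp (-(N : ℝ)) := by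
        intro k hk
        rcases hk.eq_or_lt with rfl | hlt
        · simp; positivity
        · exact far N k (by positivity) (by exact_mod_cast hlt)
      calc dist (y n) (y m) ≤ dist (y n) (y N) + dist (y m) (y N) := dist_triangle_right _ _ _
        _ ≤ _ := by linarith [hf n hn, hf m hm]
    · simpa using (hexp.comp tendsto_natCast_atTop_atTop).const_mul 2
  obtain ⟨c, hc⟩ := cauchySeq_tendsto_of_complete hcau
  refine ⟨c, fun t ht => ?_⟩
  rw [abs_sub_comm]
  refine le_of_tendsto ((hc.sub_const (y t)).abs) ?_
  obtain ⟨N, hN⟩ := exists_nat_ge (t + 1)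
  filter_upwards [eventually_ge_atTop N] with n hn
  exact far t n ht (hN.trans (by exact_mod_cast hn))

end CoMinkowski

namespace CoMinkowski

/-! ## Boundary values of equivariant maps -/

section Boundary

variable {d : ℕ} {Γ : Subgroup (OPlus d)}

theorem apply_inv_L_smul_hom (A : OPlus d) (x : Ball d) :
    A.1 ((L (x : E d))⁻¹ • hom (x : E d)) =
      (L ((A • x : Ball d) : E d))⁻¹ • hom ((A • x : Ball d) : E d) := by
  have h1 := (L_pos x).ne'
  rw [map_smul, apply_hom_eq, smul_smul]
  congr 1
  field_simp

/-- On the hyperboloid the weight disappears: the function `L⁻¹ h` changes only by the restriction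
of a linear form. -/
theorem IsEquivariant.inv_L_mul_smul {τ : Z1 Γ} {h : Ball d → ℝ} (H : IsEquivariant τ h) (A : Γ)
    (x : Ball d) : (L ((A.1 • x : Ball d) : E d))⁻¹ * h (A.1 • x) = (L (x : E d))⁻¹ * h x +
      lor ((L ((A.1 • x : Ball d) : E d))⁻¹ • hom ((A.1 • x : Ball d) : E d)) (Z1.val τ A) := by
  have h1 := (L_pos x).ne'
  have h2 := (L_pos (A.1 • x)).ne'
  rw [H.smul_eq, lor_smul_left]
  field_simp

theorem continuous_inv_L_mul {h : Ball d → ℝ} (hh : Continuous h) :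
    Continuous fun x : Ball d => (L (x : E d))⁻¹ * h x :=
  ((continuous_L.comp continuous_subtype_val).inv₀ fun x => (L_pos x).ne').mul hh

/-- Second differences of an equivariant map along geodesics are bounded. -/
theorem IsEquivariant.exists_abs_add_sub_le (hΓ : IsCompactOrientedQuotient Γ) {τ : Z1 Γ}
    {h : Ball d → ℝ} (H : IsEquivariant τ h) (M : ℝ) :
    ∃ C, ∀ c, 0 < c → c ≤ M → ∀ x p q : Ball d,
      (L (p : E d))⁻¹ • hom (p : E d) + (L (q : E d))⁻¹ • hom (q : E d) =
        c • (L (x : E d))⁻¹ • hom (x : E d) →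
      |(L (p : E d))⁻¹ * h p + (L (q : E d))⁻¹ * h q - c * ((L (x : E d))⁻¹ * h x)| ≤ C := by
  obtain ⟨l, hl, hA⟩ := hΓ.exists_le_L
  set M' := max M 1
  have hM' : 0 < M' := lt_max_of_lt_right one_pos
  obtain ⟨C, hC⟩ := (isCompact_superlevel_L (d := d) (div_pos hl hM')).exists_bound_of_continuousOn
    (continuous_inv_L_mul H.1).continuousOn
  have hC' : ∀ x : Ball d, l / M' ≤ L (x : E d) → |(L (x : E d))⁻¹ * h x| ≤ C := fun x hx => hC x hx
  -- For `x` in the compact set `{l ≤ L}`, comparing last coordinates gives `1 / L p + 1 / L q = c /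
  -- L x ≤ M' / l`. So all three points lie in `{l / M' ≤ L}`, where `L⁻¹ h` is bounded.
  have key : ∀ c, 0 < c → c ≤ M → ∀ x p q : Ball d,
      (L (p : E d))⁻¹ • hom (p : E d) + (L (q : E d))⁻¹ • hom (q : E d) =
        c • (L (x : E d))⁻¹ • hom (x : E d) → l ≤ L (x : E d) →
      |(L (p : E d))⁻¹ * h p + (L (q : E d))⁻¹ * h q - c * ((L (x : E d))⁻¹ * h x)| ≤
        C + C + M' * C := by
    intro c hc hcM x p q e hx
    have e2 := congrArg Prod.snd e
    simp only [hom, Prod.snd_add, Prod.smul_snd, smul_eq_mul, mul_one] at e2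
    have hp := L_pos p
    have hq := L_pos q
    have hp' := inv_pos.2 hp
    have hq' := inv_pos.2 hq
    have hcx : c * (L (x : E d))⁻¹ ≤ M' / l := by
      rw [div_eq_mul_inv]
      have : (L (x : E d))⁻¹ ≤ l⁻¹ := inv_anti₀ hl hx
      exact mul_le_mul (hcM.trans (le_max_left _ _)) this (inv_pos.2 (L_pos x)).le hM'.le
    have bp : l / M' ≤ L (p : E d) := by
      rw [← inv_div]; exact inv_le_of_inv_le₀ hp (by linarith)
    have bq : l / M' ≤ L (q : E d) := by
      rw [← inv_div]; exact inv_le_of_inv_le₀ hq (by linarith)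
    have bx : l / M' ≤ L (x : E d) := (div_le_self hl.le (le_max_right _ _)).trans hx
    have h1 := hC' p bp
    have h2 := hC' q bq
    have h3 := hC' x bx
    calc _ ≤ |(L (p : E d))⁻¹ * h p| + |(L (q : E d))⁻¹ * h q| + |c * ((L (x : E d))⁻¹ * h x)| :=
          (abs_sub _ _).trans (add_le_add_left (abs_add_le _ _) _)
      _ ≤ C + C + M' * C := by
          rw [abs_mul c, abs_of_pos hc]
          have : c ≤ M' := hcM.trans (le_max_left _ _)
          gcongr
  refine ⟨C + C + M' * C, fun c hc hcM x p q e => ?_⟩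
  obtain ⟨A, hAx⟩ := hA x
  have e' : (L ((A.1 • p : Ball d) : E d))⁻¹ • hom ((A.1 • p : Ball d) : E d) +
      (L ((A.1 • q : Ball d) : E d))⁻¹ • hom ((A.1 • q : Ball d) : E d) =
      c • (L ((A.1 • x : Ball d) : E d))⁻¹ • hom ((A.1 • x : Ball d) : E d) := by
    rw [← apply_inv_L_smul_hom, ← apply_inv_L_smul_hom, ← apply_inv_L_smul_hom, ← map_add, e,
      map_smul]
  have := key c hc hcM _ _ _ e' hAx.le
  -- Pairing the linear relation with `τ A` shows that the linear terms added by the group cancel,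
  -- so the bound transfers back to `x`, `p`, `q`.
  have e3 := congrArg (fun v => lor v (Z1.val τ A)) e'
  simp only [lor_add_left, lor_smul_left c] at e3
  rw [H.inv_L_mul_smul, H.inv_L_mul_smul, H.inv_L_mul_smul] at this
  convert this using 2
  linear_combination -e3

/-- The point at signed distance `t` from the origin in direction `ξ`. -/
noncomputable def ray (ξ : Sphere d) (t : ℝ) : Ball d :=
  ⟨Real.tanh t • (ξ : E d), by
    have h : ‖(ξ : E d)‖ = 1 := by simp
    rw [mem_ball_zero_iff, norm_smul, h, mul_one, Real.norm_eq_abs, abs_lt]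
    exact ⟨Real.neg_one_lt_tanh t, Real.tanh_lt_one t⟩⟩

theorem L_ray (ξ : Sphere d) (t : ℝ) : L (ray ξ t : E d) = (Real.cosh t)⁻¹ := by
  have h : ‖(ξ : E d)‖ = 1 := by simp
  have hc := Real.cosh_pos t
  have : 1 - ‖(ray ξ t : E d)‖ ^ 2 = ((Real.cosh t)⁻¹) ^ 2 := by
    simp only [ray, norm_smul, h, mul_one, Real.norm_eq_abs, sq_abs, Real.tanh_eq_sinh_div_cosh]
    have := Real.cosh_sq t
    field_simp
    linarith
  rw [L, this, Real.sqrt_sq (by positivity)]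

theorem inv_L_smul_hom_ray (ξ : Sphere d) (t : ℝ) :
    (L (ray ξ t : E d))⁻¹ • hom (ray ξ t : E d) = (Real.sinh t • (ξ : E d), Real.cosh t) := by
  have hc := (Real.cosh_pos t).ne'
  rw [L_ray, inv_inv]
  refine Prod.ext ?_ ?_
  · change Real.cosh t • (Real.tanh t • (ξ : E d)) = _
    rw [smul_smul, Real.tanh_eq_sinh_div_cosh, mul_div_cancel₀ _ hc]
  · simp [hom]

/-- The addition formulas, written as a linear relation of the kind required by
`IsEquivariant.exists_abs_add_sub_le`. -/
theorem ray_second_difference (ξ : Sphere d) (t a : ℝ) :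
    (L (ray ξ (t + a) : E d))⁻¹ • hom (ray ξ (t + a) : E d) +
      (L (ray ξ (t - a) : E d))⁻¹ • hom (ray ξ (t - a) : E d) =
      (2 * Real.cosh a) • (L (ray ξ t : E d))⁻¹ • hom (ray ξ t : E d) := by
  rw [inv_L_smul_hom_ray, inv_L_smul_hom_ray, inv_L_smul_hom_ray]
  refine Prod.ext ?_ ?_
  · change Real.sinh (t + a) • (ξ : E d) + Real.sinh (t - a) • (ξ : E d) =
      (2 * Real.cosh a) • Real.sinh t • (ξ : E d)
    rw [← add_smul, smul_smul, Real.sinh_add, Real.sinh_sub]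
    congr 1; ring
  · change Real.cosh (t + a) + Real.cosh (t - a) = (2 * Real.cosh a) * Real.cosh t
    rw [Real.cosh_add, Real.cosh_sub]; ring

theorem continuous_ray (t : ℝ) : Continuous fun ξ : Sphere d => ray ξ t :=
  Continuous.subtype_mk (f := fun ξ : Sphere d => Real.tanh t • (ξ : E d)) (by fun_prop) _

/-- An equivariant map extends continuously to the sphere at infinity. -/
theorem IsEquivariant.exists_extendsBy (hΓ : IsCompactOrientedQuotient Γ) {τ : Z1 Γ}
    {h : Ball d → ℝ} (H : IsEquivariant τ h) :
    ∃ b : Sphere d → ℝ, Continuous b ∧ ExtendsBy h b := by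
  obtain ⟨C₁, hC₁⟩ := H.exists_abs_add_sub_le hΓ (2 * Real.cosh 2)
  obtain ⟨C₂, hC₂⟩ := (isCompact_superlevel_L (d := d)
    (inv_pos.2 (Real.cosh_pos 4))).exists_bound_of_continuousOn
    (continuous_inv_L_mul H.1).continuousOn
  set C := max C₁ C₂
  set v : Sphere d → ℝ → ℝ := fun ξ t => (L (ray ξ t : E d))⁻¹ * h (ray ξ t)
  have hv1 : ∀ ξ, ∀ a, 1 ≤ a → a ≤ 2 → ∀ t,
      |v ξ (t + a) + v ξ (t - a) - 2 * Real.cosh a * v ξ t| ≤ C := by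
    intro ξ a ha ha' t
    refine (hC₁ _ (by have := Real.cosh_pos a; linarith) ?_ _ _ _
      (ray_second_difference ξ t a)).trans (le_max_left _ _)
    have : Real.cosh a ≤ Real.cosh 2 := by
      rw [Real.cosh_le_cosh, abs_of_pos (by linarith), abs_of_pos (by norm_num)]; exact ha'
    linarith
  have hv2 : ∀ ξ, ∀ t, 0 ≤ t → t ≤ 4 → |v ξ t| ≤ C := by
    intro ξ t ht ht'
    refine (hC₂ (ray ξ t) ?_).trans (le_max_right _ _)
    change _ ≤ L (ray ξ t : E d)
    rw [L_ray]
    refine inv_anti₀ (Real.cosh_pos t) ?_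
    rw [Real.cosh_le_cosh, abs_of_nonneg ht, abs_of_pos (by norm_num)]; exact ht'
  choose c hc using fun ξ => exists_abs_exp_mul_sub_le (hv1 ξ) (hv2 ξ)
  have hexp : Tendsto (fun t : ℝ => 32 * C * Real.exp (-t)) atTop (𝓝 0) := by
    simpa using Real.tendsto_exp_neg_atTop_nhds_zero.const_mul (32 * C)
  have hcc : Continuous c := by
    -- The error bound does not depend on the direction, so `c` is a uniform limit of continuous
    -- functions.
    have hu : TendstoUniformly (fun (t : ℝ) (ξ : Sphere d) => Real.exp (-t) * v ξ t) c atTop := by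
      rw [Metric.tendstoUniformly_iff]
      intro ε hε
      filter_upwards [hexp.eventually_lt_const hε, eventually_ge_atTop 0] with t ht ht0 ξ
      rw [dist_comm]
      exact (hc ξ t ht0).trans_lt ht
    refine hu.continuous (Frequently.of_forall fun t => ?_)
    exact continuous_const.mul ((continuous_inv_L_mul H.1).comp (continuous_ray t))
  -- Along a ray `h` equals `v t / cosh t`, asymptotically `2 * exp (-t) * v t`.
  refine ⟨fun ξ => 2 * c ξ, continuous_const.mul hcc, fun ξ => ?_⟩
  let dir : E d → E d := fun x => ‖x‖⁻¹ • x
  have hdir : ∀ x : E d, x ≠ 0 → dir x ∈ Metric.sphere (0 : E d) 1 := fun x hx => by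
    simp [dir, norm_smul, hx]
  classical
  -- Extending `c` by homogeneity of degree zero lets nonradial approach to `ξ` be treated; the
  -- value at `0` plays no role.
  let c' : E d → ℝ := fun x => if hx : x ≠ 0 then c ⟨dir x, hdir x hx⟩ else 0
  have hξ1 : ‖(ξ : E d)‖ = 1 := by simp
  have hξ0 : (ξ : E d) ≠ 0 := fun h0 => by rw [h0] at hξ1; simp at hξ1
  have hc' : Tendsto c' (𝓝 (ξ : E d)) (𝓝 (c ξ)) := by
    have hcont : ContinuousOn c' {x | x ≠ 0} := by
      rw [continuousOn_iff_continuous_domRestrict]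
      have : Set.domRestrict {x : E d | x ≠ 0} c' =
          fun x : {x : E d | x ≠ 0} => c ⟨dir x, hdir x x.2⟩ := by
        ext x; exact dif_pos x.2
      rw [this]
      refine hcc.comp (Continuous.subtype_mk ?_ _)
      exact (continuous_norm.comp continuous_subtype_val).inv₀
        (fun x => norm_ne_zero_iff.2 x.2) |>.smul continuous_subtype_val
    have h1 := (hcont.continuousAt (isOpen_ne.mem_nhds hξ0)).tendsto
    have h2 : c' ξ = c ξ := by
      simp only [c']; rw [dif_pos hξ0]; congr 1
      exact Subtype.ext (by simp [dir])
    rwa [h2] at h1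
  have hbd : ∀ x : Ball d, (x : E d) ≠ 0 →
      |h x - (1 + ‖(x : E d)‖) * c' x| ≤ 64 * C * L (x : E d) := by
    intro x hx
    have hn : ‖(x : E d)‖ < 1 := mem_ball_zero_iff.1 x.2
    have hn0 : 0 < ‖(x : E d)‖ := norm_pos_iff.2 hx
    set t := Real.artanh ‖(x : E d)‖
    have ht : Real.tanh t = ‖(x : E d)‖ := Real.tanh_artanh ⟨by linarith, hn⟩
    have ht0 : 0 ≤ t := Real.artanh_nonneg hn0.le
    have hray : ray ⟨dir x, hdir x hx⟩ t = x := by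
      apply Subtype.ext
      simp only [ray, ht, dir]
      rw [smul_smul, mul_inv_cancel₀ hn0.ne', one_smul]
    have h1 := hc ⟨dir x, hdir x hx⟩ t ht0
    have e1 : c ⟨dir x, hdir x hx⟩ = c' x := by simp only [c']; rw [dif_pos hx]
    simp only [v] at h1
    rw [hray, e1] at h1
    have hL : L (x : E d) = (Real.cosh t)⁻¹ := by rw [← hray, L_ray]
    have hcp := Real.cosh_pos t
    have hep := Real.exp_pos t
    have hen : Real.exp (-t) = (Real.exp t)⁻¹ := Real.exp_neg t
    -- With `‖x‖ = tanh t`, this makes `1 + ‖x‖` the exact factor between `exp (-t) * v t` and `h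
    -- x`, so the radial estimate becomes a bound by a multiple of `L x`.
    have e2 : 1 + ‖(x : E d)‖ = Real.exp t * (Real.cosh t)⁻¹ := by
      rw [← ht, Real.tanh_eq_sinh_div_cosh]
      have := Real.cosh_add_sinh t
      field_simp
      linarith
    have hp : 0 < 1 + ‖(x : E d)‖ := by linarith
    have e3 : h x - (1 + ‖(x : E d)‖) * c' x =
        (1 + ‖(x : E d)‖) * (Real.exp (-t) * ((L (x : E d))⁻¹ * h x) - c' x) := by
      have : (1 + ‖(x : E d)‖) * (Real.exp (-t) * (L (x : E d))⁻¹) = 1 := by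
        rw [e2, hL, hen]; field_simp
      linear_combination (-h x) * this
    have e4 : (1 + ‖(x : E d)‖) * Real.exp (-t) = L (x : E d) := by
      rw [e2, hL, hen]; field_simp
    have hC0 : 0 ≤ C := (abs_nonneg _).trans (hv2 ξ 0 le_rfl (by norm_num))
    rw [e3, abs_mul, abs_of_pos hp]
    calc _ ≤ (1 + ‖(x : E d)‖) * (32 * C * Real.exp (-t)) := by gcongr
      _ = 32 * C * L (x : E d) := by rw [← e4]; ring
      _ ≤ _ := by nlinarith [mul_nonneg hC0 (L_pos x).le]
  have hA : Tendsto (fun x : Ball d => h x - (1 + ‖(x : E d)‖) * c' x)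
      (comap (Subtype.val : Ball d → E d) (𝓝 (ξ : E d))) (𝓝 0) := by
    have h1 : Tendsto (fun x : Ball d => 64 * C * L (x : E d))
        (comap (Subtype.val : Ball d → E d) (𝓝 (ξ : E d))) (𝓝 0) := by
      simpa using (tendsto_L_comap ξ).const_mul (64 * C)
    refine squeeze_zero_norm' ?_ h1
    have : ∀ᶠ x : Ball d in comap (Subtype.val : Ball d → E d) (𝓝 (ξ : E d)), (x : E d) ≠ 0 :=
      tendsto_comap.eventually (isOpen_ne.mem_nhds hξ0)
    filter_upwards [this] with x hx using hbd x hx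
  have hB : Tendsto (fun x : Ball d => (1 + ‖(x : E d)‖) * c' x)
      (comap (Subtype.val : Ball d → E d) (𝓝 (ξ : E d))) (𝓝 (2 * c ξ)) := by
    have h1 : Tendsto (fun x : E d => (1 + ‖x‖) * c' x) (𝓝 (ξ : E d))
      (𝓝 ((1 + ‖(ξ : E d)‖) * c ξ)) :=
      ((continuous_const.add continuous_norm).tendsto _).mul hc'
    rw [hξ1, one_add_one_eq_two] at h1
    exact h1.comp tendsto_comap
  simpa using hA.add hB

theorem ExtendsBy.unique {h : Ball d → ℝ} {b b' : Sphere d → ℝ} (hb : ExtendsBy h b)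
    (hb' : ExtendsBy h b') : b = b' := by
  ext ξ
  have := comap_neBot ξ
  exact tendsto_nhds_unique (hb ξ) (hb' ξ)

theorem existsUnique_isBoundaryMap (hΓ : IsCompactOrientedQuotient Γ) (τ : Z1 Γ) :
    ∃! b : Sphere d → ℝ, IsBoundaryMap τ b := by
  obtain ⟨h, H⟩ := exists_isEquivariant hΓ τ
  obtain ⟨b, hb, hb'⟩ := H.exists_extendsBy hΓ
  exact ⟨b, ⟨hb, ⟨h, H⟩, fun h' H' => H.extendsBy_of hΓ H' hb'⟩, fun b' B' =>
    (B'.2.2 h H).unique hb'⟩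

theorem isBoundaryMap_boundaryMap (hΓ : IsCompactOrientedQuotient Γ) (τ : Z1 Γ) :
    IsBoundaryMap τ (boundaryMap τ) :=
  Classical.epsilon_spec (existsUnique_isBoundaryMap hΓ τ).exists

theorem IsEquivariant.extendsBy (hΓ : IsCompactOrientedQuotient Γ) {τ : Z1 Γ} {h : Ball d → ℝ}
    (H : IsEquivariant τ h) : ExtendsBy h (boundaryMap τ) :=
  (isBoundaryMap_boundaryMap hΓ τ).2.2 h H

theorem continuous_boundaryMap (hΓ : IsCompactOrientedQuotient Γ) (τ : Z1 Γ) :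
    Continuous (boundaryMap τ) :=
  (isBoundaryMap_boundaryMap hΓ τ).1

theorem boundaryMap_add (hΓ : IsCompactOrientedQuotient Γ) (τ τ' : Z1 Γ) :
    boundaryMap (τ + τ') = boundaryMap τ + boundaryMap τ' := by
  obtain ⟨h, H⟩ := exists_isEquivariant hΓ τ
  obtain ⟨h', H'⟩ := exists_isEquivariant hΓ τ'
  exact ((H.add H').extendsBy hΓ).unique fun ξ => (H.extendsBy hΓ ξ).add (H'.extendsBy hΓ ξ)

theorem boundaryMap_smul (hΓ : IsCompactOrientedQuotient Γ) (c : ℝ) (τ : Z1 Γ) :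
    boundaryMap (c • τ) = c • boundaryMap τ := by
  obtain ⟨h, H⟩ := exists_isEquivariant hΓ τ
  exact ((H.const_mul c).extendsBy hΓ).unique fun ξ => (H.extendsBy hΓ ξ).const_mul c

theorem boundaryMap_neg (hΓ : IsCompactOrientedQuotient Γ) (τ : Z1 Γ) :
    boundaryMap (-τ) = -boundaryMap τ := by
  have := boundaryMap_smul hΓ (-1) τ
  rw [show (-1 : ℝ) • τ = -τ from neg_one_smul ℝ τ] at this
  rw [this]
  exact neg_one_smul ℝ _

theorem boundaryMap_of_eq_sub (hΓ : IsCompactOrientedQuotient Γ) {τ : Z1 Γ} {w : Mink d}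
    (hw : ∀ A : Γ, Z1.val τ A = w - A.1.1 w) :
    boundaryMap τ = fun ξ : Sphere d => lor (hom (ξ : E d)) w :=
  ((isEquivariant_lor_hom_iff.2 hw).extendsBy hΓ).unique fun _ =>
    ((continuous_lor_hom w).tendsto _).comp tendsto_comap

/-- The limit of the equivariance relation. The ratio of values of `L` is written as `factor⁻¹`,
which stays meaningful on the sphere where `L` vanishes. -/
theorem boundaryMap_sphereAct (hΓ : IsCompactOrientedQuotient Γ) (τ : Z1 Γ) (A : Γ)
    (ξ : Sphere d) : boundaryMap τ (sphereAct A.1 ξ) =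
      (factor A.1 ξ)⁻¹ * boundaryMap τ ξ + lor (hom (sphereAct A.1 ξ : E d)) (Z1.val τ A) := by
  obtain ⟨h, H⟩ := exists_isEquivariant hΓ τ
  have := comap_neBot ξ
  have h1 := (H.extendsBy hΓ (sphereAct A.1 ξ)).comp (tendsto_smul_comap A.1 ξ)
  refine tendsto_nhds_unique h1 ?_
  have h2 : Tendsto (fun x : Ball d => (factor A.1 (x : E d))⁻¹)
      (comap (Subtype.val : Ball d → E d) (𝓝 (ξ : E d))) (𝓝 (factor A.1 (ξ : E d))⁻¹) :=
    (((continuous_factor A.1).tendsto _).comp tendsto_comap).inv₀ (factor_sphere_pos A.1 ξ).ne'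
  have h3 : Tendsto (fun x : Ball d => lor (hom ((A.1 • x : Ball d) : E d)) (Z1.val τ A))
      (comap (Subtype.val : Ball d → E d) (𝓝 (ξ : E d)))
      (𝓝 (lor (hom (sphereAct A.1 ξ : E d)) (Z1.val τ A))) :=
    (((continuous_lor_hom _).tendsto _).comp tendsto_comap).comp (tendsto_smul_comap A.1 ξ)
  refine ((h2.mul (H.extendsBy hΓ ξ)).add h3).congr fun x => ?_
  rw [Function.comp_apply, H.smul_eq, factor_eq, inv_div]

end Boundary

end CoMinkowski

namespace CoMinkowski

/-! ## Convex hulls of boundary maps -/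

section Hull

variable {d : ℕ}

theorem lor_hom_combo (x y : E d) (w : Mink d) {s t : ℝ} (hst : s + t = 1) :
    lor (hom (s • x + t • y)) w = s * lor (hom x) w + t * lor (hom y) w := by
  simp only [lor_hom, inner_add_left, real_inner_smul_left]
  linear_combination (-w.2) * (-hst)

/-- An affine function which is at most `c` on the sphere is at most `c` on the ball. -/
theorem lor_hom_le_of_sphere [NeZero d] {w : Mink d} {c : ℝ}
    (h : ∀ ξ : Sphere d, lor (hom (ξ : E d)) w ≤ c) (x : Ball d) : lor (hom (x : E d)) w ≤ c := by
  have hconv : Convex ℝ {y : E d | lor (hom y) w ≤ c} := by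
    intro y hy z hz s t hs ht hst
    change lor (hom _) w ≤ c
    rw [lor_hom_combo _ _ _ hst]
    have h1 : lor (hom y) w ≤ c := hy
    have h2 : lor (hom z) w ≤ c := hz
    calc _ ≤ s * c + t * c := by gcongr
      _ = c := by rw [← add_mul, hst, one_mul]
  have h1 : convexHull ℝ (Metric.sphere (0 : E d) 1) ⊆ {y : E d | lor (hom y) w ≤ c} :=
    convexHull_min (fun ξ hξ => h ⟨ξ, hξ⟩) hconv
  rw [convexHull_sphere_eq_closedBall _ zero_le_one] at h1
  exact h1 (Metric.ball_subset_closedBall x.2)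

theorem lor_hom_le_lor_hom_of_sphere [NeZero d] {w w' : Mink d}
    (h : ∀ ξ : Sphere d, lor (hom (ξ : E d)) w ≤ lor (hom (ξ : E d)) w') (x : Ball d) :
    lor (hom (x : E d)) w ≤ lor (hom (x : E d)) w' := by
  have := lor_hom_le_of_sphere (w := w - w') (c := 0)
    (fun ξ => by rw [lor_sub_right]; linarith [h ξ]) x
  rw [lor_sub_right] at this
  linarith

variable {b b' : Sphere d → ℝ}

theorem lowerHull_set_eq (b : Sphere d → ℝ) (x : Ball d) :
    {r | ∃ a : E d →ᵃ[ℝ] ℝ, (∀ ξ : Sphere d, a ξ ≤ b ξ) ∧ r = a x} =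
      (fun w => lor (hom (x : E d)) w) ''
        {w : Mink d | ∀ ξ : Sphere d, lor (hom (ξ : E d)) w ≤ b ξ} := by
  ext r
  constructor
  · rintro ⟨a, ha, rfl⟩
    obtain ⟨w, rfl⟩ := exists_eq_affOf a
    exact ⟨w, fun ξ => by rw [← affOf_apply]; exact ha ξ, (affOf_apply _ _).symm⟩
  · rintro ⟨w, hw, rfl⟩
    exact ⟨affOf w, fun ξ => by rw [affOf_apply]; exact hw ξ, (affOf_apply _ _).symm⟩

theorem exists_lor_hom_le (hb : Continuous b) :
    ∃ w : Mink d, ∀ ξ : Sphere d, lor (hom (ξ : E d)) w ≤ b ξ := by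
  obtain ⟨C, hC⟩ := isCompact_univ.exists_bound_of_continuousOn hb.continuousOn
  refine ⟨(0, C), fun ξ => ?_⟩
  have := (abs_le.1 (hC ξ (Set.mem_univ _))).1
  simpa [lor_hom] using this

theorem bddAbove_lowerHull_set [NeZero d] (hb : Continuous b) (x : Ball d) :
    BddAbove ((fun w => lor (hom (x : E d)) w) ''
      {w : Mink d | ∀ ξ : Sphere d, lor (hom (ξ : E d)) w ≤ b ξ}) := by
  obtain ⟨C, hC⟩ := isCompact_univ.exists_bound_of_continuousOn hb.continuousOn
  refine ⟨C, ?_⟩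
  rintro _ ⟨w, hw, rfl⟩
  exact lor_hom_le_of_sphere
    (fun ξ => (hw ξ).trans (abs_le.1 (hC ξ (Set.mem_univ _))).2) x

theorem lor_hom_le_lowerHull [NeZero d] (hb : Continuous b) {w : Mink d}
    (hw : ∀ ξ : Sphere d, lor (hom (ξ : E d)) w ≤ b ξ) (x : Ball d) :
    lor (hom (x : E d)) w ≤ lowerHull b x := by
  rw [lowerHull, lowerHull_set_eq]
  exact le_csSup (bddAbove_lowerHull_set hb x) ⟨w, hw, rfl⟩

theorem lowerHull_le (hb : Continuous b) {x : Ball d} {c : ℝ}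
    (h : ∀ w : Mink d, (∀ ξ : Sphere d, lor (hom (ξ : E d)) w ≤ b ξ) → lor (hom (x : E d)) w ≤ c) :
    lowerHull b x ≤ c := by
  rw [lowerHull, lowerHull_set_eq]
  obtain ⟨w, hw⟩ := exists_lor_hom_le hb
  refine csSup_le ⟨_, w, hw, rfl⟩ ?_
  rintro _ ⟨w, hw, rfl⟩
  exact h w hw

theorem upperHull_le_lor_hom [NeZero d] (hb : Continuous b) {w : Mink d}
    (hw : ∀ ξ : Sphere d, b ξ ≤ lor (hom (ξ : E d)) w) (x : Ball d) :
    upperHull b x ≤ lor (hom (x : E d)) w := by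
  have := lor_hom_le_lowerHull (b := -b) hb.neg (w := -w)
    (fun ξ => by rw [lor_neg_right]; exact neg_le_neg (hw ξ)) x
  rw [lor_neg_right] at this
  rw [upperHull]
  linarith

/-- Sums of affine minorants are affine minorants of the sum. This superadditivity is the source of
the triangle inequality. -/
theorem lowerHull_add_le [NeZero d] (hb : Continuous b) (hb' : Continuous b') (x : Ball d) :
    lowerHull b x + lowerHull b' x ≤ lowerHull (b + b') x := by
  rw [← le_sub_iff_add_le]
  refine lowerHull_le hb fun w hw => ?_
  rw [le_sub_comm]
  refine lowerHull_le hb' fun w' hw' => ?_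
  rw [le_sub_iff_add_le, add_comm, ← lor_add_right]
  exact lor_hom_le_lowerHull (hb.add hb')
    (fun ξ => by rw [lor_add_right]; exact add_le_add (hw ξ) (hw' ξ)) x

theorem lowerHull_lor_hom [NeZero d] (w : Mink d) (x : Ball d) :
    lowerHull (fun ξ : Sphere d => lor (hom (ξ : E d)) w) x = lor (hom (x : E d)) w := by
  have hc : Continuous fun ξ : Sphere d => lor (hom (ξ : E d)) w :=
    (continuous_lor_hom w).comp continuous_subtype_val
  exact le_antisymm (lowerHull_le hc fun w' hw' => lor_hom_le_lor_hom_of_sphere hw' x)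
    (lor_hom_le_lowerHull hc (fun _ => le_rfl) x)

/-- Superadditivity for `w` gives one inequality and superadditivity for `-w` the other. -/
theorem lowerHull_add_lor_hom [NeZero d] (hb : Continuous b) (w : Mink d) (x : Ball d) :
    lowerHull (b + fun ξ : Sphere d => lor (hom (ξ : E d)) w) x =
      lowerHull b x + lor (hom (x : E d)) w := by
  have hc : ∀ w : Mink d, Continuous fun ξ : Sphere d => lor (hom (ξ : E d)) w := fun w =>
    (continuous_lor_hom w).comp continuous_subtype_val
  refine le_antisymm ?_ ?_
  · have h1 := lowerHull_add_le (hb.add (hc w)) (hc (-w)) x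
    have e : (b + fun ξ : Sphere d => lor (hom (ξ : E d)) w) +
        (fun ξ : Sphere d => lor (hom (ξ : E d)) (-w)) = b := by
      ext ξ; simp [lor_neg_right]
    have h2 := lowerHull_lor_hom (-w) x
    rw [lor_neg_right] at h2
    have h3 : lowerHull (b + (fun ξ : Sphere d => lor (hom (ξ : E d)) w) +
        (fun ξ : Sphere d => lor (hom (ξ : E d)) (-w))) x = lowerHull b x := by rw [e]
    have h1' := h1.trans_eq h3
    linarith
  · have h1 := lowerHull_add_le hb (hc w) x
    rwa [lowerHull_lor_hom w x] at h1

theorem lowerHull_smul [NeZero d] (hb : Continuous b) {c : ℝ} (hc : 0 ≤ c) (x : Ball d) :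
    lowerHull (c • b) x = c * lowerHull b x := by
  rcases hc.eq_or_lt with rfl | hc
  · have := lowerHull_lor_hom (d := d) 0 x
    simp only [lor_zero_right] at this
    rw [zero_mul, zero_smul]
    exact this
  · have key : ∀ (b : Sphere d → ℝ), Continuous b → ∀ c : ℝ, 0 < c →
        lowerHull (c • b) x ≤ c * lowerHull b x := by
      intro b hb c hc
      refine lowerHull_le (hb.const_smul c) fun w hw => ?_
      rw [← inv_mul_le_iff₀ hc, ← lor_smul_right]
      refine lor_hom_le_lowerHull hb (fun ξ => ?_) x
      rw [lor_smul_right, inv_mul_le_iff₀ hc]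
      exact hw ξ
    refine le_antisymm (key b hb c hc) ?_
    have := key (c • b) (hb.const_smul c) c⁻¹ (inv_pos.2 hc)
    rw [smul_smul, inv_mul_cancel₀ hc.ne', one_smul, le_inv_mul_iff₀ hc] at this
    exact this

theorem lowerHull_le_upperHull [NeZero d] (hb : Continuous b) (x : Ball d) :
    lowerHull b x ≤ upperHull b x := by
  have h1 := lowerHull_add_le hb hb.neg x
  have h2 := lowerHull_lor_hom (d := d) 0 x
  simp only [lor_zero_right] at h2
  rw [add_neg_cancel] at h1
  have h3 : lowerHull (0 : Sphere d → ℝ) x = 0 := h2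
  rw [upperHull]
  linarith

theorem lowerHull_combo_le [NeZero d] (hb : Continuous b) {x y z : Ball d} {s t : ℝ} (hs : 0 ≤ s)
    (ht : 0 ≤ t) (hst : s + t = 1) (hz : (z : E d) = s • (x : E d) + t • (y : E d)) :
    lowerHull b z ≤ s * lowerHull b x + t * lowerHull b y := by
  refine lowerHull_le hb fun w hw => ?_
  rw [hz, lor_hom_combo _ _ _ hst]
  have h1 := lor_hom_le_lowerHull hb hw x
  have h2 := lor_hom_le_lowerHull hb hw y
  gcongr

theorem ext0_coe (h : Ball d → ℝ) (x : Ball d) : ext0 h (x : E d) = h x := by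
  rw [ext0, dif_pos x.2]

theorem continuous_of_continuousOn_ext0 {h : Ball d → ℝ}
    (hc : ContinuousOn (ext0 h) (Metric.ball 0 1)) : Continuous h := by
  have := continuousOn_iff_continuous_domRestrict.1 hc
  convert this using 1
  ext x
  exact (ext0_coe h x).symm

/-- A finite supremum of affine functions is convex, and a convex function on an open set of `ℝ^d`
is continuous. -/
theorem continuous_lowerHull [NeZero d] (hb : Continuous b) : Continuous (lowerHull b) := by
  have hconv : ConvexOn ℝ (Metric.ball (0 : E d) 1) (ext0 (lowerHull b)) := by
    refine ⟨convex_ball _ _, fun x hx y hy s t hs ht hst => ?_⟩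
    have hz := convex_ball (0 : E d) 1 hx hy hs ht hst
    have := lowerHull_combo_le hb (x := ⟨x, hx⟩) (y := ⟨y, hy⟩) (z := ⟨_, hz⟩) hs ht hst rfl
    simpa only [ext0, dif_pos hx, dif_pos hy, dif_pos hz, smul_eq_mul] using this
  exact continuous_of_continuousOn_ext0 (hconv.continuousOn Metric.isOpen_ball)

theorem upperHull_neg (b : Sphere d → ℝ) (x : Ball d) : upperHull (-b) x = -lowerHull b x := by
  rw [upperHull, neg_neg]

/-- If the two hulls agree, they are affine. -/
theorem exists_lowerHull_eq_lor_hom [NeZero d] (hb : Continuous b)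
    (h : ∀ x, lowerHull b x = upperHull b x) :
    ∃ w : Mink d, ∀ x, lowerHull b x = lor (hom (x : E d)) w := by
  let Λ : Mink d →ₗ[ℝ] (Ball d → ℝ) :=
    { toFun := fun w x => lor (hom (x : E d)) w
      map_add' := fun w w' => by ext x; exact lor_add_right _ _ _
      map_smul' := fun c w => by ext x; exact lor_smul_right _ _ _ }
  -- Affine functions form a finite-dimensional, hence closed, subspace for pointwise convergence;
  -- it suffices to approximate the hull by minorants.
  have hcl : IsClosed (Λ.range : Set (Ball d → ℝ)) := Submodule.closed_of_finiteDimensional _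
  suffices lowerHull b ∈ closure (Λ.range : Set (Ball d → ℝ)) by
    rw [hcl.closure_eq] at this
    obtain ⟨w, hw⟩ := this
    exact ⟨w, fun x => (congrFun hw x).symm⟩
  let o : Ball d := ⟨0, by simp⟩
  have hw : ∀ n : ℕ, ∃ w : Mink d, (∀ ξ : Sphere d, lor (hom (ξ : E d)) w ≤ b ξ) ∧
      lowerHull b o - 1 / ((n : ℝ) + 1) ≤ lor (hom (o : E d)) w := by
    intro n
    by_contra! hcon
    have hle := lowerHull_le hb fun w hw => (hcon w hw).le
    have : (0 : ℝ) < 1 / ((n : ℝ) + 1) := by positivity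
    linarith
  choose w hw1 hw2 using hw
  refine mem_closure_of_tendsto (b := atTop) (f := fun n => Λ (w n)) ?_
    (Eventually.of_forall fun n => LinearMap.mem_range_self _ _)
  rw [tendsto_pi_nhds]
  intro x
  have hx : ‖(x : E d)‖ < 1 := mem_ball_zero_iff.1 x.2
  let y : Ball d := ⟨-x, by rw [mem_ball_zero_iff, norm_neg]; exact hx⟩
  have hzero : Tendsto (fun n : ℕ => 2 * (1 / ((n : ℝ) + 1))) atTop (𝓝 0) := by
    simpa using tendsto_one_div_add_atTop_nhds_zero_nat.const_mul (2 : ℝ)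
  have hlow : ∀ n, Λ (w n) x ≤ lowerHull b x := fun n => lor_hom_le_lowerHull hb (hw1 n) x
  -- Equality of the hulls makes the lower hull concave too. A minorant that is optimal up to `1 /
  -- (n + 1)` at the midpoint `0` of `x` and `-x`, and lies below the hull at `-x`, loses at most
  -- twice that at `x`.
  have hup : ∀ n : ℕ, lowerHull b x - 2 * (1 / ((n : ℝ) + 1)) ≤ Λ (w n) x := by
    intro n
    have e : (o : E d) = (1 / 2 : ℝ) • (x : E d) + (1 / 2 : ℝ) • (y : E d) := by
      change (0 : E d) = (1 / 2 : ℝ) • (x : E d) + (1 / 2 : ℝ) • (-x : E d)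
      simp
    have h1 := lowerHull_combo_le (b := -b) hb.neg (x := x) (y := y) (z := o) (s := 1 / 2)
      (t := 1 / 2) (by norm_num) (by norm_num) (by norm_num) e
    have hneg : ∀ z, lowerHull (-b) z = -lowerHull b z := fun z => by
      rw [h z, upperHull, neg_neg]
    simp only [hneg] at h1
    have h2 := lor_hom_le_lowerHull hb (hw1 n) y
    have h3 := lor_hom_combo (x : E d) (y : E d) (w n) (s := 1 / 2) (t := 1 / 2) (by norm_num)
    rw [← e] at h3
    have h4 := hw2 n
    change _ ≤ lor (hom (x : E d)) (w n)
    linarith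
  refine tendsto_of_tendsto_of_tendsto_of_le_of_le ?_ tendsto_const_nhds hup hlow
  simpa using hzero.const_sub (lowerHull b x)

end Hull

/-! ### Equivariance of the hulls of the boundary map -/

section EquivariantHull

variable {d : ℕ} {Γ : Subgroup (OPlus d)}

/-- The pair `(A, τ A)` permutes the affine minorants of `b_τ`, since the boundary map and affine
functions transform by the same positive factor and the same translation. -/
theorem lor_hom_act_le_boundaryMap (hΓ : IsCompactOrientedQuotient Γ) (τ : Z1 Γ) (A : Γ)
    {w : Mink d} (hw : ∀ ξ : Sphere d, lor (hom (ξ : E d)) w ≤ boundaryMap τ ξ) (ξ : Sphere d) :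
    lor (hom (ξ : E d)) (A.1.1 w + Z1.val τ A) ≤ boundaryMap τ ξ := by
  obtain ⟨η, rfl⟩ : ∃ η, sphereAct A.1 η = ξ := by
    refine ⟨sphereAct A.1⁻¹ ξ, ?_⟩
    rw [← sphereAct_mul, mul_inv_cancel, sphereAct_one]
  rw [boundaryMap_sphereAct hΓ, lor_add_right, lor_hom_sphereAct]
  have := factor_sphere_pos A.1 η
  have := hw η
  gcongr

theorem isEquivariant_hMinus [NeZero d] (hΓ : IsCompactOrientedQuotient Γ) (τ : Z1 Γ) :
    IsEquivariant τ (hMinus τ) := by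
  have hb := continuous_boundaryMap hΓ τ
  have key : ∀ (A : Γ) (x : Ball d), L ((A.1 • x : Ball d) : E d) / L (x : E d) * hMinus τ x +
        lor (hom ((A.1 • x : Ball d) : E d)) (Z1.val τ A) ≤ hMinus τ (A.1 • x) := by
    intro A x
    have hp : 0 < L ((A.1 • x : Ball d) : E d) / L (x : E d) := div_pos (L_pos _) (L_pos _)
    rw [← le_sub_iff_add_le, ← le_div_iff₀' hp]
    refine lowerHull_le hb fun w hw => ?_
    rw [le_div_iff₀' hp, le_sub_iff_add_le, ← lor_hom_smul, ← lor_add_right]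
    exact lor_hom_le_lowerHull hb (lor_hom_act_le_boundaryMap hΓ τ A hw) _
  refine isEquivariant_iff.2 ⟨continuous_lowerHull hb, fun A x => le_antisymm ?_ (key A x)⟩
  -- The opposite inequality is the one already proved, for `A⁻¹` at the point `A • x`.
  have h1 := key A⁻¹ (A.1 • x)
  have e1 : (A⁻¹ : Γ).1 • A.1 • x = x := inv_smul_smul A.1 x
  rw [e1] at h1
  have h2 := lor_hom_smul A.1 x (Z1.val τ A⁻¹)
  have h3 := Z1.val_mul τ A A⁻¹
  rw [mul_inv_cancel, Z1.val_one] at h3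
  have h4 : A.1.1 (Z1.val τ A⁻¹) = -Z1.val τ A := (neg_eq_of_add_eq_zero_right h3.symm).symm
  rw [h4, lor_neg_right] at h2
  have hx := L_pos x
  have hy := L_pos (A.1 • x)
  have h5 := mul_le_mul_of_nonneg_left h1 (div_pos hy hx).le
  rw [mul_add, ← h2] at h5
  have e2 : L ((A.1 • x : Ball d) : E d) / L (x : E d) * (L (x : E d) /
      L ((A.1 • x : Ball d) : E d) * hMinus τ (A.1 • x)) = hMinus τ (A.1 • x) := by
    field_simp
  rw [e2] at h5
  linarith

theorem hPlus_eq (hΓ : IsCompactOrientedQuotient Γ) (τ : Z1 Γ) (x : Ball d) :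
    hPlus τ x = -hMinus (-τ) x := by
  rw [hPlus, hMinus, upperHull, boundaryMap_neg hΓ]

theorem isEquivariant_hPlus [NeZero d] (hΓ : IsCompactOrientedQuotient Γ) (τ : Z1 Γ) :
    IsEquivariant τ (hPlus τ) := by
  have h := (isEquivariant_hMinus hΓ (-τ)).const_mul (-1)
  rw [show (-1 : ℝ) • (-τ) = τ from (neg_one_smul ℝ (-τ)).trans (neg_neg τ)] at h
  convert h using 1
  ext x
  rw [hPlus_eq hΓ, neg_one_mul]

theorem hMinus_le_hPlus [NeZero d] (hΓ : IsCompactOrientedQuotient Γ) (τ : Z1 Γ) (x : Ball d) :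
    hMinus τ x ≤ hPlus τ x :=
  lowerHull_le_upperHull (continuous_boundaryMap hΓ τ) x

end EquivariantHull

end CoMinkowski

namespace CoMinkowski

/-! ## Geodesics -/

section Geodesic

variable {d : ℕ}

/-- A function whose second derivative is `k f`, with `k ≥ 0`, which is nonnegative at `0` and `1`
is nonnegative in between. -/
theorem nonneg_of_deriv_deriv_eq_mul {f f' : ℝ → ℝ} {k : ℝ} (hk : 0 ≤ k)
    (hf : ∀ t, HasDerivAt f (f' t) t) (hf' : ∀ t, HasDerivAt f' (k * f t) t) (h0 : 0 ≤ f 0)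
    (h1 : 0 ≤ f 1) {t : ℝ} (ht : t ∈ Set.Icc (0 : ℝ) 1) : 0 ≤ f t := by
  set κ := √k
  have hκ : κ * κ = k := Real.mul_self_sqrt hk
  have hexp : ∀ (c t : ℝ), HasDerivAt (fun t => Real.exp (c * t)) (Real.exp (c * t) * c) t := by
    intro c t
    simpa using ((hasDerivAt_id t).const_mul c).exp
  -- Factor the operator as `(D + κ)(D - κ)`. The first factor gives this constant; then `f * exp
  -- (-κ t)` has a derivative of constant sign, so it is monotone and is bounded below by its value
  -- at `0` or at `1`.
  have hconst : ∀ t, (f' t - κ * f t) * Real.exp (κ * t) = f' 0 - κ * f 0 := by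
    have hd : ∀ t, HasDerivAt (fun t => (f' t - κ * f t) * Real.exp (κ * t)) 0 t := by
      intro t
      refine HasDerivAt.congr_deriv (((hf' t).sub ((hf t).const_mul κ)).mul (hexp κ t)) ?_
      rw [← hκ]
      simp only [Pi.sub_apply]
      ring
    intro t
    have := is_const_of_deriv_eq_zero (fun t => (hd t).differentiableAt) (fun t => (hd t).deriv) t 0
    simpa using this
  set a := f' 0 - κ * f 0
  have hg : ∀ t, HasDerivAt (fun t => f t * Real.exp (-κ * t)) (a * Real.exp (-κ * t) ^ 2) t := by
    intro t
    refine HasDerivAt.congr_deriv ((hf t).mul (hexp (-κ) t)) ?_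
    have e : Real.exp (κ * t) * Real.exp (-κ * t) = 1 := by rw [← Real.exp_add]; simp
    rw [← hconst t]
    linear_combination ((f' t - κ * f t) * Real.exp (-κ * t)) * (-e)
  have hp : 0 < Real.exp (-κ * t) := Real.exp_pos _
  rcases le_total 0 a with ha | ha
  · have hm : Monotone fun t => f t * Real.exp (-κ * t) :=
      monotone_of_deriv_nonneg (fun t => (hg t).differentiableAt) fun t => by
        rw [(hg t).deriv]; positivity
    have := hm ht.1
    simp only [mul_zero, Real.exp_zero, mul_one] at this
    exact nonneg_of_mul_nonneg_left (h0.trans this) hp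
  · have hm : Antitone fun t => f t * Real.exp (-κ * t) :=
      antitone_of_deriv_nonpos (fun t => (hg t).differentiableAt) fun t => by
        rw [(hg t).deriv]; exact mul_nonpos_of_nonpos_of_nonneg ha (by positivity)
    have := hm ht.2
    exact nonneg_of_mul_nonneg_left ((mul_nonneg h1 (Real.exp_pos _).le).trans this) hp

theorem hasDerivAt_fst {F G : Type*} [NormedAddCommGroup F] [NormedSpace ℝ F]
    [NormedAddCommGroup G] [NormedSpace ℝ G] {f : ℝ → F × G} {f' : F × G} {t : ℝ}
    (hf : HasDerivAt f f' t) : HasDerivAt (fun t => (f t).1) f'.1 t :=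
  (ContinuousLinearMap.fst ℝ F G).hasFDerivAt.comp_hasDerivAt t hf

theorem hasDerivAt_snd {F G : Type*} [NormedAddCommGroup F] [NormedSpace ℝ F]
    [NormedAddCommGroup G] [NormedSpace ℝ G] {f : ℝ → F × G} {f' : F × G} {t : ℝ}
    (hf : HasDerivAt f f' t) : HasDerivAt (fun t => (f t).2) f'.2 t :=
  (ContinuousLinearMap.snd ℝ F G).hasFDerivAt.comp_hasDerivAt t hf

theorem hasDerivAt_lor {f g : ℝ → Mink d} {f' g' : Mink d} {t : ℝ} (hf : HasDerivAt f f' t)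
    (hg : HasDerivAt g g' t) :
    HasDerivAt (fun t => lor (f t) (g t)) (lor f' (g t) + lor (f t) g') t := by
  have h1 := (hasDerivAt_fst hf).inner ℝ (hasDerivAt_fst hg)
  have h2 := (hasDerivAt_snd hf).mul (hasDerivAt_snd hg)
  refine HasDerivAt.congr_deriv (h1.sub h2) ?_
  simp only [lor]
  ring

/-- By Cauchy-Schwarz in `ℝ^d`, a vector orthogonal to a timelike one cannot be timelike. -/
theorem lor_self_nonneg_of_lor_eq_zero {n v : Mink d} (hn : lor n n = -1) (h : lor n v = 0) :
    0 ≤ lor v v := by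
  simp only [lor, real_inner_self_eq_norm_sq] at *
  have hcs := abs_real_inner_le_norm n.1 v.1
  have h1 : (inner ℝ n.1 v.1) ^ 2 ≤ (‖n.1‖ * ‖v.1‖) ^ 2 :=
    sq_le_sq' (by linarith [(abs_le.1 hcs).1]) (abs_le.1 hcs).2
  have h2 : inner ℝ n.1 v.1 = n.2 * v.2 := by linarith
  rw [h2] at h1
  have h3 : n.2 ^ 2 = ‖n.1‖ ^ 2 + 1 := by linarith
  have h4 : (n.2 * v.2) ^ 2 = (‖n.1‖ ^ 2 + 1) * v.2 ^ 2 := by rw [mul_pow, h3]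
  by_contra hneg
  have h5 : ‖v.1‖ ^ 2 < v.2 ^ 2 := by nlinarith
  nlinarith [sq_nonneg ‖n.1‖, mul_le_mul_of_nonneg_left h5.le (sq_nonneg ‖n.1‖), sq_nonneg ‖v.1‖]

theorem lor_toQuadric (p : CoMink d) : lor (toQuadric p).1 (toQuadric p).1 = -1 :=
  (hom_mem_hyperboloid p.1).1

/-- Half-spaces of co-Minkowski space are convex along geodesics. -/
theorem IsGeodesic.lor_le {γ : ℝ → CoMink d} (H : IsGeodesic γ) {w : Mink d} {c : ℝ}
    (h0 : c * lor (hom ((γ 0).1 : E d)) w ≤ c * (γ 0).2)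
    (h1 : c * lor (hom ((γ 1).1 : E d)) w ≤ c * (γ 1).2) {t : ℝ} (ht : t ∈ Set.Icc (0 : ℝ) 1) :
    c * lor (hom ((γ t).1 : E d)) w ≤ c * (γ t).2 := by
  set q : ℝ → Mink d × ℝ := fun t => toQuadric (γ t) with hq
  obtain ⟨Hc, H2⟩ := H
  have hd : ∀ t, HasDerivAt q (deriv q t) t := fun t =>
    (Hc.differentiable (by norm_num) t).hasDerivAt
  have hd' : ∀ t, HasDerivAt (deriv q) (deriv (deriv q) t) t := fun t => by
    have : ContDiff ℝ 1 (deriv q) := (contDiff_succ_iff_deriv (n := 1).1 Hc).2.2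
    exact (this.differentiable (by norm_num) t).hasDerivAt
  have hn : ∀ t, lor (q t).1 (q t).1 = -1 := fun t => lor_toQuadric _
  have horth : ∀ t, lor (q t).1 (deriv q t).1 = 0 := by
    intro t
    have h1 := hasDerivAt_lor (hasDerivAt_fst (hd t)) (hasDerivAt_fst (hd t))
    have h2 : HasDerivAt (fun t => lor (q t).1 (q t).1) 0 t := by
      simp only [hn]; exact hasDerivAt_const _ _
    have h3 := h1.unique h2
    rw [lor_comm] at h3
    linarith
  set k : ℝ → ℝ := fun t => lor (deriv q t).1 (deriv q t).1
  -- The speed is constant: its derivative is a multiple of the pairing of position and velocity,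
  -- which vanishes on the quadric.
  have hk : ∀ t, k t = k 0 := by
    have hkd : ∀ t, HasDerivAt k 0 t := by
      intro t
      refine HasDerivAt.congr_deriv (hasDerivAt_lor (hasDerivAt_fst (hd' t))
        (hasDerivAt_fst (hd' t))) ?_
      rw [H2 t]
      have := horth t
      simp only [Prod.smul_fst, lor_smul_left, lor_smul_right]
      rw [lor_comm (deriv q t).1 (toQuadric (γ t)).1]
      change _ * lor (q t).1 (deriv q t).1 + _ * lor (q t).1 (deriv q t).1 = 0
      rw [this]; ring
    intro t
    exact is_const_of_deriv_eq_zero (fun t => (hkd t).differentiableAt) (fun t => (hkd t).deriv) t 0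
  have hk0 : 0 ≤ k 0 := lor_self_nonneg_of_lor_eq_zero (hn 0) (horth 0)
  -- A linear form along the curve, so the geodesic equation reads `f'' = k f` with constant `k ≥
  -- 0`. The sign of `c` selects the half-space above or below the hyperplane.
  let f : ℝ → ℝ := fun t => c * ((q t).2 - lor (q t).1 w)
  let f' : ℝ → ℝ := fun t => c * ((deriv q t).2 - lor (deriv q t).1 w)
  have hw : ∀ t, HasDerivAt (fun _ : ℝ => w) 0 t := fun t => hasDerivAt_const t w
  have hf : ∀ t, HasDerivAt f (f' t) t := by
    intro t
    refine HasDerivAt.congr_deriv (((hasDerivAt_snd (hd t)).sub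
      (hasDerivAt_lor (hasDerivAt_fst (hd t)) (hw t))).const_mul c) ?_
    simp [f', lor_zero_right]
  have hf' : ∀ t, HasDerivAt f' (k 0 * f t) t := by
    intro t
    refine HasDerivAt.congr_deriv (((hasDerivAt_snd (hd' t)).sub
      (hasDerivAt_lor (hasDerivAt_fst (hd' t)) (hw t))).const_mul c) ?_
    rw [H2 t, lor_zero_right]
    change c * (k t * _ - (lor (k t • _) _ + 0)) = _
    rw [hk t, lor_smul_left]
    simp only [f, q]
    ring
  have hfe : ∀ t, f t = (L ((γ t).1 : E d))⁻¹ *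
      (c * (γ t).2 - c * lor (hom ((γ t).1 : E d)) w) := by
    intro t
    simp only [f, q, toQuadric, lor_smul_left]
    ring
  have hpos : ∀ t, 0 < (L ((γ t).1 : E d))⁻¹ := fun t => inv_pos.2 (L_pos _)
  have := nonneg_of_deriv_deriv_eq_mul hk0 hf hf'
    (by rw [hfe]; exact mul_nonneg (hpos 0).le (by linarith))
    (by rw [hfe]; exact mul_nonneg (hpos 1).le (by linarith)) ht
  rw [hfe] at this
  have := nonneg_of_mul_nonneg_right this (hpos t)
  linarith

theorem exists_toQuadric_eq {q : Mink d × ℝ} (h1 : lor q.1 q.1 = -1) (h2 : 0 < q.1.2) :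
    ∃ p : CoMink d, toQuadric p = q ∧ (p.1 : E d) = q.1.2⁻¹ • q.1.1 ∧ p.2 = q.1.2⁻¹ * q.2 := by
  have h1' : ‖q.1.1‖ ^ 2 - q.1.2 * q.1.2 = -1 := by
    simpa only [lor, real_inner_self_eq_norm_sq] using h1
  have hlt : ‖q.1.1‖ < q.1.2 := by nlinarith [norm_nonneg q.1.1]
  have hn : ‖q.1.2⁻¹ • q.1.1‖ = q.1.2⁻¹ * ‖q.1.1‖ := by
    rw [norm_smul, norm_inv, Real.norm_of_nonneg h2.le]
  have hL : L (q.1.2⁻¹ • q.1.1) = q.1.2⁻¹ := by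
    rw [L, hn]
    have : 1 - (q.1.2⁻¹ * ‖q.1.1‖) ^ 2 = (q.1.2⁻¹) ^ 2 := by
      field_simp; linarith
    rw [this, Real.sqrt_sq (inv_pos.2 h2).le]
  refine ⟨(⟨q.1.2⁻¹ • q.1.1, ?_⟩, q.1.2⁻¹ * q.2), ?_, rfl, rfl⟩
  · rw [mem_ball_zero_iff, hn, inv_mul_lt_iff₀ h2, mul_one]; exact hlt
  · refine Prod.ext (Prod.ext ?_ ?_) ?_
    · simp only [toQuadric, hL, hom, Prod.smul_mk, inv_inv, smul_smul, mul_inv_cancel₀ h2.ne',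
        one_smul]
    · simp only [toQuadric, hL, hom, Prod.smul_mk, inv_inv, smul_eq_mul, mul_one]
    · simp only [toQuadric, hL, inv_inv]
      rw [mul_inv_cancel_left₀ h2.ne']

/-- The left-out geometry: the right side is the hyperbolic cosine of the distance from `p` to `q`.
The inequality reduces to `2 L p L q ≤ L p ^ 2 + L q ^ 2` and `p ≠ q`. -/
theorem one_lt_neg_lor {p q : Ball d} (hpq : p ≠ q) :
    1 < -lor ((L (p : E d))⁻¹ • hom (p : E d)) ((L (q : E d))⁻¹ • hom (q : E d)) := by
  have hp := L_pos p
  have hq := L_pos q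
  have hp2 := L_sq p
  have hq2 := L_sq q
  rw [lor_smul_smul, ← mul_inv, ← mul_neg, lt_inv_mul_iff₀ (mul_pos hp hq), mul_one]
  simp only [lor, hom, mul_one]
  have hne : 0 < ‖(p : E d) - q‖ ^ 2 := by
    have : (p : E d) - q ≠ 0 := sub_ne_zero.2 fun h => hpq (Subtype.ext h)
    positivity
  rw [norm_sub_sq_real] at hne
  nlinarith [sq_nonneg (L (p : E d) - L (q : E d))]

/-- Straight segments of the cylinder are traced by geodesics. -/
theorem exists_isGeodesic (p q : CoMink d) {s : ℝ} (hs : s ∈ Set.Icc (0 : ℝ) 1) :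
    ∃ γ : ℝ → CoMink d, IsGeodesic γ ∧ γ 0 = p ∧ γ 1 = q ∧ ∃ t ∈ Set.Icc (0 : ℝ) 1,
      ((γ t).1 : E d) = (1 - s) • (p.1 : E d) + s • (q.1 : E d) ∧
      (γ t).2 = (1 - s) * p.2 + s * q.2 := by
  by_cases hpq : p.1 = q.1
  -- Over a single base point the fibre direction is null for the degenerate form, so the geodesic
  -- is an affine line.
  · let v : Mink d × ℝ := (0, (L (p.1 : E d))⁻¹ * (q.2 - p.2))
    have e : ∀ t : ℝ, toQuadric (p.1, (1 - t) * p.2 + t * q.2) = toQuadric p + t • v := by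
      intro t
      refine Prod.ext ?_ ?_
      · simp [toQuadric, v]
      · simp [toQuadric, v]; ring
    have hd : ∀ t : ℝ, HasDerivAt (fun t : ℝ => toQuadric p + t • v) v t := fun t => by
      simpa using ((hasDerivAt_id t).smul_const v).const_add (toQuadric p)
    refine ⟨fun t => (p.1, (1 - t) * p.2 + t * q.2), ⟨?_, fun t => ?_⟩, by simp,
      Prod.ext hpq (by simp), s, hs, ?_, rfl⟩
    · simp only [e]; fun_prop
    · simp only [e]
      have : (deriv fun t : ℝ => toQuadric p + t • v) = fun _ => v := funext fun t => (hd t).deriv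
      rw [this]
      simp [v, lor]
    · simp [← hpq, ← add_smul]
  · set C₀ := toQuadric p with hC₀
    set C₁ := toQuadric q with hC₁
    have hp := L_pos p.1
    have hq := L_pos q.1
    have h00 : lor C₀.1 C₀.1 = -1 := lor_toQuadric p
    have h11 : lor C₁.1 C₁.1 = -1 := lor_toQuadric q
    have h1lt : 1 < -lor C₀.1 C₁.1 := one_lt_neg_lor hpq
    set κ := Real.arcosh (-lor C₀.1 C₁.1)
    have hκ : 0 < κ := Real.arcosh_pos h1lt
    have hcosh : lor C₀.1 C₁.1 = -Real.cosh κ := by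
      rw [Real.cosh_arcosh h1lt.le]; ring
    have hsinh : 0 < Real.sinh κ := Real.sinh_pos_iff.2 hκ
    set S := Real.sinh κ
    -- Hyperbolic interpolation at constant speed `κ`, the hyperbolic distance. The curve stays in
    -- the plane of `C₀` and `C₁`, so its central projection is the straight segment.
    let α : ℝ → ℝ := fun t => Real.sinh (κ * (1 - t)) / S
    let β : ℝ → ℝ := fun t => Real.sinh (κ * t) / S
    let α' : ℝ → ℝ := fun t => -(κ * Real.cosh (κ * (1 - t))) / S
    let β' : ℝ → ℝ := fun t => κ * Real.cosh (κ * t) / S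
    have hα : ∀ t, HasDerivAt α (α' t) t := by
      intro t
      have h1 : HasDerivAt (fun t : ℝ => κ * (1 - t)) (-κ) t := by
        simpa using ((hasDerivAt_id t).const_sub 1).const_mul κ
      refine HasDerivAt.congr_deriv (h1.sinh.div_const S) ?_
      simp only [α']; ring
    have hα' : ∀ t, HasDerivAt α' (κ ^ 2 * α t) t := by
      intro t
      have h1 : HasDerivAt (fun t : ℝ => κ * (1 - t)) (-κ) t := by
        simpa using ((hasDerivAt_id t).const_sub 1).const_mul κ
      refine HasDerivAt.congr_deriv ((h1.cosh.const_mul κ).neg.div_const S) ?_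
      simp only [α]; ring
    have hβ : ∀ t, HasDerivAt β (β' t) t := by
      intro t
      have h1 : HasDerivAt (fun t : ℝ => κ * t) κ t := by
        simpa using (hasDerivAt_id t).const_mul κ
      refine HasDerivAt.congr_deriv (h1.sinh.div_const S) ?_
      simp only [β']; ring
    have hβ' : ∀ t, HasDerivAt β' (κ ^ 2 * β t) t := by
      intro t
      have h1 : HasDerivAt (fun t : ℝ => κ * t) κ t := by
        simpa using (hasDerivAt_id t).const_mul κ
      refine HasDerivAt.congr_deriv ((h1.cosh.const_mul κ).div_const S) ?_
      simp only [β]; ring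
    let c : ℝ → Mink d × ℝ := fun t => α t • C₀ + β t • C₁
    let c' : ℝ → Mink d × ℝ := fun t => α' t • C₀ + β' t • C₁
    have hc : ∀ t, HasDerivAt c (c' t) t := fun t =>
      ((hα t).smul_const C₀).add ((hβ t).smul_const C₁)
    have hc' : ∀ t, HasDerivAt c' (κ ^ 2 • c t) t := by
      intro t
      refine HasDerivAt.congr_deriv (((hα' t).smul_const C₀).add ((hβ' t).smul_const C₁)) ?_
      simp only [c, smul_add, smul_smul]
    have hlor : ∀ a b : ℝ, lor (a • C₀ + b • C₁).1 (a • C₀ + b • C₁).1 =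
        -a ^ 2 - b ^ 2 - 2 * a * b * Real.cosh κ := by
      intro a b
      simp only [Prod.fst_add, Prod.smul_fst, lor_add_left, lor_add_right, lor_smul_left,
        lor_smul_right, h00, h11, lor_comm C₁.1 C₀.1, hcosh]
      ring
    have hκt : ∀ t, κ = κ * (1 - t) + κ * t := fun t => by ring
    have hq1 : ∀ t, lor (c t).1 (c t).1 = -1 := by
      intro t
      rw [hlor]
      simp only [α, β]
      have hS : S = Real.sinh (κ * (1 - t)) * Real.cosh (κ * t) +
          Real.cosh (κ * (1 - t)) * Real.sinh (κ * t) := by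
        rw [← Real.sinh_add, ← hκt]
      have hC : Real.cosh κ = Real.cosh (κ * (1 - t)) * Real.cosh (κ * t) +
          Real.sinh (κ * (1 - t)) * Real.sinh (κ * t) := by
        rw [← Real.cosh_add, ← hκt]
      have e1 := Real.cosh_sq (κ * (1 - t))
      have e2 := Real.cosh_sq (κ * t)
      have hS0 := hsinh.ne'
      field_simp
      rw [hC, hS]
      linear_combination (Real.sinh (κ * (1 - t)) ^ 2) * e2 + (Real.sinh (κ * t) ^ 2) * e1
    have hq2 : ∀ t, lor (c' t).1 (c' t).1 = κ ^ 2 := by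
      intro t
      rw [hlor]
      simp only [α', β']
      have hS : S = Real.sinh (κ * (1 - t)) * Real.cosh (κ * t) +
          Real.cosh (κ * (1 - t)) * Real.sinh (κ * t) := by
        rw [← Real.sinh_add, ← hκt]
      have hC : Real.cosh κ = Real.cosh (κ * (1 - t)) * Real.cosh (κ * t) +
          Real.sinh (κ * (1 - t)) * Real.sinh (κ * t) := by
        rw [← Real.cosh_add, ← hκt]
      have e1 := Real.cosh_sq (κ * (1 - t))
      have e2 := Real.cosh_sq (κ * t)
      have hS0 := hsinh.ne'
      field_simp
      rw [hC, hS]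
      linear_combination (Real.cosh (κ * t) ^ 2) * e1 + (Real.cosh (κ * (1 - t)) ^ 2) * e2
    have hα0 : ∀ t ∈ Set.Icc (0 : ℝ) 1, 0 ≤ α t := fun t ht =>
      div_nonneg (Real.sinh_nonneg_iff.2 (mul_nonneg hκ.le (by linarith [ht.2]))) hsinh.le
    have hβ0 : ∀ t ∈ Set.Icc (0 : ℝ) 1, 0 ≤ β t := fun t ht =>
      div_nonneg (Real.sinh_nonneg_iff.2 (mul_nonneg hκ.le ht.1)) hsinh.le
    have hc2 : ∀ t, (c t).1.2 = α t * (L (p.1 : E d))⁻¹ + β t * (L (q.1 : E d))⁻¹ := by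
      intro t; simp [c, C₀, C₁, toQuadric, hom]
    -- The last coordinate cannot vanish on `{⟨n, n⟩ = -1}`, so by connectedness the curve stays on
    -- the future sheet for all real `t`, not only in `[0, 1]`.
    have hcpos : ∀ t, 0 < (c t).1.2 := by
      have hcont : Continuous fun t => (c t).1.2 :=
        (continuous_snd.comp continuous_fst).comp
          (continuous_iff_continuousAt.2 fun t => (hc t).continuousAt)
      have hne : ∀ t, (c t).1.2 ≠ 0 := by
        intro t h0
        have := hq1 t
        simp only [lor, h0, real_inner_self_eq_norm_sq] at this
        nlinarith [sq_nonneg ‖(c t).1.1‖]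
      intro t
      by_contra hneg
      have h0 : 0 ≤ (c 0).1.2 := by
        rw [hc2]
        have := hα0 0 (by simp)
        have := hβ0 0 (by simp)
        positivity
      obtain ⟨t', ht'⟩ := mem_range_of_exists_le_of_exists_ge hcont ⟨t, not_lt.1 hneg⟩ ⟨0, h0⟩
      exact hne t' ht'
    choose γ hγ hγ1 hγ2 using fun t => exists_toQuadric_eq (hq1 t) (hcpos t)
    have hγc : (fun t => toQuadric (γ t)) = c := funext hγ
    have hinj : Function.Injective (toQuadric : CoMink d → Mink d × ℝ) := by
      intro x y hxy
      have e1 := congrArg (fun z => z.1.2) hxy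
      simp only [toQuadric, hom, Prod.smul_snd, smul_eq_mul, mul_one] at e1
      have e2 := congrArg (fun z => z.1.1) hxy
      simp only [toQuadric, hom, Prod.smul_fst, e1] at e2
      have e3 := congrArg (fun z => z.2) hxy
      simp only [toQuadric, e1] at e3
      have hy := inv_ne_zero (L_pos y.1).ne'
      exact Prod.ext (Subtype.ext (smul_right_injective _ hy e2)) (mul_left_cancel₀ hy e3)
    have hα_0 : α 0 = 1 := by simp [α, S, hsinh.ne']
    have hα_1 : α 1 = 0 := by simp [α]
    have hβ_0 : β 0 = 0 := by simp [β]
    have hβ_1 : β 1 = 1 := by simp [β, S, hsinh.ne']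
    refine ⟨γ, ⟨?_, fun t => ?_⟩, hinj ?_, hinj ?_, ?_⟩
    · rw [hγc]
      simp only [c, α, β]
      have : ContDiff ℝ 2 Real.sinh := Real.contDiff_sinh
      fun_prop
    · rw [hγc]
      have e1 : deriv c = c' := funext fun t => (hc t).deriv
      rw [e1, (hc' t).deriv, hq2, hγ]
    · rw [hγ]; simp [c, hα_0, hβ_0, C₀]
    · rw [hγ]; simp [c, hα_1, hβ_1, C₁]
    -- This quotient is the position of the projected point on the segment; it runs from `0` to `1`,
    -- so the intermediate value theorem gives the parameter for `s`.
    · have hcont : ContinuousOn (fun t => β t * (L (q.1 : E d))⁻¹ / (c t).1.2) (Set.Icc 0 1) := by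
        refine ContinuousOn.div ?_ ?_ fun t _ => (hcpos t).ne'
        · exact (continuous_iff_continuousAt.2 fun t =>
            ((hβ t).continuousAt.mul continuousAt_const)).continuousOn
        · exact ((continuous_snd.comp continuous_fst).comp
            (continuous_iff_continuousAt.2 fun t => (hc t).continuousAt)).continuousOn
      have hivt := intermediate_value_Icc zero_le_one hcont
      have hmem : s ∈ Set.Icc (β 0 * (L (q.1 : E d))⁻¹ / (c 0).1.2)
          (β 1 * (L (q.1 : E d))⁻¹ / (c 1).1.2) := by
        rw [hc2, hc2, hα_0, hα_1, hβ_0, hβ_1]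
        have := inv_ne_zero hq.ne'
        simpa [this] using hs
      obtain ⟨t, ht, hts⟩ := hivt hmem
      simp only at hts
      have hne := (hcpos t).ne'
      have e1 : (c t).1.2⁻¹ * (β t * (L (q.1 : E d))⁻¹) = s := by rw [← hts]; field_simp
      have e0 : (c t).1.2⁻¹ * (α t * (L (p.1 : E d))⁻¹) = 1 - s := by
        rw [← hts, eq_sub_iff_add_eq, div_eq_inv_mul, ← mul_add, ← hc2, inv_mul_cancel₀ hne]
      refine ⟨t, ht, ?_, ?_⟩
      · rw [hγ1, ← e0, ← e1]
        simp only [c, C₀, C₁, toQuadric, hom, Prod.fst_add, Prod.smul_fst, smul_add, smul_smul]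
      · rw [hγ2, ← e0, ← e1]
        simp only [c, C₀, C₁, toQuadric, Prod.snd_add, Prod.smul_snd, smul_eq_mul]
        ring

end Geodesic

end CoMinkowski

namespace CoMinkowski

/-! ## The convex core -/

section Core

variable {d : ℕ} {Γ : Subgroup (OPlus d)}

theorem one_sub_inner_smul (A : OPlus d) (x y : Ball d) :
    1 - inner ℝ ((A • x : Ball d) : E d) ((A • y : Ball d) : E d) =
      L ((A • x : Ball d) : E d) / L (x : E d) * (L ((A • y : Ball d) : E d) / L (y : E d)) *
        (1 - inner ℝ (x : E d) (y : E d)) := by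
  have h1 := A.2.1 (hom (x : E d)) (hom (y : E d))
  rw [apply_hom_eq, apply_hom_eq, lor_smul_smul] at h1
  simp only [lor, hom, mul_one] at h1
  have hx := (L_pos x).ne'
  have hy := (L_pos y).ne'
  have hx' := (L_pos (A • x)).ne'
  have hy' := (L_pos (A • y)).ne'
  field_simp
  field_simp at h1
  linarith

/-- Every orbit accumulates at every point at infinity. -/
theorem exists_tendsto_smul (hΓ : IsCompactOrientedQuotient Γ) (x : Ball d) (ξ : Sphere d) :
    ∃ A : ℕ → Γ, Tendsto (fun n => (A n).1 • x) atTop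
      (comap (Subtype.val : Ball d → E d) (𝓝 (ξ : E d))) := by
  obtain ⟨l, hl, hA⟩ := hΓ.exists_le_L
  -- `B n` brings the ray point back to a fixed compact set, so `(B n)⁻¹ • x` remains at bounded
  -- hyperbolic distance from the ray, hence Euclidean close to it far out.
  choose B hB using fun n : ℕ => hA (ray ξ n)
  refine ⟨fun n => (B n)⁻¹, ?_⟩
  rw [tendsto_comap_iff]
  have hcosh : Tendsto (fun n : ℕ => (Real.cosh n)⁻¹) atTop (𝓝 0) := by
    refine Tendsto.inv_tendsto_atTop (tendsto_atTop_mono (fun n => ?_) tendsto_natCast_atTop_atTop)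
    have h1 := Real.sinh_lt_cosh (n : ℝ)
    have h2 := Real.self_le_sinh_iff.2 (Nat.cast_nonneg n : (0 : ℝ) ≤ n)
    linarith
  have hray : Tendsto (fun n : ℕ => (ray ξ n : E d)) atTop (𝓝 (ξ : E d)) := by
    have ht : Tendsto (fun n : ℕ => Real.tanh n) atTop (𝓝 1) := by
      have h1 : ∀ n : ℕ, Real.tanh n = √(1 - (Real.cosh n)⁻¹ ^ 2) := by
        intro n
        have hc := Real.cosh_pos (n : ℝ)
        have h2 : 1 - (Real.cosh n)⁻¹ ^ 2 = Real.tanh n ^ 2 := by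
          rw [Real.tanh_eq_sinh_div_cosh]
          have := Real.cosh_sq (n : ℝ)
          field_simp
          linarith
        rw [h2, Real.sqrt_sq]
        rw [Real.tanh_eq_sinh_div_cosh]
        exact div_nonneg (Real.sinh_nonneg_iff.2 (Nat.cast_nonneg n)) hc.le
      simp only [h1]
      have := ((hcosh.pow 2).const_sub 1).sqrt
      simpa using this
    simpa [ray] using ht.smul_const (ξ : E d)
  have hdist : Tendsto (fun n : ℕ => ((((B n)⁻¹ : Γ).1 • x : Ball d) : E d) - (ray ξ n : E d)) atTop
      (𝓝 0) := by
    rw [tendsto_zero_iff_norm_tendsto_zero]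
    -- For points `u`, `r` of the ball, `‖u - r‖ ^ 2 ≤ 2 * (1 - ⟨u, r⟩)`, and `one_sub_inner_smul`
    -- makes the right side a multiple of `L (ray ξ n) = 1 / cosh n`.
    have hb : ∀ n, ‖((((B n)⁻¹ : Γ).1 • x : Ball d) : E d) - (ray ξ n : E d)‖ ≤
        √(4 * ((L (x : E d))⁻¹ * l⁻¹) * (Real.cosh n)⁻¹) := by
      intro n
      set y : Ball d := (B n).1 • ray ξ n with hy
      have hy' : ((B n)⁻¹ : Γ).1 • y = ray ξ n := inv_smul_smul _ _
      have h1 := one_sub_inner_smul ((B n)⁻¹ : Γ).1 x y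
      rw [hy', L_ray] at h1
      set u : Ball d := ((B n)⁻¹ : Γ).1 • x
      have hu1 : ‖(u : E d)‖ < 1 := mem_ball_zero_iff.1 u.2
      have hr1 : ‖(ray ξ n : E d)‖ < 1 := mem_ball_zero_iff.1 (ray ξ n).2
      have hx1 : ‖(x : E d)‖ < 1 := mem_ball_zero_iff.1 x.2
      have hy1 : ‖(y : E d)‖ < 1 := mem_ball_zero_iff.1 y.2
      have h2 : 1 - inner ℝ (x : E d) (y : E d) ≤ 2 := by
        have := (abs_le.1 (abs_real_inner_le_norm (x : E d) (y : E d))).1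
        nlinarith [norm_nonneg (x : E d), norm_nonneg (y : E d)]
      have h2' : 0 ≤ 1 - inner ℝ (x : E d) (y : E d) := by
        have := (abs_le.1 (abs_real_inner_le_norm (x : E d) (y : E d))).2
        nlinarith [norm_nonneg (x : E d), norm_nonneg (y : E d)]
      have hly : (L (y : E d))⁻¹ ≤ l⁻¹ := inv_anti₀ hl (hB n).le
      have hLx := inv_pos.2 (L_pos x)
      have hLy := inv_pos.2 (L_pos y)
      have hLu := L_le_one (u : E d)
      have hLu0 := L_pos u
      have hc := inv_pos.2 (Real.cosh_pos (n : ℝ))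
      refine Real.le_sqrt_of_sq_le ?_
      rw [norm_sub_sq_real]
      have h3 : 1 - inner ℝ (u : E d) (ray ξ n : E d) ≤
          (1 * (L (x : E d))⁻¹) * ((Real.cosh n)⁻¹ * l⁻¹) * 2 := by
        rw [h1, div_eq_mul_inv, div_eq_mul_inv]
        gcongr
      nlinarith [norm_nonneg (u : E d), norm_nonneg (ray ξ n : E d)]
    refine squeeze_zero (fun n => norm_nonneg _) hb ?_
    have := (hcosh.const_mul (4 * ((L (x : E d))⁻¹ * l⁻¹))).sqrt
    simpa using this
  have := hdist.add hray
  simpa [Function.comp_def] using this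

theorem proj_smul (τ : Z1 Γ) (A : Γ) (p : CoMink d) :
    proj τ (coAct ⟨A.1, Z1.val τ A⟩ p) = proj τ p :=
  Quotient.sound ⟨⟨⟨A.1, Z1.val τ A⟩, A, rfl⟩, rfl⟩

theorem exists_coAct_eq_of_proj_eq {τ : Z1 Γ} {p q : CoMink d} (h : proj τ p = proj τ q) :
    ∃ A : Γ, coAct ⟨A.1, Z1.val τ A⟩ q = p := by
  obtain ⟨⟨_, A, rfl⟩, hg⟩ := Quotient.exact h
  exact ⟨A, hg⟩

theorem IsEquivariant.coAct_eq {τ : Z1 Γ} {h : Ball d → ℝ} (H : IsEquivariant τ h) (A : Γ)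
    (x : Ball d) : coAct ⟨A.1, Z1.val τ A⟩ (x, h x) = (A.1 • x, h (A.1 • x)) := by
  rw [H.smul_eq]; rfl

/-- The region between the hulls of the boundary map. -/
def hullRegion (τ : Z1 Γ) : Set (CoMink d) := {p | hMinus τ p.1 ≤ p.2 ∧ p.2 ≤ hPlus τ p.1}

theorem coAct_mem_hullRegion_iff [NeZero d] (hΓ : IsCompactOrientedQuotient Γ) (τ : Z1 Γ) (A : Γ)
    (p : CoMink d) : coAct ⟨A.1, Z1.val τ A⟩ p ∈ hullRegion τ ↔ p ∈ hullRegion τ := by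
  have hp : 0 < L ((A.1 • p.1 : Ball d) : E d) / L (p.1 : E d) := div_pos (L_pos _) (L_pos _)
  change hMinus τ (A.1 • p.1) ≤ _ * p.2 + _ ∧ _ * p.2 + _ ≤ hPlus τ (A.1 • p.1) ↔ _
  rw [(isEquivariant_hMinus hΓ τ).smul_eq, (isEquivariant_hPlus hΓ τ).smul_eq,
    add_le_add_iff_right, add_le_add_iff_right]
  exact and_congr (mul_le_mul_iff_right₀ hp) (mul_le_mul_iff_right₀ hp)

theorem proj_mem_image_hullRegion_iff [NeZero d] (hΓ : IsCompactOrientedQuotient Γ) (τ : Z1 Γ)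
    (p : CoMink d) : proj τ p ∈ proj τ '' hullRegion τ ↔ p ∈ hullRegion τ := by
  refine ⟨?_, fun h => ⟨p, h, rfl⟩⟩
  rintro ⟨q, hq, hqp⟩
  obtain ⟨A, rfl⟩ := exists_coAct_eq_of_proj_eq hqp.symm
  exact (coAct_mem_hullRegion_iff hΓ τ A q).2 hq

theorem isClosed_iff_preimage_proj (τ : Z1 Γ) (C : Set (CoQuotient τ)) :
    IsClosed C ↔ IsClosed (proj τ ⁻¹' C) :=
  (isQuotientMap_quot_mk.isClosed_preimage (s := C)).symm

theorem isClosed_hullRegion [NeZero d] (hΓ : IsCompactOrientedQuotient Γ) (τ : Z1 Γ) :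
    IsClosed (hullRegion τ) :=
  (isClosed_le ((isEquivariant_hMinus hΓ τ).1.comp continuous_fst) continuous_snd).inter
    (isClosed_le continuous_snd ((isEquivariant_hPlus hΓ τ).1.comp continuous_fst))

/-- The region is an intersection of half-spaces, so `IsGeodesic.lor_le` yields its convexity. -/
theorem mem_hullRegion_iff [NeZero d] (hΓ : IsCompactOrientedQuotient Γ) (τ : Z1 Γ) (p : CoMink d) :
    p ∈ hullRegion τ ↔
      (∀ w : Mink d, (∀ ξ : Sphere d, lor (hom (ξ : E d)) w ≤ boundaryMap τ ξ) →
        lor (hom (p.1 : E d)) w ≤ p.2) ∧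
      (∀ w : Mink d, (∀ ξ : Sphere d, boundaryMap τ ξ ≤ lor (hom (ξ : E d)) w) →
        p.2 ≤ lor (hom (p.1 : E d)) w) := by
  have hb := continuous_boundaryMap hΓ τ
  constructor
  · rintro ⟨h1, h2⟩
    exact ⟨fun w hw => (lor_hom_le_lowerHull hb hw _).trans h1,
      fun w hw => h2.trans (upperHull_le_lor_hom hb hw _)⟩
  · rintro ⟨h1, h2⟩
    refine ⟨lowerHull_le hb fun w hw => h1 w hw, ?_⟩
    rw [hPlus, upperHull, le_neg]
    refine lowerHull_le hb.neg fun w hw => ?_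
    have := h2 (-w) fun ξ => by
      rw [lor_neg_right]; linarith [hw ξ, Pi.neg_apply (boundaryMap τ) ξ]
    rw [lor_neg_right] at this
    linarith

theorem image_hullRegion_mem_convexSets [NeZero d] (hΓ : IsCompactOrientedQuotient Γ) (τ : Z1 Γ) :
    proj τ '' hullRegion τ ∈ convexSets τ := by
  refine ⟨⟨_, (⟨0, by simp⟩, _), ⟨le_rfl, hMinus_le_hPlus hΓ τ _⟩, rfl⟩, ?_, ?_⟩
  · rw [isClosed_iff_preimage_proj]
    convert isClosed_hullRegion hΓ τ using 1
    ext p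
    exact proj_mem_image_hullRegion_iff hΓ τ p
  · intro γ hγ h0 h1 t ht
    rw [proj_mem_image_hullRegion_iff hΓ, mem_hullRegion_iff hΓ] at *
    refine ⟨fun w hw => ?_, fun w hw => ?_⟩
    · have := hγ.lor_le (w := w) (c := 1) (by simpa using h0.1 w hw) (by simpa using h1.1 w hw) ht
      simpa using this
    · have := hγ.lor_le (w := w) (c := -1) (by simpa using h0.2 w hw) (by simpa using h1.2 w hw) ht
      simpa using this

/-- The inclusion of the cylinder `B^d × ℝ` in `ℝ^d × ℝ`. -/
def cyl (p : CoMink d) : E d × ℝ := ((p.1 : E d), p.2)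

theorem isInducing_cyl : IsInducing (cyl : CoMink d → E d × ℝ) :=
  IsInducing.subtypeVal.prodMap IsInducing.id

/-- An equivariant graph passes through `p`; it contains the orbit of `p` and has boundary map
`b_τ`. Following an orbit whose base points tend to `ξ` gives the limit. -/
theorem boundary_mem_closure (hΓ : IsCompactOrientedQuotient Γ) {τ : Z1 Γ}
    {C : Set (CoQuotient τ)} {p : CoMink d} (hp : proj τ p ∈ C) (ξ : Sphere d) :
    ((ξ : E d), boundaryMap τ ξ) ∈ closure (cyl '' (proj τ ⁻¹' C)) := by
  obtain ⟨h, H⟩ := exists_isEquivariant hΓ τ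
  obtain ⟨A, hA⟩ := exists_tendsto_smul hΓ p.1 ξ
  have H' := H.add_mul_L ((p.2 - h p.1) / L (p.1 : E d))
  set h' : Ball d → ℝ := fun x => h x + (p.2 - h p.1) / L (p.1 : E d) * L (x : E d)
  have hp2 : p = (p.1, h' p.1) := by
    refine Prod.ext rfl ?_
    have := (L_pos p.1).ne'
    simp only [h']
    field_simp
    ring
  have h1 : Tendsto (fun n => cyl ((A n).1 • p.1, h' ((A n).1 • p.1))) atTop
      (𝓝 ((ξ : E d), boundaryMap τ ξ)) :=
    (tendsto_comap.comp hA).prodMk_nhds ((H'.extendsBy hΓ ξ).comp hA)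
  refine mem_closure_of_tendsto h1 (Eventually.of_forall fun n => ⟨_, ?_, rfl⟩)
  change proj τ _ ∈ C
  rw [← H'.coAct_eq, proj_smul, ← hp2]
  exact hp

theorem hullRegion_subset_preimage [NeZero d] (hΓ : IsCompactOrientedQuotient Γ) {τ : Z1 Γ}
    {C : Set (CoQuotient τ)} (hC : C ∈ convexSets τ) : hullRegion τ ⊆ proj τ ⁻¹' C := by
  obtain ⟨⟨q, hq⟩, hcl, hconv⟩ := hC
  obtain ⟨p, rfl⟩ : ∃ p, proj τ p = q := Quotient.exists_rep q
  have hb := continuous_boundaryMap hΓ τ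
  -- Geodesic convexity becomes ordinary convexity, because geodesics trace straight segments.
  have hS : Convex ℝ (cyl '' (proj τ ⁻¹' C)) := by
    rintro _ ⟨x, hx, rfl⟩ _ ⟨y, hy, rfl⟩ s t hs ht hst
    obtain ⟨γ, hγ, hγ0, hγ1, r, hr, e1, e2⟩ := exists_isGeodesic x y (s := t) ⟨ht, by linarith⟩
    refine ⟨γ r, hconv γ hγ (by rw [hγ0]; exact hx) (by rw [hγ1]; exact hy) r hr, ?_⟩
    have hs' : s = 1 - t := by linarith
    rw [hs']
    exact Prod.ext e1 e2
  rintro x ⟨hx1, hx2⟩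
  -- The closure in `ℝ^d × ℝ` adds nothing inside the open cylinder, so a missing point can be
  -- strictly separated from a closed convex set that also contains the graph of `b_τ`.
  have hclos : proj τ ⁻¹' C = cyl ⁻¹' closure (cyl '' (proj τ ⁻¹' C)) := by
    rw [← isInducing_cyl.closure_eq_preimage_closure_image,
      ((isClosed_iff_preimage_proj τ C).1 hcl).closure_eq]
  rw [hclos]
  by_contra hnot
  obtain ⟨f, u, hf1, hf2⟩ := geometric_hahn_banach_closed_point hS.closure isClosed_closure hnot
  set c := f (0, 1)
  set v : E d := (InnerProductSpace.toDual ℝ (E d)).symm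
    (f.comp (ContinuousLinearMap.inl ℝ (E d) ℝ))
  have hv : ∀ (y : E d) (s : ℝ), f (y, s) = inner ℝ y v + c * s := by
    intro y s
    rw [real_inner_comm, InnerProductSpace.toDual_symm_apply]
    have : ((y, s) : E d × ℝ) = (y, 0) + s • ((0 : E d), (1 : ℝ)) := by simp
    rw [this, map_add, map_smul, smul_eq_mul, mul_comm]
    rfl
  have hξ : ∀ ξ : Sphere d, inner ℝ (ξ : E d) v + c * boundaryMap τ ξ < u := fun ξ => by
    rw [← hv]; exact hf1 _ (boundary_mem_closure hΓ hq ξ)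
  have hxu : u < inner ℝ (x.1 : E d) v + c * x.2 := by rw [← hv]; exact hf2
  have hw : ∀ (y : E d), c ≠ 0 → lor (hom y) (-c⁻¹ • v, -(c⁻¹ * u)) = c⁻¹ * (u - inner ℝ y v) := by
    intro y _
    rw [lor_hom, real_inner_smul_right]; ring
  -- By the sign of the vertical coefficient: the separating hyperplane is the graph of an affine
  -- minorant of `b_τ` lying above the point, or is vertical and would separate a point of the ball
  -- from the sphere, or is the graph of a majorant lying below the point.
  rcases lt_trichotomy c 0 with hc | hc | hc
  · have h1 := lor_hom_le_lowerHull hb (w := (-c⁻¹ • v, -(c⁻¹ * u))) (fun ξ => by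
      rw [hw _ hc.ne, inv_mul_eq_div, div_le_iff_of_neg hc]; linarith [hξ ξ]) x.1
    rw [hw _ hc.ne] at h1
    have h2 : c⁻¹ * (u - inner ℝ (x.1 : E d) v) ≤ x.2 := h1.trans hx1
    rw [inv_mul_eq_div, div_le_iff_of_neg hc] at h2
    linarith
  · have h1 := lor_hom_le_of_sphere (d := d) (w := (v, 0)) (c := u) (fun ξ => by
      have := hξ ξ
      rw [hc] at this
      rw [lor_hom]
      simp only [sub_zero]
      linarith) x.1
    rw [lor_hom] at h1
    rw [hc] at hxu
    simp only [sub_zero] at h1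
    linarith
  · have h1 := upperHull_le_lor_hom hb (w := (-c⁻¹ • v, -(c⁻¹ * u))) (fun ξ => by
      rw [hw _ hc.ne', inv_mul_eq_div, le_div_iff₀ hc]; linarith [hξ ξ]) x.1
    rw [hw _ hc.ne'] at h1
    have h2 : x.2 ≤ c⁻¹ * (u - inner ℝ (x.1 : E d) v) := hx2.trans h1
    rw [inv_mul_eq_div, le_div_iff₀ hc] at h2
    linarith

theorem isLeast_image_hullRegion [NeZero d] (hΓ : IsCompactOrientedQuotient Γ) (τ : Z1 Γ) :
    IsLeast (convexSets τ) (proj τ '' hullRegion τ) :=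
  ⟨image_hullRegion_mem_convexSets hΓ τ, fun _ hC =>
    Set.image_subset_iff.2 (hullRegion_subset_preimage hΓ hC)⟩

theorem convexCore_eq [NeZero d] (hΓ : IsCompactOrientedQuotient Γ) (τ : Z1 Γ) :
    convexCore τ = proj τ '' hullRegion τ := by
  have h := isLeast_image_hullRegion hΓ τ
  exact (Set.sInter_subset_of_mem h.1).antisymm (Set.subset_sInter h.2)

theorem isLeast_convexCore [NeZero d] (hΓ : IsCompactOrientedQuotient Γ) (τ : Z1 Γ) :
    IsLeast (convexSets τ) (convexCore τ) := by
  rw [convexCore_eq hΓ]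
  exact isLeast_image_hullRegion hΓ τ

end Core

end CoMinkowski

namespace CoMinkowski

/-! ## The quotient measure and fundamental domains -/

section QuotientMeasure

variable {G X : Type} [Group G] [MulAction G X]

theorem mk_smul_eq (g : G) (x : X) :
    (Quotient.mk _ (g • x) : MulAction.orbitRel.Quotient G X) = Quotient.mk _ x :=
  Quotient.sound ⟨g, rfl⟩

variable [MeasurableSpace X]

theorem measurable_mk : Measurable fun x : X =>
    (Quotient.mk _ x : MulAction.orbitRel.Quotient G X) :=
  @measurable_quotient_mk'' _ _ _

/-- The quotient measure is the image of the restriction to a strict fundamental domain. -/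
theorem quotientMeasure_eq_map [Countable G] {μ : Measure X}
    (hμ : ∀ g : G, MeasurePreserving (fun x : X => g • x) μ μ)
    (hfree : ∀ (g : G) (x : X), g • x = x → g = 1) {F : Set X} (hF : MeasurableSet F)
    (hinj : Set.InjOn (fun x => (Quotient.mk _ x : MulAction.orbitRel.Quotient G X)) F)
    (hsurj : ∀ x : X, ∃ g : G, g • x ∈ F) :
    quotientMeasure G μ =
      (μ.restrict F).map fun x => (Quotient.mk _ x : MulAction.orbitRel.Quotient G X) := by
  refine le_antisymm (iSup₂_le ?_) (le_iSup₂ (f := fun (U : Set X) (_ : MeasurableSet U ∧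
    Set.InjOn (fun x => (Quotient.mk _ x : MulAction.orbitRel.Quotient G X)) U) =>
      (μ.restrict U).map fun x => (Quotient.mk _ x : MulAction.orbitRel.Quotient G X)) F ⟨hF, hinj⟩)
  rintro U ⟨hU, hUinj⟩
  refine Measure.le_iff.2 fun s hs => ?_
  rw [Measure.map_apply measurable_mk hs, Measure.map_apply measurable_mk hs]
  set T := (fun x => (Quotient.mk _ x : MulAction.orbitRel.Quotient G X)) ⁻¹' s with hT
  have hTm : MeasurableSet T := measurable_mk hs
  have hTinv : ∀ (g : G) (x : X), g • x ∈ T ↔ x ∈ T := fun g x => by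
    simp only [hT, Set.mem_preimage, mk_smul_eq]
  rw [Measure.restrict_apply hTm, Measure.restrict_apply hTm]
  -- The part of `g • (T ∩ U)` in `F`. These pieces are disjoint, by injectivity on `U` and
  -- freeness, and pulling them back by `g` covers `T ∩ U`.
  let V : G → Set X := fun g => (fun x => g⁻¹ • x) ⁻¹' (T ∩ U) ∩ F
  have hVm : ∀ g, MeasurableSet (V g) := fun g =>
    ((hμ g⁻¹).measurable (hTm.inter hU)).inter hF
  have hsub : T ∩ U ⊆ ⋃ g, (fun x => g • x) ⁻¹' V g := by
    intro x hx
    obtain ⟨g, hg⟩ := hsurj x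
    refine Set.mem_iUnion.2 ⟨g, ?_, hg⟩
    simpa using hx
  have hdisj : Pairwise (Function.onFun Disjoint V) := by
    intro g h hgh
    refine Set.disjoint_left.2 fun x hx hx' => hgh ?_
    have h1 : g⁻¹ • x = h⁻¹ • x := hUinj hx.1.2 hx'.1.2 (by simp only [mk_smul_eq])
    have h2 : (h * g⁻¹) • x = x := by rw [mul_smul, h1, smul_inv_smul]
    have := hfree _ _ h2
    rw [mul_inv_eq_one] at this
    exact this.symm
  calc μ (T ∩ U) ≤ μ (⋃ g, (fun x => g • x) ⁻¹' V g) := measure_mono hsub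
    _ ≤ ∑' g, μ ((fun x => g • x) ⁻¹' V g) := measure_iUnion_le _
    _ = ∑' g, μ (V g) := by
      congr 1; ext g; exact (hμ g).measure_preimage (hVm g).nullMeasurableSet
    _ = μ (⋃ g, V g) := (measure_iUnion hdisj hVm).symm
    _ ≤ μ (T ∩ F) := by
      refine measure_mono (Set.iUnion_subset fun g x hx => ⟨?_, hx.2⟩)
      exact (hTinv g⁻¹ x).1 hx.1.1

end QuotientMeasure

/-! ### Strict fundamental domains for the action on the ball -/

section FundamentalDomain

variable {d : ℕ} {Γ : Subgroup (OPlus d)}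

/-- Only finitely many elements move the origin into `{1 / (n + 1) ≤ L}`, and these sets exhaust the
ball. -/
theorem IsCompactOrientedQuotient.countable (hΓ : IsCompactOrientedQuotient Γ) : Countable Γ := by
  have := hΓ.properlyDiscontinuous
  let o : Ball d := ⟨0, by simp⟩
  have h : ∀ n : ℕ, {A : Γ | (1 : ℝ) / (n + 1) ≤ L ((A.1 • o : Ball d) : E d)}.Finite := by
    intro n
    refine (ProperlyDiscontinuousSMul.finite_disjoint_inter_image (Γ := Γ)
      (isCompact_singleton (x := o))
      (isCompact_superlevel_L (d := d) (l := 1 / ((n : ℝ) + 1)) (by positivity))).subset ?_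
    intro A hA
    exact ⟨A • o, ⟨o, rfl, rfl⟩, hA⟩
  have hu : (⋃ n : ℕ, {A : Γ | (1 : ℝ) / (n + 1) ≤ L ((A.1 • o : Ball d) : E d)}) = Set.univ := by
    refine Set.eq_univ_of_forall fun A => ?_
    obtain ⟨n, hn⟩ := exists_nat_one_div_lt (L_pos (A.1 • o))
    exact Set.mem_iUnion.2 ⟨n, hn.le⟩
  rw [← Set.countable_univ_iff, ← hu]
  exact Set.countable_iUnion fun n => (h n).countable

/-- Inside the compact set `{l ≤ L}` only finitely many group elements can identify points; freeness
and the Hausdorff property exclude each nontrivial one near `x`. -/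
theorem IsCompactOrientedQuotient.exists_injOn_nhds (hΓ : IsCompactOrientedQuotient Γ)
    (x : Ball d) {l : ℝ} (hl : 0 < l) (hx : l < L (x : E d)) :
    ∃ V : Set (Ball d), IsOpen V ∧ x ∈ V ∧ (∀ y ∈ V, l ≤ L (y : E d)) ∧
      Set.InjOn (fun y => (Quotient.mk _ y : HypQuotient Γ)) V := by
  have := hΓ.properlyDiscontinuous
  have hfin := ProperlyDiscontinuousSMul.finite_disjoint_inter_image (Γ := Γ)
    (isCompact_superlevel_L (d := d) hl) (isCompact_superlevel_L (d := d) hl)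
  set S := {A : Γ | ((A • ·) '' {y : Ball d | l ≤ L (y : E d)} ∩
    {y : Ball d | l ≤ L (y : E d)}).Nonempty} with hS
  have hsep : ∀ A : Γ, A ≠ 1 → ∃ W : Set (Ball d), IsOpen W ∧ x ∈ W ∧ ∀ y ∈ W, A • y ∉ W := by
    intro A hA
    have hne : A • x ≠ x := fun h => hA (Subtype.ext (hΓ.free A.1 A.2 x h))
    obtain ⟨U₁, U₂, h1, h2, hx1, hx2, hd⟩ := t2_separation hne
    refine ⟨U₂ ∩ (A • ·) ⁻¹' U₁, h2.inter (h1.preimage (continuous_const_smul A)), ⟨hx2, hx1⟩, ?_⟩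
    rintro y ⟨-, hy⟩ ⟨hy', -⟩
    exact Set.disjoint_left.1 hd hy hy'
  choose! W hWo hxW hW using hsep
  refine ⟨{y : Ball d | l < L (y : E d)} ∩ ⋂ A ∈ S \ {1}, W A, ?_, ?_, ?_, ?_⟩
  · refine (isOpen_lt continuous_const (continuous_L.comp continuous_subtype_val)).inter ?_
    exact (hfin.subset Set.sdiff_subset).isOpen_biInter fun A hA => hWo A hA.2
  · exact ⟨hx, Set.mem_iInter₂.2 fun A hA => hxW A hA.2⟩
  · exact fun y hy => le_of_lt hy.1
  · intro y hy z hz hyz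
    obtain ⟨A, hA⟩ := Quotient.exact hyz
    have hA' : A • z = y := hA
    by_cases hA1 : A = 1
    · rw [← hA', hA1, one_smul]
    · exfalso
      have hAS : A ∈ S \ {1} :=
        ⟨⟨y, ⟨z, (show l < L (z : E d) from hz.1).le, hA'⟩,
          (show l < L (y : E d) from hy.1).le⟩, hA1⟩
      refine hW A hA1 z (Set.mem_iInter₂.1 hz.2 A hAS) ?_
      rw [hA']
      exact Set.mem_iInter₂.1 hy.2 A hAS

/-- A measurable strict fundamental domain for `Γ`, contained in a compact set. -/
structure IsFundDomain (Γ : Subgroup (OPlus d)) (F : Set (Ball d)) : Prop where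
  measurableSet : MeasurableSet F
  injOn : Set.InjOn (fun x => (Quotient.mk _ x : HypQuotient Γ)) F
  exists_smul_mem : ∀ x : Ball d, ∃ A : Γ, A • x ∈ F
  exists_le_L : ∃ l : ℝ, 0 < l ∧ ∀ x ∈ F, l ≤ L (x : E d)

theorem IsCompactOrientedQuotient.exists_isFundDomain (hΓ : IsCompactOrientedQuotient Γ) :
    ∃ F, IsFundDomain Γ F := by
  obtain ⟨l, hl, hA⟩ := hΓ.exists_le_L
  have hV : ∀ x : Ball d, l ≤ L (x : E d) → ∃ V : Set (Ball d), IsOpen V ∧ x ∈ V ∧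
      (∀ y ∈ V, l / 2 ≤ L (y : E d)) ∧
      Set.InjOn (fun y => (Quotient.mk _ y : HypQuotient Γ)) V := fun x hx =>
    hΓ.exists_injOn_nhds x (half_pos hl) (by linarith)
  choose! V hVo hxV hVl hVinj using hV
  obtain ⟨t, ht, hcov⟩ := (isCompact_superlevel_L (d := d) hl).elim_nhds_subcover V
    (fun x hx => (hVo x hx).mem_nhds (hxV x hx))
  have hπ : IsOpenMap fun x : Ball d => (Quotient.mk _ x : HypQuotient Γ) :=
    isOpenMap_quotient_mk'_mul
  -- Built from a finite cover by injective pieces: to each stage add the part of the new piece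
  -- whose orbits were not yet met. The saturation `Z` to be removed is open, hence measurable.
  have key : ∀ t : Finset (Ball d), (∀ x ∈ t, l ≤ L (x : E d)) → ∃ F : Set (Ball d),
      MeasurableSet F ∧ Set.InjOn (fun x => (Quotient.mk _ x : HypQuotient Γ)) F ∧
      (∀ x ∈ ⋃ y ∈ t, V y, ∃ A : Γ, A • x ∈ F) ∧ F ⊆ ⋃ y ∈ t, V y := by
    classical
    intro t
    induction t using Finset.induction_on with
    | empty => exact fun _ => ⟨∅, MeasurableSet.empty, by simp, by simp, by simp⟩
    | insert a t ha ih =>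
      intro ht
      obtain ⟨F, hFm, hFi, hFs, hFV⟩ := ih fun x hx => ht x (Finset.mem_insert_of_mem hx)
      have ha' := ht a (Finset.mem_insert_self _ _)
      set Z : Set (Ball d) := (fun x => (Quotient.mk _ x : HypQuotient Γ)) ⁻¹'
        ((fun x => (Quotient.mk _ x : HypQuotient Γ)) '' ⋃ y ∈ t, V y)
      have hZo : IsOpen Z := (hπ _ (isOpen_biUnion fun y hy =>
        hVo y (ht y (Finset.mem_insert_of_mem hy)))).preimage continuous_quotient_mk'
      have hZ : ∀ (x y : Ball d), (Quotient.mk _ x : HypQuotient Γ) = Quotient.mk _ y →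
          y ∈ ⋃ y ∈ t, V y → x ∈ Z := fun x y hxy hy => ⟨y, hy, hxy.symm⟩
      refine ⟨F ∪ (V a \ Z),
        hFm.union (MeasurableSet.diff (hVo a ha').measurableSet hZo.measurableSet), ?_, ?_, ?_⟩
      · rintro x (hx | hx) y (hy | hy) hxy
        · exact hFi hx hy hxy
        · exact absurd (hZ y x hxy.symm (hFV hx)) hy.2
        · exact absurd (hZ x y hxy (hFV hy)) hx.2
        · exact hVinj a ha' hx.1 hy.1 hxy
      · intro x hx
        by_cases hxZ : x ∈ Z
        · obtain ⟨y, hy, hyx⟩ := hxZ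
          obtain ⟨B, hB⟩ := Quotient.exact hyx
          obtain ⟨A, hA⟩ := hFs y hy
          refine ⟨A * B, Or.inl ?_⟩
          rw [mul_smul, show B • x = y from hB]
          exact hA
        · refine ⟨1, Or.inr ⟨?_, by rwa [one_smul]⟩⟩
          rw [one_smul]
          obtain ⟨y, hy, hxy⟩ := Set.mem_iUnion₂.1 hx
          rcases Finset.mem_insert.1 hy with rfl | hy
          · exact hxy
          · exact absurd (hZ x x rfl (Set.mem_iUnion₂.2 ⟨y, hy, hxy⟩)) hxZ
      · refine Set.union_subset (hFV.trans ?_) fun x hx => ?_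
        · exact Set.biUnion_subset_biUnion_left fun y hy => Finset.mem_insert_of_mem hy
        · exact Set.mem_iUnion₂.2 ⟨a, Finset.mem_insert_self _ _, hx.1⟩
  obtain ⟨F, hFm, hFi, hFs, hFV⟩ := key t ht
  refine ⟨F, hFm, hFi, fun x => ?_, l / 2, half_pos hl, fun x hx => ?_⟩
  · obtain ⟨A, hAx⟩ := hA x
    obtain ⟨B, hB⟩ := hFs (A • x) (hcov hAx.le)
    exact ⟨B * A, by rwa [mul_smul]⟩
  · obtain ⟨y, hy, hxy⟩ := Set.mem_iUnion₂.1 (hFV hx)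
    exact hVl y (ht y hy) x hxy

end FundamentalDomain

/-! ## Invariance of the volumes -/

section Volume

variable {d : ℕ} {Γ : Subgroup (OPlus d)}

/-- The part of the cone over a subset of the ball that lies below the hyperboloid. -/
def coneBelow (S : Set (Ball d)) : Set (Mink d) :=
  {m | ∃ x ∈ S, ∃ s : ℝ, 0 < s ∧ s * L (x : E d) < 1 ∧ m = s • hom (x : E d)}

/-- For `m = s • (x, 1)` the number `s * L x` is the Lorentzian length of `m`, so isometries
preserve the condition of lying below the hyperboloid. -/
theorem preimage_coneBelow (A : OPlus d) (S : Set (Ball d)) :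
    (A.1 : Mink d → Mink d) ⁻¹' coneBelow S = coneBelow ((fun x : Ball d => A • x) ⁻¹' S) := by
  ext m
  constructor
  · rintro ⟨x, hx, s, hs, hsx, hm⟩
    have hm' : m = s • (A⁻¹).1 (hom (x : E d)) := by
      rw [← map_smul, ← hm]; exact (A.1.symm_apply_apply m).symm
    have hy := L_pos (A⁻¹ • x)
    have hx0 := L_pos x
    refine ⟨A⁻¹ • x, by simpa using hx, s * (L (x : E d) / L ((A⁻¹ • x : Ball d) : E d)),
      by positivity, ?_, ?_⟩
    · rw [mul_assoc, div_mul_cancel₀ _ hy.ne']; exact hsx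
    · rw [hm', apply_hom_eq, smul_smul]
  · rintro ⟨x, hx, s, hs, hsx, rfl⟩
    have hy := L_pos (A • x)
    have hx0 := L_pos x
    refine ⟨A • x, hx, s * (L (x : E d) / L ((A • x : Ball d) : E d)), by positivity, ?_, ?_⟩
    · rw [mul_assoc, div_mul_cancel₀ _ hy.ne']; exact hsx
    · rw [map_smul, apply_hom_eq, smul_smul]

theorem coneBelow_eq (S : Set (Ball d)) : coneBelow S =
    {m | 0 < m.2 ∧ m.2⁻¹ • m.1 ∈ Subtype.val '' S ∧ m.2 * L (m.2⁻¹ • m.1) < 1} := by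
  ext m
  constructor
  · rintro ⟨x, hx, s, hs, hsx, rfl⟩
    have e : (s • hom (x : E d)).2⁻¹ • (s • hom (x : E d)).1 = x := by
      simp [hom, smul_smul, hs.ne']
    refine ⟨by simpa [hom] using hs, ⟨x, hx, e.symm⟩, ?_⟩
    rw [e]
    simpa [hom] using hsx
  · rintro ⟨hs, ⟨x, hx, e⟩, h⟩
    refine ⟨x, hx, m.2, hs, by rwa [e], Prod.ext ?_ ?_⟩
    · simp [hom, e, smul_smul, hs.ne']
    · simp [hom]

theorem measurable_L : Measurable (L : E d → ℝ) := continuous_L.measurable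

theorem lintegral_pow_Ioo (n : ℕ) {a : ℝ} (ha : 0 ≤ a) :
    ∫⁻ s in Set.Ioo 0 a, ENNReal.ofReal (s ^ n) = ENNReal.ofReal (a ^ (n + 1) / (n + 1)) := by
  rw [← ofReal_integral_eq_lintegral_ofReal]
  · rw [← integral_Ioc_eq_integral_Ioo, ← intervalIntegral.integral_of_le ha, integral_pow]
    simp
  · exact ((continuous_pow n).integrableOn_Icc).mono_set Set.Ioo_subset_Icc_self
  · exact (ae_restrict_mem measurableSet_Ioo).mono fun s hs => pow_nonneg hs.1.le n

/-- In coordinates `(s x, s)` Lebesgue measure is `s ^ d dx ds`, and integrating over `0 < s < 1 / L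
x` gives `L ^ (-(d + 1)) / (d + 1)`. Hyperbolic volume is thus a Lebesgue volume in Minkowski space,
where invariance under linear maps of determinant one is immediate. -/
theorem volume_coneBelow {S : Set (Ball d)} (hS : MeasurableSet S) :
    volume (coneBelow S) = ENNReal.ofReal (1 / ((d : ℝ) + 1)) * hypVolume d S := by
  have hS' : MeasurableSet (Subtype.val '' S : Set (E d)) :=
    MeasurableSet.subtype_image Metric.isOpen_ball.measurableSet hS
  set S' : Set (E d) := Subtype.val '' S
  have hmeas : MeasurableSet (coneBelow S) := by
    rw [coneBelow_eq]
    have h1 : Measurable fun m : Mink d => m.2⁻¹ • m.1 := by fun_prop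
    exact (measurableSet_lt measurable_const measurable_snd).inter
      ((h1 hS').inter (measurableSet_lt (measurable_snd.mul (measurable_L.comp h1))
        measurable_const))
  set R : Set (E d × ℝ) := {p | 0 < p.2 ∧ p.2 * L p.1 < 1}
  have hR : MeasurableSet R := (measurableSet_lt measurable_const measurable_snd).inter
    (measurableSet_lt (measurable_snd.mul (measurable_L.comp measurable_fst)) measurable_const)
  set K : E d × ℝ → ENNReal := R.indicator fun p => ENNReal.ofReal (p.2 ^ d)
  have hK : Measurable K := Measurable.indicator (by fun_prop) hR
  have hslice : ∀ s : ℝ, volume ((fun y : E d => (y, s)) ⁻¹' coneBelow S) =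
      ∫⁻ x in S', K (x, s) := by
    intro s
    rw [coneBelow_eq]
    rcases le_or_gt s 0 with hs | hs
    · have e1 : (fun y : E d => (y, s)) ⁻¹' {m : Mink d | 0 < m.2 ∧ m.2⁻¹ • m.1 ∈ S' ∧
          m.2 * L (m.2⁻¹ • m.1) < 1} = ∅ := by
        ext y; simp [not_lt.2 hs]
      have e2 : ∀ x, K (x, s) = 0 := fun x =>
        Set.indicator_of_notMem (fun h => absurd h.1 (not_lt.2 hs)) _
      rw [e1]
      simp [e2]
    · have e1 : (fun y : E d => (y, s)) ⁻¹' {m : Mink d | 0 < m.2 ∧ m.2⁻¹ • m.1 ∈ S' ∧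
          m.2 * L (m.2⁻¹ • m.1) < 1} = (s⁻¹ • ·) ⁻¹' ({x | s * L x < 1} ∩ S') := by
        ext y; simp [hs, and_comm]
      have e2 : ∀ x, K (x, s) = {x : E d | s * L x < 1}.indicator
          (fun _ => ENNReal.ofReal (s ^ d)) x := by
        intro x
        simp [K, R, Set.indicator_apply, hs]
      have hm : MeasurableSet {x : E d | s * L x < 1} :=
        measurableSet_lt (measurable_const.mul measurable_L) measurable_const
      rw [e1, Measure.addHaar_preimage_smul _ (inv_ne_zero hs.ne')]
      simp only [e2]
      rw [lintegral_indicator_const hm, Measure.restrict_apply hm]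
      congr 2
      simp [abs_of_pos hs]
  have hinner : ∀ x ∈ S', ∫⁻ s, K (x, s) =
      ENNReal.ofReal (1 / ((d : ℝ) + 1)) * ENNReal.ofReal (L x ^ (d + 1))⁻¹ := by
    rintro _ ⟨x, -, rfl⟩
    have hx := L_pos x
    have e : ∀ s, K ((x : E d), s) = (Set.Ioo 0 (L (x : E d))⁻¹).indicator
        (fun s => ENNReal.ofReal (s ^ d)) s := by
      intro s
      simp only [K, R, Set.indicator_apply, Set.mem_ofPred_eq, Set.mem_Ioo]
      have e' : s * L (x : E d) < 1 ↔ s < (L (x : E d))⁻¹ := by rw [← lt_div_iff₀ hx, one_div]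
      simp only [e']
    simp only [e]
    rw [lintegral_indicator measurableSet_Ioo, lintegral_pow_Ioo _ (inv_pos.2 hx).le,
      ← ENNReal.ofReal_mul (by positivity)]
    congr 1
    rw [inv_pow]
    ring
  have hhyp : hypVolume d S = ∫⁻ x in S', ENNReal.ofReal (L x ^ (d + 1))⁻¹ := by
    rw [hypVolume, withDensity_apply _ hS]
    exact setLIntegral_subtype Metric.isOpen_ball.measurableSet S fun x =>
      ENNReal.ofReal (L x ^ (d + 1))⁻¹
  rw [hhyp, ← lintegral_const_mul _ (by have := measurable_L (d := d); fun_prop)]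
  change (volume.prod volume) (coneBelow S) = _
  rw [Measure.prod_apply_symm hmeas]
  simp only [hslice]
  rw [lintegral_lintegral_swap (f := fun s x => K (x, s)) (hK.comp measurable_swap).aemeasurable]
  exact setLIntegral_congr_fun hS' hinner

theorem measurePreserving_smul_hypVolume {A : OPlus d}
    (hA : LinearMap.det (A.1 : Mink d →ₗ[ℝ] Mink d) = 1) :
    MeasurePreserving (fun x : Ball d => A • x) (hypVolume d) (hypVolume d) := by
  have hm : Measurable fun x : Ball d => A • x := (continuous_const_smul A).measurable
  refine ⟨hm, Measure.ext fun S hS => ?_⟩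
  rw [Measure.map_apply hm hS]
  have h1 := volume_coneBelow hS
  have h2 := volume_coneBelow (hm hS)
  rw [← preimage_coneBelow] at h2
  have : (volume : Measure (Mink d)).IsAddHaarMeasure :=
    inferInstanceAs ((volume : Measure (E d)).prod (volume : Measure ℝ)).IsAddHaarMeasure
  have h3 := Measure.addHaar_preimage_linearMap (volume : Measure (Mink d))
    (f := (A.1 : Mink d →ₗ[ℝ] Mink d)) (by rw [hA]; exact one_ne_zero) (coneBelow S)
  rw [hA] at h3
  simp only [inv_one, abs_one, ENNReal.ofReal_one, one_mul] at h3
  have h4 := h2.symm.trans (h3.trans h1)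
  have hc : ENNReal.ofReal (1 / ((d : ℝ) + 1)) ≠ 0 := by
    rw [Ne, ENNReal.ofReal_eq_zero, not_le]; positivity
  exact (ENNReal.mul_right_inj hc ENNReal.ofReal_ne_top).1 h4

instance : IsFiniteMeasure (Measure.comap Subtype.val (volume : Measure (E d)) :
    Measure (Ball d)) :=
  ⟨by
    have h := comap_subtype_coe_apply (Metric.isOpen_ball (x := (0 : E d)) (ε := 1)).measurableSet
      volume Set.univ
    rw [h, Set.image_univ, Subtype.range_coe]
    exact measure_ball_lt_top⟩

theorem hypVolume_lt_top {F : Set (Ball d)} {l : ℝ} (hl : 0 < l)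
    (hF : ∀ x ∈ F, l ≤ L (x : E d)) : hypVolume d F < ⊤ := by
  have hm : MeasurableSet {x : Ball d | l ≤ L (x : E d)} :=
    (isCompact_superlevel_L hl).isClosed.measurableSet
  refine (measure_mono (show F ⊆ {x : Ball d | l ≤ L (x : E d)} from hF)).trans_lt ?_
  rw [hypVolume, withDensity_apply _ hm]
  have hle : ∀ x ∈ {x : Ball d | l ≤ L (x : E d)}, ENNReal.ofReal (L (x : E d) ^ (d + 1))⁻¹ ≤
      ENNReal.ofReal (l ^ (d + 1))⁻¹ := fun x hx =>
    ENNReal.ofReal_le_ofReal (inv_anti₀ (pow_pos hl (d + 1))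
      (pow_le_pow_left₀ hl.le (show l ≤ L (x : E d) from hx) _))
  refine (setLIntegral_mono measurable_const hle).trans_lt ?_
  rw [setLIntegral_const]
  exact ENNReal.mul_lt_top ENNReal.ofReal_lt_top (measure_lt_top _ _)

theorem isOpen_eq_empty_of_hypVolume_eq_zero {U : Set (Ball d)} (hU : IsOpen U)
    (h : hypVolume d U = 0) : U = ∅ := by
  rw [hypVolume, withDensity_apply _ hU.measurableSet, setLIntegral_subtype
    Metric.isOpen_ball.measurableSet U fun x : E d => ENNReal.ofReal (L x ^ (d + 1))⁻¹] at h
  have hU' : IsOpen (Subtype.val '' U : Set (E d)) := Metric.isOpen_ball.isOpenMap_subtype_val U hU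
  have h0 : volume (Subtype.val '' U : Set (E d)) = 0 := by
    by_contra hne
    refine (setLIntegral_pos_iff (by have := measurable_L (d := d); fun_prop)).2 ?_ |>.ne' h
    refine lt_of_lt_of_le (pos_iff_ne_zero.2 hne) (measure_mono ?_)
    rintro _ ⟨x, hx, rfl⟩
    refine ⟨?_, x, hx, rfl⟩
    have := L_pos x
    simp only [Function.mem_support, ne_eq, ENNReal.ofReal_eq_zero, not_le]
    positivity
  have := hU'.eq_empty_of_measure_zero h0
  simpa using this

theorem coVolume_apply {S : Set (CoMink d)} (hS : MeasurableSet S) :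
    coVolume d S = ∫⁻ x, ENNReal.ofReal (L (x : E d))⁻¹ * volume (Prod.mk x ⁻¹' S)
      ∂hypVolume d := by
  have hL : Measurable fun p : CoMink d => ENNReal.ofReal (L (p.1 : E d))⁻¹ := by
    have := measurable_L (d := d); fun_prop
  rw [coVolume, withDensity_apply _ hS, ← lintegral_indicator hS,
    lintegral_prod _ (hL.indicator hS).aemeasurable]
  refine lintegral_congr fun x => ?_
  have e : ∀ t : ℝ, S.indicator (fun p : CoMink d => ENNReal.ofReal (L (p.1 : E d))⁻¹) (x, t) =
      (Prod.mk x ⁻¹' S).indicator (fun _ => ENNReal.ofReal (L (x : E d))⁻¹) t := fun t => rfl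
  simp only [e]
  exact lintegral_indicator_const (measurable_prodMk_left hS) _

theorem measurable_coAct (g : CoIsom d) : Measurable (coAct g) := by
  have h1 : Continuous fun x : Ball d => g.lin • x := continuous_const_smul g.lin
  have hL : Continuous fun x : Ball d => L (x : E d) := continuous_L.comp continuous_subtype_val
  have h2 := (continuous_lor_hom g.trans).comp
    (continuous_subtype_val.comp (h1.comp (continuous_fst (Y := ℝ))))
  refine Continuous.measurable (Continuous.prodMk (h1.comp continuous_fst) (Continuous.add
    (Continuous.mul (Continuous.div (hL.comp (h1.comp continuous_fst)) (hL.comp continuous_fst)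
      fun p => (L_pos p.1).ne') continuous_snd) h2))

/-- On fibres the action is affine with slope `L (A • x) / L x`, which the density `L⁻¹`
compensates; on the base it preserves hyperbolic volume. -/
theorem measurePreserving_coAct {g : CoIsom d}
    (hA : LinearMap.det (g.lin.1 : Mink d →ₗ[ℝ] Mink d) = 1) :
    MeasurePreserving (coAct g) (coVolume d) (coVolume d) := by
  have hm := measurable_coAct g
  refine ⟨hm, Measure.ext fun S hS => ?_⟩
  have hL : Measurable fun x : Ball d => ENNReal.ofReal (L (x : E d))⁻¹ := by
    have := measurable_L (d := d); fun_prop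
  rw [Measure.map_apply hm hS, coVolume_apply hS, coVolume_apply (hm hS),
    ← (measurePreserving_smul_hypVolume hA).lintegral_comp
      (f := fun x => ENNReal.ofReal (L (x : E d))⁻¹ * volume (Prod.mk x ⁻¹' S))
      (hL.mul (measurable_measure_prodMk_left hS))]
  refine lintegral_congr fun x => ?_
  set a := L ((g.lin • x : Ball d) : E d) / L (x : E d) with ha
  have hx := L_pos x
  have hy := L_pos (g.lin • x)
  have ha0 : 0 < a := div_pos hy hx
  have e : Prod.mk x ⁻¹' (coAct g ⁻¹' S) = (a * ·) ⁻¹'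
      ((· + lor (hom ((g.lin • x : Ball d) : E d)) g.trans) ⁻¹'
      (Prod.mk (g.lin • x) ⁻¹' S)) := rfl
  rw [e, Real.volume_preimage_mul_left ha0.ne', measure_preimage_add_right, ← mul_assoc,
    ← ENNReal.ofReal_mul (inv_pos.2 hx).le, abs_of_pos (inv_pos.2 ha0)]
  congr 2
  rw [ha]
  field_simp

end Volume

end CoMinkowski

namespace CoMinkowski

/-! ## Integration over the quotient and the volume of the convex core -/

section Integration

variable {d : ℕ} {Γ : Subgroup (OPlus d)}

theorem quotientMeasure_hypVolume (hΓ : IsCompactOrientedQuotient Γ) {F : Set (Ball d)}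
    (hF : IsFundDomain Γ F) : quotientMeasure Γ (hypVolume d) =
      ((hypVolume d).restrict F).map fun x => (Quotient.mk _ x : HypQuotient Γ) := by
  have := hΓ.countable
  exact quotientMeasure_eq_map (G := Γ)
    (fun A => measurePreserving_smul_hypVolume (hΓ.orientation A.1 A.2))
    (fun A x h => Subtype.ext (hΓ.free A.1 A.2 x h)) hF.measurableSet hF.injOn hF.exists_smul_mem

theorem countable_deformed (hΓ : IsCompactOrientedQuotient Γ) (τ : Z1 Γ) :
    Countable (deformed τ) := by
  have := hΓ.countable
  have hs : Function.Surjective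
      fun A : Γ => (⟨⟨A.1, Z1.val τ A⟩, A, rfl⟩ : deformed τ) := by
    rintro ⟨_, A, rfl⟩
    exact ⟨A, rfl⟩
  exact hs.countable

/-- The action covers the free action on the ball, so the cylinder over a fundamental domain is a
fundamental domain. -/
theorem quotientMeasure_coVolume (hΓ : IsCompactOrientedQuotient Γ) (τ : Z1 Γ) {F : Set (Ball d)}
    (hF : IsFundDomain Γ F) : quotientMeasure (deformed τ) (coVolume d) =
      ((coVolume d).restrict (Prod.fst ⁻¹' F)).map (proj τ) := by
  have := countable_deformed hΓ τ
  refine quotientMeasure_eq_map (G := deformed τ) ?_ ?_ (measurable_fst hF.measurableSet) ?_ ?_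
  · rintro ⟨_, A, rfl⟩
    exact measurePreserving_coAct (g := ⟨A.1, Z1.val τ A⟩) (hΓ.orientation A.1 A.2)
  · rintro ⟨_, A, rfl⟩ p hp
    have h1 : A.1 • p.1 = p.1 := congrArg Prod.fst hp
    have h2 : A = 1 := Subtype.ext (hΓ.free A.1 A.2 _ h1)
    subst h2
    exact Subtype.ext (CoIsom.ext rfl (Z1.val_one τ))
  · intro p hp q hq hpq
    obtain ⟨A, hA⟩ := exists_coAct_eq_of_proj_eq (τ := τ) hpq
    have h1 : A.1 • q.1 = p.1 := congrArg Prod.fst hA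
    have h2 : p.1 = q.1 := hF.injOn hp hq (Quotient.sound ⟨A, h1⟩)
    have h3 : A = 1 := Subtype.ext (hΓ.free A.1 A.2 q.1 (h1.trans h2))
    subst h3
    rw [← hA]
    have h4 : (⟨(1 : Γ).1, Z1.val τ 1⟩ : CoIsom d) = 1 := CoIsom.ext rfl (Z1.val_one τ)
    rw [h4]
    exact one_smul (CoIsom d) q
  · intro p
    obtain ⟨A, hA⟩ := hF.exists_smul_mem p.1
    exact ⟨⟨⟨A.1, Z1.val τ A⟩, A, rfl⟩, hA⟩

theorem descend_mk {f : Ball d → ℝ} (hf : IsGammaInvariant Γ f) (x : Ball d) :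
    descend Γ f (Quotient.mk _ x) = (L (x : E d))⁻¹ * f x := by
  obtain ⟨A, hA⟩ := Quotient.exact (Quotient.out_eq (Quotient.mk _ x : HypQuotient Γ))
  have := hf A.1 A.2 x
  rw [show A.1 • x = (Quotient.mk _ x : HypQuotient Γ).out from hA] at this
  exact this

theorem measurable_descend {f : Ball d → ℝ} (hc : Continuous f) (hf : IsGammaInvariant Γ f) :
    Measurable (descend Γ f) := by
  refine measurable_from_quotient.2 ?_
  convert (continuous_inv_L_mul hc).measurable using 1
  ext x
  exact descend_mk hf x

theorem integrableOn_inv_L_mul (hΓ : IsCompactOrientedQuotient Γ) {F : Set (Ball d)}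
    (hF : IsFundDomain Γ F) {f : Ball d → ℝ} (hc : Continuous f) (hf : IsGammaInvariant Γ f) :
    IntegrableOn (fun x : Ball d => (L (x : E d))⁻¹ * f x) F (hypVolume d) := by
  obtain ⟨C, hC0, hC⟩ := hf.exists_abs_le hΓ hc
  obtain ⟨l, hl, hlF⟩ := hF.exists_le_L
  refine Measure.integrableOn_of_bounded (M := C) (hypVolume_lt_top hl hlF).ne
    (continuous_inv_L_mul hc).aestronglyMeasurable (Eventually.of_forall fun x => ?_)
  rw [norm_mul, norm_inv, Real.norm_eq_abs, Real.norm_eq_abs, abs_of_pos (L_pos x),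
    inv_mul_le_iff₀ (L_pos x), mul_comm]
  exact hC x

theorem integrable_descend (hΓ : IsCompactOrientedQuotient Γ) {f : Ball d → ℝ}
    (hc : Continuous f) (hf : IsGammaInvariant Γ f) :
    Integrable (descend Γ f) (quotientMeasure Γ (hypVolume d)) := by
  obtain ⟨F, hF⟩ := hΓ.exists_isFundDomain
  rw [quotientMeasure_hypVolume hΓ hF,
    integrable_map_measure (measurable_descend hc hf).aestronglyMeasurable
      measurable_mk.aemeasurable]
  refine (integrableOn_inv_L_mul hΓ hF hc hf).congr (Eventually.of_forall fun x => ?_)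
  exact (descend_mk hf x).symm

theorem integral_descend (hΓ : IsCompactOrientedQuotient Γ) {F : Set (Ball d)}
    (hF : IsFundDomain Γ F) {f : Ball d → ℝ} (hc : Continuous f) (hf : IsGammaInvariant Γ f) :
    ∫ q, descend Γ f q ∂(quotientMeasure Γ (hypVolume d)) =
      ∫ x in F, (L (x : E d))⁻¹ * f x ∂hypVolume d := by
  rw [quotientMeasure_hypVolume hΓ hF,
    integral_map measurable_mk.aemeasurable (measurable_descend hc hf).aestronglyMeasurable]
  exact integral_congr_ae (Eventually.of_forall fun x => descend_mk hf x)

/-- The open set `{f ≠ 0}` is null in the fundamental domain, hence null after countably many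
translations, and a null open set is empty because the volume density is positive. -/
theorem eq_zero_of_integral_descend_eq_zero (hΓ : IsCompactOrientedQuotient Γ) {f : Ball d → ℝ}
    (hc : Continuous f) (hf : IsGammaInvariant Γ f) (hnn : ∀ x, 0 ≤ f x)
    (h : ∫ q, descend Γ f q ∂(quotientMeasure Γ (hypVolume d)) = 0) (x : Ball d) : f x = 0 := by
  have := hΓ.countable
  obtain ⟨F, hF⟩ := hΓ.exists_isFundDomain
  rw [integral_descend hΓ hF hc hf] at h
  have hnn' : ∀ x : Ball d, 0 ≤ (L (x : E d))⁻¹ * f x := fun x =>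
    mul_nonneg (inv_pos.2 (L_pos x)).le (hnn x)
  rw [setIntegral_eq_zero_iff_of_nonneg_ae (Eventually.of_forall hnn')
    (integrableOn_inv_L_mul hΓ hF hc hf)] at h
  set U : Set (Ball d) := {x | f x ≠ 0}
  have hU : IsOpen U := isOpen_ne.preimage hc
  have hUF : hypVolume d (U ∩ F) = 0 := by
    have h1 := ae_iff.1 ((ae_restrict_iff' hF.measurableSet).1 h)
    refine measure_mono_null (fun y hy => ?_) h1
    simp only [Set.mem_ofPred_eq, Classical.not_imp]
    exact ⟨hy.2, mul_ne_zero (inv_pos.2 (L_pos y)).ne' hy.1⟩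
  have hsub : U ⊆ ⋃ A : Γ, (fun x : Ball d => A.1 • x) ⁻¹' (U ∩ F) := by
    intro y hy
    obtain ⟨A, hA⟩ := hF.exists_smul_mem y
    refine Set.mem_iUnion.2 ⟨A, fun h0 => hy ?_, hA⟩
    have := hf A.1 A.2 y
    rw [h0, mul_zero] at this
    exact (mul_eq_zero.1 this.symm).resolve_left (inv_pos.2 (L_pos y)).ne'
  have hU0 : hypVolume d U = 0 := by
    refine measure_mono_null hsub (measure_iUnion_null fun A => ?_)
    rw [(measurePreserving_smul_hypVolume (hΓ.orientation A.1 A.2)).measure_preimage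
      (hU.measurableSet.inter hF.measurableSet).nullMeasurableSet]
    exact hUF
  have hempty := isOpen_eq_empty_of_hypVolume_eq_zero hU hU0
  by_contra hx
  exact (hempty ▸ (show x ∈ U from hx) : x ∈ (∅ : Set (Ball d)))

/-- The volume of the convex core is the integral of the difference of the hulls. -/
theorem coreVolume_eq [NeZero d] (hΓ : IsCompactOrientedQuotient Γ) (τ : Z1 Γ) :
    coreVolume τ = ENNReal.ofReal
      (∫ q, descend Γ (fun x => hPlus τ x - hMinus τ x) q ∂(quotientMeasure Γ (hypVolume d))) := by
  obtain ⟨F, hF⟩ := hΓ.exists_isFundDomain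
  have hP := isEquivariant_hPlus hΓ τ
  have hM := isEquivariant_hMinus hΓ τ
  have hinv := hP.sub_isGammaInvariant hM
  have hc : Continuous fun x => hPlus τ x - hMinus τ x := hP.1.sub hM.1
  have hcore : proj τ ⁻¹' convexCore τ = hullRegion τ := by
    ext p
    rw [convexCore_eq hΓ]
    exact proj_mem_image_hullRegion_iff hΓ τ p
  have hmc : MeasurableSet (convexCore τ) := by
    change MeasurableSet (proj τ ⁻¹' convexCore τ)
    rw [hcore]
    exact (isClosed_hullRegion hΓ τ).measurableSet
  have hmh : MeasurableSet (hullRegion τ) := (isClosed_hullRegion hΓ τ).measurableSet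
  have hproj : Measurable (proj τ) := measurable_mk
  rw [coreVolume, quotientMeasure_coVolume hΓ τ hF, Measure.map_apply hproj hmc, hcore,
    Measure.restrict_apply hmh, coVolume_apply (hmh.inter (measurable_fst hF.measurableSet)),
    integral_descend hΓ hF hc hinv, ofReal_integral_eq_lintegral_ofReal
      (integrableOn_inv_L_mul hΓ hF hc hinv) (Eventually.of_forall fun x =>
        mul_nonneg (inv_pos.2 (L_pos x)).le (sub_nonneg.2 (hMinus_le_hPlus hΓ τ x))),
    ← lintegral_indicator hF.measurableSet]
  refine lintegral_congr fun x => ?_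
  by_cases hx : x ∈ F
  · rw [Set.indicator_of_mem hx]
    -- By Fubini, the fibre over `x` contributes the length of this interval times `L⁻¹`, which is
    -- the integrand on the quotient.
    have e : Prod.mk x ⁻¹' (hullRegion τ ∩ Prod.fst ⁻¹' F) = Set.Icc (hMinus τ x) (hPlus τ x) := by
      ext t
      exact ⟨fun h => h.1, fun h => ⟨h, hx⟩⟩
    rw [e, Real.volume_Icc, ← ENNReal.ofReal_mul (inv_pos.2 (L_pos x)).le]
  · rw [Set.indicator_of_notMem hx]
    have e : Prod.mk x ⁻¹' (hullRegion τ ∩ Prod.fst ⁻¹' F) = ∅ := by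
      ext t
      exact ⟨fun h => hx h.2, fun h => h.elim⟩
    rw [e, measure_empty, mul_zero]

end Integration

end CoMinkowski

namespace CoMinkowski

/-! ## The mean curvature operator and its maximum principle -/

section MaximumPrinciple

variable {d : ℕ}

/-- The trace of a bilinear form with respect to `1 - x xᵀ`. -/
noncomputable def kleinTr (x : E d) (N : E d →L[ℝ] E d →L[ℝ] ℝ) : ℝ :=
  ∑ i, N (EuclideanSpace.single i 1) (EuclideanSpace.single i 1) - N x x

/-- The operator `f ↦ ∑ (δ_ij - x_i x_j) ∂_i ∂_j f`. -/
noncomputable def kleinOp (f : E d → ℝ) (x : E d) : ℝ := kleinTr x (fderiv ℝ (fderiv ℝ f) x)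

theorem sum_smul_single (x : E d) : ∑ i, x i • (EuclideanSpace.single i 1 : E d) = x := by
  have := (EuclideanSpace.basisFun (Fin d) ℝ).sum_repr x
  simpa using this

theorem sum_mul_apply_single (x : E d) (φ : E d →L[ℝ] ℝ) :
    ∑ i, x i * φ (EuclideanSpace.single i 1) = φ x := by
  conv_rhs => rw [← sum_smul_single x]
  simp

theorem sum_mul_apply_single_left (x y : E d) (N : E d →L[ℝ] E d →L[ℝ] ℝ) :
    ∑ i, x i * N (EuclideanSpace.single i 1) y = N x y :=
  sum_mul_apply_single x (N.flip y)

theorem sum_sq_eq (x : E d) : ∑ i, x i ^ 2 = ‖x‖ ^ 2 := by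
  rw [EuclideanSpace.norm_sq_eq]; simp

theorem kleinTr_add (x : E d) (N N' : E d →L[ℝ] E d →L[ℝ] ℝ) :
    kleinTr x (N + N') = kleinTr x N + kleinTr x N' := by
  simp [kleinTr, Finset.sum_add_distrib]; ring

theorem kleinTr_smul (x : E d) (c : ℝ) (N : E d →L[ℝ] E d →L[ℝ] ℝ) :
    kleinTr x (c • N) = c * kleinTr x N := by
  simp [kleinTr, Finset.mul_sum, mul_sub]

theorem innerSL_single (y : E d) (i : Fin d) :
    innerSL ℝ y (EuclideanSpace.single i 1) = y i := by
  rw [innerSL_apply_apply, EuclideanSpace.inner_single_right]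
  simp

/-- The inner product of `ℝ^d` as a bilinear form. -/
noncomputable def innerForm (d : ℕ) : E d →L[ℝ] E d →L[ℝ] ℝ := innerSL ℝ

theorem innerForm_apply (x y : E d) : innerForm d x y = inner ℝ x y := rfl

theorem kleinTr_innerForm (x : E d) :
    kleinTr x (innerForm d) = d - ‖x‖ ^ 2 := by
  have h : ∀ y : E d, innerForm d y y = ‖y‖ ^ 2 := fun y =>
    real_inner_self_eq_norm_sq y
  simp only [kleinTr, h]
  simp

theorem kleinTr_smulRight_left (x y : E d) (φ : E d →L[ℝ] ℝ) :
    kleinTr x ((innerSL ℝ y).smulRight φ) = φ y - inner ℝ y x * φ x := by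
  simp only [kleinTr, ContinuousLinearMap.smulRight_apply, smul_apply,
    smul_eq_mul, innerSL_single, sum_mul_apply_single]
  simp

theorem kleinTr_smulRight_right (x y : E d) (φ : E d →L[ℝ] ℝ) :
    kleinTr x (φ.smulRight (innerSL ℝ y)) = φ y - inner ℝ y x * φ x := by
  simp only [kleinTr, ContinuousLinearMap.smulRight_apply, smul_apply,
    smul_eq_mul, innerSL_single, mul_comm (φ _), sum_mul_apply_single]
  simp

/-- The matrix `1 - (1 + l)⁻¹ x xᵀ` is a square root of `1 - x xᵀ`, and its columns are the vectors
in the sum. As a sum of diagonal values, the trace inherits the sign of a semidefinite form. -/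
theorem kleinTr_eq_sum (x : E d) {l : ℝ} (hl : 0 ≤ l) (hx : l ^ 2 = 1 - ‖x‖ ^ 2)
    (N : E d →L[ℝ] E d →L[ℝ] ℝ) :
    kleinTr x N = ∑ i, N (EuclideanSpace.single i 1 - ((1 + l)⁻¹ * x i) • x)
      (EuclideanSpace.single i 1 - ((1 + l)⁻¹ * x i) • x) := by
  set c := (1 + l)⁻¹ with hc
  have h1 : ∀ i, N (EuclideanSpace.single i 1 - (c * x i) • x)
      (EuclideanSpace.single i 1 - (c * x i) • x) =
      N (EuclideanSpace.single i 1) (EuclideanSpace.single i 1) -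
        c * (x i * N (EuclideanSpace.single i 1) x) - c * (x i * N x (EuclideanSpace.single i 1)) +
        c ^ 2 * N x x * x i ^ 2 := by
    intro i
    simp only [map_sub, map_smul, sub_apply, smul_apply,
      smul_eq_mul]
    ring
  simp only [h1, Finset.sum_add_distrib, Finset.sum_sub_distrib, ← Finset.mul_sum,
    sum_mul_apply_single, sum_mul_apply_single_left, sum_sq_eq, kleinTr]
  have h2 : 2 * c - c ^ 2 * ‖x‖ ^ 2 = 1 := by
    have : ‖x‖ ^ 2 = 1 - l ^ 2 := by linarith
    rw [this, hc]
    field_simp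
    ring
  linear_combination (N x x) * h2

/-- The second derivative at a local maximum is nonpositive. -/
theorem fderiv_fderiv_nonpos_of_isLocalMax {g : E d → ℝ} {x : E d} (hg : ContDiffAt ℝ 2 g x)
    (hmax : IsLocalMax g x) (v : E d) : fderiv ℝ (fderiv ℝ g) x v v ≤ 0 := by
  by_contra! hpos
  set φ : ℝ → ℝ := fun t => g (x + t • v)
  have hline : ∀ t : ℝ, HasDerivAt (fun t : ℝ => x + t • v) v t := fun t => by
    simpa using ((hasDerivAt_id t).smul_const v).const_add x
  have hcont : ContinuousAt (fun t : ℝ => x + t • v) 0 := (hline 0).continuousAt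
  have h0 : x + (0 : ℝ) • v = x := by simp
  have hev : ∀ᶠ t in 𝓝 (0 : ℝ), ContDiffAt ℝ 2 g (x + t • v) := by
    have h1 := hg.eventually (by simp)
    rw [← h0] at h1
    exact hcont.eventually h1
  have hd : ∀ᶠ t in 𝓝 (0 : ℝ), deriv φ t = fderiv ℝ g (x + t • v) v := by
    filter_upwards [hev] with t ht
    exact ((ht.differentiableAt (by norm_num)).hasFDerivAt.comp_hasDerivAt t (hline t)).deriv
  have hdd : HasDerivAt (deriv φ) (fderiv ℝ (fderiv ℝ g) x v v) 0 := by
    have h1 : DifferentiableAt ℝ (fderiv ℝ g) x :=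
      (hg.fderiv_right (m := 1) (by norm_num)).differentiableAt (by norm_num)
    have h1' : HasFDerivAt (fderiv ℝ g) (fderiv ℝ (fderiv ℝ g) x) (x + (0 : ℝ) • v) := by
      rw [h0]; exact h1.hasFDerivAt
    have h2 := h1'.comp_hasDerivAt (0 : ℝ) (hline 0)
    have h3 := (ContinuousLinearMap.apply ℝ ℝ v).hasFDerivAt.comp_hasDerivAt (0 : ℝ) h2
    exact h3.congr_of_eventuallyEq hd
  have hmax' : IsLocalMax φ 0 := by
    have h1 : ∀ᶠ y in 𝓝 (x + (0 : ℝ) • v), g y ≤ g x := by rw [h0]; exact hmax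
    filter_upwards [hcont.eventually h1] with t ht
    simpa only [φ, h0] using ht
  -- A positive second derivative would also make the maximum a minimum, so `φ` would be locally
  -- constant and its second derivative zero.
  have hmin : IsLocalMin φ 0 := by
    refine isLocalMin_of_deriv_deriv_pos ?_ hmax'.deriv_eq_zero ?_
    · rw [hdd.deriv]; exact hpos
    · have : ContinuousAt g (x + (0 : ℝ) • v) := by rw [h0]; exact hg.continuousAt
      exact ContinuousAt.comp (g := g) (f := fun t : ℝ => x + t • v) this hcont
  have hconst : φ =ᶠ[𝓝 0] fun _ => φ 0 := by
    filter_upwards [hmax', hmin] with t h1 h2 using le_antisymm h1 h2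
  have hzero : deriv φ =ᶠ[𝓝 0] fun _ => 0 := by
    have := hconst.deriv
    simpa using this
  have := hdd.unique ((hasDerivAt_const (0 : ℝ) (0 : ℝ)).congr_of_eventuallyEq hzero)
  exact hpos.ne' this

theorem contDiffAt_of_ball {f : E d → ℝ} {n : WithTop ℕ∞} (hf : ContDiffOn ℝ n f (Metric.ball 0 1))
    {x : E d} (hx : x ∈ Metric.ball (0 : E d) 1) : ContDiffAt ℝ n f x :=
  hf.contDiffAt (Metric.isOpen_ball.mem_nhds hx)

theorem fderiv_fderiv_add {f g : E d → ℝ} {x : E d} (hf : ContDiffAt ℝ 2 f x)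
    (hg : ContDiffAt ℝ 2 g x) : fderiv ℝ (fderiv ℝ fun y => f y + g y) x =
      fderiv ℝ (fderiv ℝ f) x + fderiv ℝ (fderiv ℝ g) x := by
  have h1 : fderiv ℝ (fun y => f y + g y) =ᶠ[𝓝 x] fun y => fderiv ℝ f y + fderiv ℝ g y := by
    filter_upwards [hf.eventually (by simp), hg.eventually (by simp)] with y h1 h2
    exact fderiv_fun_add (h1.differentiableAt (by norm_num)) (h2.differentiableAt (by norm_num))
  rw [h1.fderiv_eq]
  exact fderiv_fun_add ((hf.fderiv_right (m := 1) (by norm_num)).differentiableAt (by norm_num))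
    ((hg.fderiv_right (m := 1) (by norm_num)).differentiableAt (by norm_num))

theorem fderiv_fderiv_const_mul {f : E d → ℝ} {x : E d} (hf : ContDiffAt ℝ 2 f x) (c : ℝ) :
    fderiv ℝ (fderiv ℝ fun y => c * f y) x = c • fderiv ℝ (fderiv ℝ f) x := by
  have h1 : fderiv ℝ (fun y => c * f y) =ᶠ[𝓝 x] fun y => c • fderiv ℝ f y := by
    filter_upwards [hf.eventually (by simp)] with y h1
    exact fderiv_const_mul (h1.differentiableAt (by norm_num)) c
  rw [h1.fderiv_eq]
  exact fderiv_fun_const_smul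
    ((hf.fderiv_right (m := 1) (by norm_num)).differentiableAt (by norm_num)) c

theorem fderiv_fderiv_norm_sq (x : E d) :
    fderiv ℝ (fderiv ℝ fun y : E d => ‖y‖ ^ 2) x =
      (2 : ℝ) • innerForm d := by
  have h1 : (fderiv ℝ fun y : E d => ‖y‖ ^ 2) = fun y => (2 : ℝ) • innerForm d y := by
    ext1 y
    have := (hasStrictFDerivAt_norm_sq y).hasFDerivAt.fderiv
    rw [this]
    ext v
    simp [innerForm_apply]
  rw [h1]
  exact ((2 : ℝ) • innerForm d).fderiv

/-- Weak maximum principle: adding `ε ‖x‖ ^ 2` makes the operator equal to `2 ε (d - ‖x‖ ^ 2) > 0`,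
which rules out interior maxima; then let `ε` tend to `0`. -/
theorem le_of_kleinOp_eq_zero [NeZero d] {f : E d → ℝ} (hf : ContDiffOn ℝ 2 f (Metric.ball 0 1))
    (hT : ∀ x ∈ Metric.ball (0 : E d) 1, kleinOp f x = 0) {r M : ℝ} (hr : r < 1)
    (hM : ∀ x : E d, ‖x‖ = r → f x ≤ M) {x : E d} (hx : ‖x‖ ≤ r) : f x ≤ M := by
  refine le_of_forall_pos_le_add fun ε hε => ?_
  set g : E d → ℝ := fun y => f y + ε * ‖y‖ ^ 2
  have hsub : Metric.closedBall (0 : E d) r ⊆ Metric.ball 0 1 := Metric.closedBall_subset_ball hr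
  have hgc : ContinuousOn g (Metric.closedBall 0 r) :=
    (hf.continuousOn.mono hsub).add (by fun_prop)
  obtain ⟨x₀, hx₀, hmax⟩ := (isCompact_closedBall (0 : E d) r).exists_isMaxOn
    ⟨x, mem_closedBall_zero_iff.2 hx⟩ hgc
  have hgx : g x ≤ g x₀ := hmax (mem_closedBall_zero_iff.2 hx)
  have hx₀' : ‖x₀‖ ≤ r := mem_closedBall_zero_iff.1 hx₀
  have hx₀1 : ‖x₀‖ < 1 := hx₀'.trans_lt hr
  have hfg : f x ≤ g x := by simp only [g]; nlinarith [sq_nonneg ‖x‖]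
  rcases hx₀'.eq_or_lt with heq | hlt
  · have h1 := hM x₀ heq
    have h2 : ‖x₀‖ ^ 2 ≤ 1 := by nlinarith [norm_nonneg x₀]
    have : g x₀ ≤ M + ε := by simp only [g]; nlinarith
    linarith
  · exfalso
    have hloc : IsLocalMax g x₀ := by
      refine hmax.isLocalMax ?_
      exact mem_of_superset (Metric.isOpen_ball.mem_nhds (mem_ball_zero_iff.2 hlt))
        Metric.ball_subset_closedBall
    have hmem : x₀ ∈ Metric.ball (0 : E d) 1 := hsub hx₀
    have hf2 := contDiffAt_of_ball hf hmem
    have hn2 : ContDiffAt ℝ 2 (fun y : E d => ‖y‖ ^ 2) x₀ := (contDiff_norm_sq ℝ).contDiffAt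
    have hn3 : ContDiffAt ℝ 2 (fun y : E d => ε * ‖y‖ ^ 2) x₀ := contDiffAt_const.mul hn2
    have hD : fderiv ℝ (fderiv ℝ g) x₀ =
        fderiv ℝ (fderiv ℝ f) x₀ + ε • (2 : ℝ) • innerForm d := by
      rw [fderiv_fderiv_add hf2 hn3, fderiv_fderiv_const_mul hn2, fderiv_fderiv_norm_sq]
    have htr : kleinTr x₀ (fderiv ℝ (fderiv ℝ g) x₀) = ε * (2 * (d - ‖x₀‖ ^ 2)) := by
      rw [hD, kleinTr_add, kleinTr_smul, kleinTr_smul, kleinTr_innerForm]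
      have := hT x₀ hmem
      rw [kleinOp] at this
      rw [this, zero_add]
    have hpos : 0 < ε * (2 * (d - ‖x₀‖ ^ 2)) := by
      have hd : (1 : ℝ) ≤ d := by exact_mod_cast NeZero.one_le
      have : ‖x₀‖ ^ 2 < 1 := by nlinarith [norm_nonneg x₀]
      have : 0 < (d : ℝ) - ‖x₀‖ ^ 2 := by linarith
      positivity
    have hnonpos : kleinTr x₀ (fderiv ℝ (fderiv ℝ g) x₀) ≤ 0 := by
      rw [kleinTr_eq_sum x₀ (L_pos ⟨x₀, hmem⟩).le (L_sq ⟨x₀, hmem⟩)]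
      exact Finset.sum_nonpos fun i _ =>
        fderiv_fderiv_nonpos_of_isLocalMax (hf2.add hn3) hloc _
    linarith

/-- Smooth solutions of the mean curvature equation on the ball. -/
structure IsKleinHarmonic (f : E d → ℝ) : Prop where
  contDiffOn : ContDiffOn ℝ ∞ f (Metric.ball 0 1)
  kleinOp_eq_zero : ∀ x ∈ Metric.ball (0 : E d) 1, kleinOp f x = 0

theorem IsKleinHarmonic.contDiffAt {f : E d → ℝ} (hf : IsKleinHarmonic f) {x : E d}
    (hx : x ∈ Metric.ball (0 : E d) 1) : ContDiffAt ℝ 2 f x :=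
  contDiffAt_of_ball (contDiffOn_infty.1 hf.contDiffOn 2) hx

theorem IsKleinHarmonic.add {f g : E d → ℝ} (hf : IsKleinHarmonic f) (hg : IsKleinHarmonic g) :
    IsKleinHarmonic fun x => f x + g x :=
  ⟨hf.contDiffOn.add hg.contDiffOn, fun x hx => by
    rw [kleinOp, fderiv_fderiv_add (hf.contDiffAt hx) (hg.contDiffAt hx), kleinTr_add]
    have h1 := hf.kleinOp_eq_zero x hx
    have h2 := hg.kleinOp_eq_zero x hx
    rw [kleinOp] at h1 h2
    rw [h1, h2, add_zero]⟩

theorem IsKleinHarmonic.const_mul {f : E d → ℝ} (hf : IsKleinHarmonic f) (c : ℝ) :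
    IsKleinHarmonic fun x => c * f x :=
  ⟨contDiffOn_const.mul hf.contDiffOn, fun x hx => by
    rw [kleinOp, fderiv_fderiv_const_mul (hf.contDiffAt hx), kleinTr_smul]
    have h1 := hf.kleinOp_eq_zero x hx
    rw [kleinOp] at h1
    rw [h1, mul_zero]⟩

theorem IsKleinHarmonic.sub {f g : E d → ℝ} (hf : IsKleinHarmonic f) (hg : IsKleinHarmonic g) :
    IsKleinHarmonic fun x => f x - g x := by
  have := hf.add (hg.const_mul (-1))
  simpa [sub_eq_add_neg] using this

theorem isKleinHarmonic_lor_hom (w : Mink d) : IsKleinHarmonic fun x : E d => lor (hom x) w := by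
  have h1 : (fun x : E d => lor (hom x) w) = fun x => innerSL ℝ w.1 x - w.2 := by
    ext x
    rw [lor_hom, innerSL_apply_apply, real_inner_comm]
  rw [h1]
  refine ⟨by fun_prop, fun x _ => ?_⟩
  have h2 : (fderiv ℝ fun x : E d => innerSL ℝ w.1 x - w.2) = fun _ => innerSL ℝ w.1 := by
    ext1 x
    rw [fderiv_sub_const]
    exact (innerSL ℝ w.1).fderiv
  rw [kleinOp, h2]
  simp [kleinTr]

theorem IsKleinHarmonic.congr {f g : E d → ℝ} (hf : IsKleinHarmonic f)
    (h : ∀ x ∈ Metric.ball (0 : E d) 1, g x = f x) : IsKleinHarmonic g := by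
  refine ⟨hf.contDiffOn.congr h, fun x hx => ?_⟩
  have he : g =ᶠ[𝓝 x] f := by
    filter_upwards [Metric.isOpen_ball.mem_nhds hx] with y hy using h y hy
  rw [kleinOp, he.fderiv.fderiv_eq]
  exact hf.kleinOp_eq_zero x hx

/-- A solution with boundary values `0` vanishes. -/
theorem IsKleinHarmonic.eq_zero [NeZero d] {f : E d → ℝ} (hf : IsKleinHarmonic f)
    (hb : ExtendsBy (fun x : Ball d => f x) fun _ => 0) (x : Ball d) : f x = 0 := by
  have key : ∀ f : E d → ℝ, IsKleinHarmonic f → ExtendsBy (fun x : Ball d => f x) (fun _ => 0) →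
      f x ≤ 0 := by
    intro f hf hb
    refine le_of_forall_pos_le_add fun ε hε => ?_
    have hx1 : ‖(x : E d)‖ < 1 := mem_ball_zero_iff.1 x.2
    have h1 : ∀ᶠ y in 𝓝ˢ (Metric.sphere (0 : E d) 1), ∀ hy : y ∈ Metric.ball (0 : E d) 1,
        f y < ε := by
      rw [eventually_nhdsSet_iff_forall]
      intro ξ hξ
      have h2 := (hb ⟨ξ, hξ⟩).eventually (gt_mem_nhds hε)
      rw [eventually_comap] at h2
      filter_upwards [h2] with y hy hyb using hy ⟨y, hyb⟩ rfl
    obtain ⟨U, hUo, hSU, hU⟩ := mem_nhdsSet_iff_exists.1 h1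
    obtain ⟨δ, hδ, hδU⟩ := (isCompact_sphere (0 : E d) 1).exists_thickening_subset_open hUo hSU
    -- By compactness `f < ε` within `δ` of the sphere at infinity. The sphere of radius `r < 1`
    -- lies in that region and encloses `x`.
    set r := max ‖(x : E d)‖ (1 - δ / 2)
    have hr1 : r < 1 := max_lt hx1 (by linarith)
    rw [zero_add]
    refine le_of_kleinOp_eq_zero (contDiffOn_infty.1 hf.contDiffOn 2)
      hf.kleinOp_eq_zero hr1 (fun y hy => ?_) (le_max_left _ _)
    -- The origin has no radial projection; it occurs only if `r = 0`, and then `2 ≤ δ`, so any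
    -- point of the sphere is near enough.
    rcases eq_or_ne y 0 with rfl | hy0
    · have hx0 : ‖(x : E d)‖ ≤ 0 := by rw [norm_zero] at hy; rw [hy]; exact le_max_left _ _
      have hδ2 : 1 - δ / 2 ≤ 0 := by rw [norm_zero] at hy; rw [hy]; exact le_max_right _ _
      obtain ⟨ξ, hξ⟩ := NormedSpace.sphere_nonempty (E := E d) (x := 0) (r := 1) |>.2 zero_le_one
      refine (hU (hδU (Metric.mem_thickening_iff.2 ⟨ξ, hξ, ?_⟩)) (by simp)).le
      have : ‖ξ‖ = 1 := by simpa using hξ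
      rw [dist_zero_left, this]
      linarith
    · have hyn : 0 < ‖y‖ := norm_pos_iff.2 hy0
      have hy1 : ‖y‖ < 1 := by rw [hy]; exact hr1
      have hyr : 1 - δ / 2 ≤ ‖y‖ := by rw [hy]; exact le_max_right _ _
      refine (hU (hδU (Metric.mem_thickening_iff.2 ⟨‖y‖⁻¹ • y, ?_, ?_⟩))
        (mem_ball_zero_iff.2 hy1)).le
      · rw [mem_sphere_zero_iff_norm, norm_smul, norm_inv, norm_norm, inv_mul_cancel₀ hyn.ne']
      · have e : y - ‖y‖⁻¹ • y = (1 - ‖y‖⁻¹) • y := by rw [sub_smul, one_smul]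
        rw [dist_eq_norm, e, norm_smul, Real.norm_eq_abs, ← abs_of_pos hyn, ← abs_mul,
          abs_of_pos hyn, sub_mul, inv_mul_cancel₀ hyn.ne', one_mul, abs_sub_comm,
          abs_of_pos (by linarith)]
        linarith
  refine le_antisymm (key f hf hb) ?_
  have := key (fun x => -1 * f x) (hf.const_mul (-1)) fun ξ => by
    simpa using (hb ξ).const_mul (-1)
  linarith

theorem IsKleinHarmonic.eq_of_extendsBy [NeZero d] {f g : E d → ℝ} {b : Sphere d → ℝ}
    (hf : IsKleinHarmonic f) (hg : IsKleinHarmonic g) (hfb : ExtendsBy (fun x : Ball d => f x) b)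
    (hgb : ExtendsBy (fun x : Ball d => g x) b) (x : Ball d) : f x = g x := by
  have := (hf.sub hg).eq_zero (fun ξ => by simpa using (hfb ξ).sub (hgb ξ)) x
  linarith

/-- A rank-one update: the metric is `L⁻² (1 + L⁻² x xᵀ)`, with inverse `L² (1 - x xᵀ)` because
`‖x‖² = 1 - L²`. -/
theorem hypMetric_inv (x : Ball d) : (hypMetric (x : E d))⁻¹ =
    Matrix.of fun i j => L (x : E d) ^ 2 * ((if i = j then 1 else 0) - x.1 i * x.1 j) := by
  refine Matrix.inv_eq_right_inv ?_
  have hL := L_pos x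
  have hq := L_sq x
  have hs := sum_sq_eq (x : E d)
  ext i j
  rw [Matrix.mul_apply, Matrix.one_apply]
  have e : ∀ k, hypMetric (x : E d) i k *
      (Matrix.of fun i j => L (x : E d) ^ 2 * ((if i = j then 1 else 0) - x.1 i * x.1 j)) k j =
      (if i = k then ((if k = j then 1 else 0) - x.1 k * x.1 j) else 0) +
      (if k = j then (L (x : E d) ^ 2)⁻¹ * (x.1 i * x.1 k) else 0) -
      (L (x : E d) ^ 2)⁻¹ * (x.1 i * x.1 j) * x.1 k ^ 2 := by
    intro k
    simp only [hypMetric, Matrix.of_apply]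
    split_ifs <;> field_simp <;> ring
  simp only [e, Finset.sum_add_distrib, Finset.sum_sub_distrib, ← Finset.mul_sum, hs,
    Finset.sum_ite_eq, Finset.sum_ite_eq', Finset.mem_univ, if_true]
  have hn : ‖(x : E d)‖ ^ 2 = 1 - L (x : E d) ^ 2 := by linarith
  rw [hn]
  field_simp
  ring

theorem meanCurv_eq (h : Ball d → ℝ) (x : Ball d) :
    meanCurv h x = (1 / d) * (L (x : E d) * kleinOp (ext0 h) x) := by
  have hL := L_pos x
  rw [meanCurv, hypMetric_inv]
  congr 1
  set N := fderiv ℝ (fderiv ℝ (ext0 h)) (x : E d) with hN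
  have e : ∀ i j, (Matrix.of fun i j =>
        L (x : E d) ^ 2 * ((if i = j then 1 else 0) - x.1 i * x.1 j)) i j * secondForm h x j i =
      (if i = j then L (x : E d) * N (EuclideanSpace.single j 1) (EuclideanSpace.single i 1)
        else 0) - L (x : E d) * (x.1 i *
          (x.1 j * N (EuclideanSpace.single j 1) (EuclideanSpace.single i 1))) := by
    intro i j
    simp only [secondForm, Matrix.of_apply, ← hN]
    split_ifs <;> field_simp <;> ring
  simp only [Matrix.trace, Matrix.diag, Matrix.mul_apply, e, Finset.sum_sub_distrib,
    Finset.sum_ite_eq, Finset.mem_univ, if_true, ← Finset.mul_sum, sum_mul_apply_single_left,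
    sum_mul_apply_single]
  rw [kleinOp, kleinTr]
  ring

theorem meanCurv_eq_zero_iff [NeZero d] (h : Ball d → ℝ) (x : Ball d) :
    meanCurv h x = 0 ↔ kleinOp (ext0 h) x = 0 := by
  have hd : (d : ℝ) ≠ 0 := by exact_mod_cast NeZero.ne d
  simp [meanCurv_eq, hd, (L_pos x).ne']

theorem isMeanMap_iff [NeZero d] {Γ : Subgroup (OPlus d)} {τ : Z1 Γ} {h : Ball d → ℝ} :
    IsMeanMap τ h ↔ IsKleinHarmonic (ext0 h) ∧ IsEquivariant τ h := by
  simp only [IsMeanMap, meanCurv_eq_zero_iff]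
  exact ⟨fun ⟨h1, h2, h3⟩ => ⟨⟨h1, fun x hx => h3 ⟨x, hx⟩⟩, h2⟩,
    fun ⟨h1, h2⟩ => ⟨h1.contDiffOn, h2, fun x => h1.kleinOp_eq_zero x x.2⟩⟩

end MaximumPrinciple

end CoMinkowski

namespace CoMinkowski

/-! ## Poisson integrals -/

section Poisson

variable {d : ℕ}

theorem one_sub_inner_pos {ζ x : E d} (hζ : ‖ζ‖ = 1) (hx : x ∈ Metric.ball (0 : E d) 1) :
    0 < 1 - inner ℝ ζ x := by
  have h1 := real_inner_le_norm ζ x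
  rw [hζ, one_mul] at h1
  have := mem_ball_zero_iff.1 hx
  linarith

theorem hasDerivAt_inv_pow (k : ℕ) {s : ℝ} (hs : s ≠ 0) :
    HasDerivAt (fun s : ℝ => (s ^ k)⁻¹) (-(k * (s ^ (k + 1))⁻¹)) s := by
  have h := hasDerivAt_zpow (-(k : ℤ)) s (Or.inl hs)
  have e : ∀ t : ℝ, t ^ (-(k : ℤ)) = (t ^ k)⁻¹ := fun t => by rw [zpow_neg, zpow_natCast]
  simp only [e] at h
  refine h.congr_deriv ?_
  have : -(k : ℤ) - 1 = -((k + 1 : ℕ) : ℤ) := by push_cast; ring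
  rw [this, zpow_neg, zpow_natCast]
  push_cast
  ring

variable {F : Type} [NormedAddCommGroup F] [NormedSpace ℝ F]

/-- The integral of `(1 - ⟨ζ(η), x⟩)⁻ᵏ w(η)` over the sphere. -/
noncomputable def kernelInt (ζ : Sphere d → E d) (k : ℕ) (w : Sphere d → F) (x : E d) : F :=
  ∫ η, ((1 - inner ℝ (ζ η) x) ^ k)⁻¹ • w η ∂(volume : Measure (E d)).toSphere

/-- The density of the derivative of `kernelInt`. -/
noncomputable def kernelDeriv (ζ : Sphere d → E d) (k : ℕ) (w : Sphere d → F) (η : Sphere d) :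
    E d →L[ℝ] F :=
  (k : ℝ) • (innerSL ℝ (ζ η)).smulRight (w η)

variable {ζ : Sphere d → E d} {w : Sphere d → F}

theorem continuous_kernelDeriv (hζ : Continuous ζ) (hw : Continuous w) (k : ℕ) :
    Continuous (kernelDeriv ζ k w) := by
  unfold kernelDeriv
  fun_prop

theorem continuous_kernel (hζ : Continuous ζ) (hn : ∀ η, ‖ζ η‖ = 1) (hw : Continuous w) (k : ℕ)
    {x : E d} (hx : x ∈ Metric.ball (0 : E d) 1) :
    Continuous fun η => ((1 - inner ℝ (ζ η) x) ^ k)⁻¹ • w η := by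
  refine Continuous.smul (Continuous.inv₀ (by fun_prop) fun η => ?_) hw
  exact (pow_pos (one_sub_inner_pos (hn η) hx) k).ne'

theorem integrable_kernel (hζ : Continuous ζ) (hn : ∀ η, ‖ζ η‖ = 1) (hw : Continuous w) (k : ℕ)
    {x : E d} (hx : x ∈ Metric.ball (0 : E d) 1) :
    Integrable (fun η => ((1 - inner ℝ (ζ η) x) ^ k)⁻¹ • w η)
      (volume : Measure (E d)).toSphere :=
  (continuous_kernel hζ hn hw k hx).integrable_of_hasCompactSupport
    (HasCompactSupport.of_compactSpace _)

theorem hasFDerivAt_kernelInt (hζ : Continuous ζ) (hn : ∀ η, ‖ζ η‖ = 1)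
    (hw : Continuous w) (k : ℕ) {x : E d} (hx : x ∈ Metric.ball (0 : E d) 1) :
    HasFDerivAt (kernelInt ζ k w) (kernelInt ζ (k + 1) (kernelDeriv ζ k w) x) x := by
  have hx1 : ‖x‖ < 1 := mem_ball_zero_iff.1 hx
  -- On the ball of this radius around `x` the denominators stay above `ε`, uniformly in the
  -- boundary point, which justifies differentiation under the integral.
  set ε := (1 - ‖x‖) / 2 with hε
  have hε0 : 0 < ε := by linarith
  have hsub : ∀ y ∈ Metric.ball x ε, ‖y‖ < 1 - ε := fun y hy => by
    have h1 : ‖y - x‖ < ε := mem_ball_iff_norm.1 hy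
    have h2 := norm_sub_norm_le y x
    linarith
  have hsub' : ∀ y ∈ Metric.ball x ε, y ∈ Metric.ball (0 : E d) 1 := fun y hy =>
    mem_ball_zero_iff.2 (by linarith [hsub y hy])
  have hW := continuous_kernelDeriv hζ hw k
  obtain ⟨C, hC⟩ := isCompact_univ.exists_bound_of_continuousOn hW.continuousOn
  refine hasFDerivAt_integral_of_dominated_of_fderiv_le (bound := fun _ => (ε ^ (k + 1))⁻¹ * C)
    (F' := fun y η => ((1 - inner ℝ (ζ η) y) ^ (k + 1))⁻¹ • kernelDeriv ζ k w η)
    (Metric.ball_mem_nhds x hε0) ?_ (integrable_kernel hζ hn hw k hx)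
    (integrable_kernel hζ hn hW _ hx).1 ?_ (integrable_const _) ?_
  · filter_upwards [Metric.ball_mem_nhds x hε0] with y hy
    exact (integrable_kernel hζ hn hw k (hsub' y hy)).1
  · refine Eventually.of_forall fun η y hy => ?_
    have h1 : ε ≤ 1 - inner ℝ (ζ η) y := by
      have := real_inner_le_norm (ζ η) y
      rw [hn, one_mul] at this
      linarith [hsub y hy]
    have h2 : 0 < 1 - inner ℝ (ζ η) y := hε0.trans_le h1
    rw [norm_smul, norm_inv, norm_pow, Real.norm_of_nonneg h2.le]
    have h3 := hC η (Set.mem_univ _)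
    gcongr
  · refine Eventually.of_forall fun η y hy => ?_
    have h2 := one_sub_inner_pos (hn η) (hsub' y hy)
    have h3 : HasFDerivAt (fun y : E d => 1 - inner ℝ (ζ η) y) (-innerSL ℝ (ζ η)) y := by
      have := ((innerSL ℝ (ζ η)).hasFDerivAt (x := y)).const_sub 1
      exact this
    have h4 := ((hasDerivAt_inv_pow k h2.ne').comp_hasFDerivAt y h3).smul_const (w η)
    refine h4.congr_fderiv ?_
    ext v
    simp only [kernelDeriv, smul_apply, neg_apply, ContinuousLinearMap.smulRight_apply, smul_smul,
      smul_eq_mul]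
    congr 1
    ring

/-- The derivative is again a kernel integral, with exponent `k + 1` and a density in `E d →L[ℝ] F`.
Hence the induction runs over all target spaces, the reason for vector-valued densities. -/
theorem contDiffOn_kernelInt (hζ : Continuous ζ) (hn : ∀ η, ‖ζ η‖ = 1) (hw : Continuous w)
    (k : ℕ) : ContDiffOn ℝ ∞ (kernelInt ζ k w) (Metric.ball 0 1) := by
  refine contDiffOn_infty.2 fun n => ?_
  induction n generalizing F k with
  | zero =>
    refine contDiffOn_zero.2 fun x hx => ?_
    exact (hasFDerivAt_kernelInt hζ hn hw k hx).continuousAt.continuousWithinAt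
  | succ n ih =>
    have h := (contDiffOn_succ_iff_fderiv_of_isOpen (n := (n : WithTop ℕ∞)) (𝕜 := ℝ)
      (f := kernelInt ζ k w) (Metric.isOpen_ball (x := (0 : E d)) (ε := 1))).2
    refine h ⟨fun x hx => ?_, fun h => by simp at h, ?_⟩
    · exact (hasFDerivAt_kernelInt hζ hn hw k hx).differentiableAt.differentiableWithinAt
    · exact (ih (continuous_kernelDeriv hζ hw k) (k + 1)).congr fun x hx =>
        (hasFDerivAt_kernelInt hζ hn hw k hx).fderiv

theorem fderiv_fderiv_kernelInt (hζ : Continuous ζ) (hn : ∀ η, ‖ζ η‖ = 1) (hw : Continuous w)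
    (k : ℕ) {x : E d} (hx : x ∈ Metric.ball (0 : E d) 1) :
    fderiv ℝ (fderiv ℝ (kernelInt ζ k w)) x =
      kernelInt ζ (k + 2) (kernelDeriv ζ (k + 1) (kernelDeriv ζ k w)) x := by
  have h1 : fderiv ℝ (kernelInt ζ k w) =ᶠ[𝓝 x] kernelInt ζ (k + 1) (kernelDeriv ζ k w) := by
    filter_upwards [Metric.isOpen_ball.mem_nhds hx] with y hy
    exact (hasFDerivAt_kernelInt hζ hn hw k hy).fderiv
  rw [h1.fderiv_eq]
  exact (hasFDerivAt_kernelInt hζ hn (continuous_kernelDeriv hζ hw k) (k + 1) hx).fderiv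

theorem kernelInt_apply {w : Sphere d → E d →L[ℝ] F} (hζ : Continuous ζ) (hn : ∀ η, ‖ζ η‖ = 1)
    (hw : Continuous w) (k : ℕ) {x : E d} (hx : x ∈ Metric.ball (0 : E d) 1) (v : E d) :
    kernelInt ζ k w x v = kernelInt ζ k (fun η => w η v) x := by
  rw [kernelInt, ContinuousLinearMap.integral_apply (integrable_kernel hζ hn hw k hx)]
  rfl

theorem kernelInt_sum {ι : Type} (s : Finset ι) {w : ι → Sphere d → F} (hζ : Continuous ζ)
    (hn : ∀ η, ‖ζ η‖ = 1) (hw : ∀ i, Continuous (w i)) (k : ℕ) {x : E d}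
    (hx : x ∈ Metric.ball (0 : E d) 1) :
    ∑ i ∈ s, kernelInt ζ k (w i) x = kernelInt ζ k (fun η => ∑ i ∈ s, w i η) x := by
  simp only [kernelInt, Finset.smul_sum]
  exact (integral_finsetSum _ fun i _ => integrable_kernel hζ hn (hw i) k hx).symm

variable {w : Sphere d → ℝ}

theorem fderiv_kernelInt_self (hζ : Continuous ζ) (hn : ∀ η, ‖ζ η‖ = 1) (hw : Continuous w)
    (k : ℕ) {x : E d} (hx : x ∈ Metric.ball (0 : E d) 1) :
    fderiv ℝ (kernelInt ζ k w) x x = k * (kernelInt ζ (k + 1) w x - kernelInt ζ k w x) := by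
  rw [(hasFDerivAt_kernelInt hζ hn hw k hx).fderiv,
    kernelInt_apply hζ hn (continuous_kernelDeriv hζ hw k) _ hx, kernelInt, kernelInt, kernelInt,
    ← integral_sub (integrable_kernel hζ hn hw _ hx) (integrable_kernel hζ hn hw _ hx),
    ← integral_const_mul]
  congr 1
  ext η
  have := one_sub_inner_pos (hn η) hx
  simp only [kernelDeriv, smul_apply, ContinuousLinearMap.smulRight_apply, innerSL_apply_apply,
    smul_eq_mul]
  rw [pow_succ]
  field_simp
  ring

/-- With `s = 1 - ⟨ζ, x⟩` the integrand is `k (k + 1) s ^ (-k - 2) (1 - ⟨ζ, x⟩ ^ 2)`, and `1 - ⟨ζ,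
x⟩ ^ 2 = s (2 - s)`. -/
theorem kleinOp_kernelInt (hζ : Continuous ζ) (hn : ∀ η, ‖ζ η‖ = 1) (hw : Continuous w)
    (k : ℕ) {x : E d} (hx : x ∈ Metric.ball (0 : E d) 1) :
    kleinOp (kernelInt ζ k w) x =
      k * (k + 1) * (2 * kernelInt ζ (k + 1) w x - kernelInt ζ k w x) := by
  have hW := continuous_kernelDeriv hζ (continuous_kernelDeriv hζ hw k) (k + 1)
  have happ : ∀ v, kernelInt ζ (k + 2) (kernelDeriv ζ (k + 1) (kernelDeriv ζ k w)) x v v =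
      kernelInt ζ (k + 2) (fun η => kernelDeriv ζ (k + 1) (kernelDeriv ζ k w) η v v) x :=
    fun v => by
      rw [kernelInt_apply hζ hn hW _ hx, kernelInt_apply hζ hn (by fun_prop) _ hx]
  have hc : ∀ v, Continuous fun η => kernelDeriv ζ (k + 1) (kernelDeriv ζ k w) η v v :=
    fun v => by fun_prop
  rw [kleinOp, fderiv_fderiv_kernelInt hζ hn hw k hx, kleinTr]
  simp only [happ]
  rw [kernelInt_sum _ hζ hn (fun i => hc _) _ hx, kernelInt, kernelInt,
    ← integral_sub (integrable_kernel hζ hn (by fun_prop) _ hx)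
      (integrable_kernel hζ hn (hc x) _ hx), kernelInt, kernelInt, ← integral_const_mul,
    ← integral_sub ((integrable_kernel hζ hn hw _ hx).const_mul 2)
      (integrable_kernel hζ hn hw _ hx), ← integral_const_mul]
  congr 1
  ext η
  have hs := one_sub_inner_pos (hn η) hx
  have hsum := sum_sq_eq (ζ η)
  rw [hn] at hsum
  have hk : ∀ v, kernelDeriv ζ (k + 1) (kernelDeriv ζ k w) η v v =
      k * (k + 1) * w η * (inner ℝ (ζ η) v) ^ 2 := fun v => by
    simp only [kernelDeriv, smul_apply, ContinuousLinearMap.smulRight_apply, innerSL_apply_apply,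
      smul_eq_mul]
    push_cast
    ring
  have hin : ∀ i, inner ℝ (ζ η) (EuclideanSpace.single i 1) = ζ η i := innerSL_single (ζ η)
  simp only [hk, hin, ← Finset.mul_sum, hsum, smul_eq_mul]
  rw [pow_succ, pow_succ]
  field_simp
  ring

theorem fderiv_fderiv_mul {f g : E d → ℝ} {x : E d} (hf : ContDiffAt ℝ 2 f x)
    (hg : ContDiffAt ℝ 2 g x) : fderiv ℝ (fderiv ℝ fun y => f y * g y) x =
      (f x • fderiv ℝ (fderiv ℝ g) x + (fderiv ℝ f x).smulRight (fderiv ℝ g x)) +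
      (g x • fderiv ℝ (fderiv ℝ f) x + (fderiv ℝ g x).smulRight (fderiv ℝ f x)) := by
  have h1 : fderiv ℝ (fun y => f y * g y) =ᶠ[𝓝 x]
      fun y => f y • fderiv ℝ g y + g y • fderiv ℝ f y := by
    filter_upwards [hf.eventually (by simp), hg.eventually (by simp)] with y h1 h2
    exact fderiv_fun_mul (h1.differentiableAt (by norm_num)) (h2.differentiableAt (by norm_num))
  rw [h1.fderiv_eq]
  have hf1 := (hf.differentiableAt (by norm_num)).hasFDerivAt
  have hg1 := (hg.differentiableAt (by norm_num)).hasFDerivAt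
  have hf2 := ((hf.fderiv_right (m := 1) (by norm_num)).differentiableAt (by norm_num)).hasFDerivAt
  have hg2 := ((hg.fderiv_right (m := 1) (by norm_num)).differentiableAt (by norm_num)).hasFDerivAt
  exact ((hf1.smul hg2).add (hg1.smul hf2)).fderiv

theorem one_sub_norm_sq_pos {x : E d} (hx : x ∈ Metric.ball (0 : E d) 1) : 0 < 1 - ‖x‖ ^ 2 := by
  have := mem_ball_zero_iff.1 hx
  nlinarith [norm_nonneg x]

theorem hasFDerivAt_one_sub_norm_sq_rpow (p : ℝ) {x : E d} (hx : x ∈ Metric.ball (0 : E d) 1) :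
    HasFDerivAt (fun y : E d => (1 - ‖y‖ ^ 2) ^ p)
      ((-2 * p * (1 - ‖x‖ ^ 2) ^ (p - 1)) • innerForm d x) x := by
  have h := (((hasFDerivAt_id x).norm_sq).const_sub 1).rpow_const (p := p)
    (Or.inl (one_sub_norm_sq_pos hx).ne')
  refine h.congr_fderiv ?_
  ext v
  simp [innerForm_apply]
  ring

theorem contDiffOn_one_sub_norm_sq_rpow (p : ℝ) :
    ContDiffOn ℝ ∞ (fun y : E d => (1 - ‖y‖ ^ 2) ^ p) (Metric.ball 0 1) := by
  refine ContDiffOn.rpow_const_of_ne ?_ fun x hx => (one_sub_norm_sq_pos hx).ne'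
  exact (contDiff_const.sub (contDiff_norm_sq ℝ)).contDiffOn

theorem kleinTr_smulRight_innerForm_left (x : E d) (φ : E d →L[ℝ] ℝ) :
    kleinTr x ((innerForm d x).smulRight φ) = (1 - ‖x‖ ^ 2) * φ x := by
  have := kleinTr_smulRight_left x x φ
  rw [real_inner_self_eq_norm_sq] at this
  rw [sub_mul, one_mul]
  exact this

theorem kleinTr_smulRight_innerForm_right (x : E d) (φ : E d →L[ℝ] ℝ) :
    kleinTr x (φ.smulRight (innerForm d x)) = (1 - ‖x‖ ^ 2) * φ x := by
  have := kleinTr_smulRight_right x x φ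
  rw [real_inner_self_eq_norm_sq] at this
  rw [sub_mul, one_mul]
  exact this

theorem kleinOp_one_sub_norm_sq_rpow (p : ℝ) {x : E d} (hx : x ∈ Metric.ball (0 : E d) 1) :
    kleinOp (fun y : E d => (1 - ‖y‖ ^ 2) ^ p) x =
      -2 * p * (1 - ‖x‖ ^ 2) ^ (p - 1) * (d - ‖x‖ ^ 2 - 2 * (p - 1) * ‖x‖ ^ 2) := by
  have hq := one_sub_norm_sq_pos hx
  have h1 : fderiv ℝ (fun y : E d => (1 - ‖y‖ ^ 2) ^ p) =ᶠ[𝓝 x]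
      fun y => (-2 * p * (1 - ‖y‖ ^ 2) ^ (p - 1)) • innerForm d y := by
    filter_upwards [Metric.isOpen_ball.mem_nhds hx] with y hy
    exact (hasFDerivAt_one_sub_norm_sq_rpow p hy).fderiv
  have h2 := ((hasFDerivAt_one_sub_norm_sq_rpow (p - 1) hx).const_mul (-2 * p)).smul
    (innerForm d).hasFDerivAt
  have h3 : fderiv ℝ (fderiv ℝ fun y : E d => (1 - ‖y‖ ^ 2) ^ p) x =
      (-2 * p * (1 - ‖x‖ ^ 2) ^ (p - 1)) • innerForm d +
      ((-2 * p) * (-2 * (p - 1) * (1 - ‖x‖ ^ 2) ^ (p - 1 - 1))) •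
        (innerForm d x).smulRight (innerForm d x) := by
    rw [h1.fderiv_eq]
    refine h2.fderiv.trans ?_
    congr 1
    ext v u
    simp
    ring
  rw [kleinOp, h3, kleinTr_add, kleinTr_smul, kleinTr_smul, kleinTr_innerForm,
    kleinTr_smulRight_innerForm_left, innerForm_apply, real_inner_self_eq_norm_sq]
  have h4 : (1 - ‖x‖ ^ 2) ^ (p - 1) = (1 - ‖x‖ ^ 2) ^ (p - 1 - 1) * (1 - ‖x‖ ^ 2) := by
    rw [← Real.rpow_add_one hq.ne']; congr 1; ring
  rw [h4]
  ring

/-- The (unnormalized) Poisson integral. -/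
noncomputable def poisson (ζ : Sphere d → E d) (w : Sphere d → ℝ) (x : E d) : ℝ :=
  L x ^ (d + 1) * kernelInt ζ d w x

theorem L_pow_eq_rpow {x : E d} (hx : x ∈ Metric.ball (0 : E d) 1) :
    L x ^ (d + 1) = (1 - ‖x‖ ^ 2) ^ (((d : ℝ) + 1) / 2) := by
  rw [L, Real.sqrt_eq_rpow, ← Real.rpow_natCast, ← Real.rpow_mul (one_sub_norm_sq_pos hx).le]
  congr 1
  push_cast
  ring

/-- Leibniz rule for `(1 - ‖x‖ ^ 2) ^ m` times the kernel integral of exponent `d`. Taking `m = (d +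
1) / 2` cancels the terms of exponent `d + 1`, and then those of exponent `d` cancel as well. -/
theorem isKleinHarmonic_poisson (hζ : Continuous ζ) (hn : ∀ η, ‖ζ η‖ = 1) (hw : Continuous w) :
    IsKleinHarmonic (poisson ζ w) := by
  set m : ℝ := ((d : ℝ) + 1) / 2 with hm
  have hQ := contDiffOn_one_sub_norm_sq_rpow (d := d) m
  have hG := contDiffOn_kernelInt hζ hn hw d
  have key : IsKleinHarmonic fun x => (1 - ‖x‖ ^ 2) ^ m * kernelInt ζ d w x := by
    refine ⟨hQ.mul hG, fun x hx => ?_⟩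
    have hq := one_sub_norm_sq_pos hx
    have h1 := kleinOp_one_sub_norm_sq_rpow m hx
    have h2 := kleinOp_kernelInt hζ hn hw d hx
    have h3 := fderiv_kernelInt_self hζ hn hw d hx
    rw [kleinOp] at h1 h2
    rw [kleinOp, fderiv_fderiv_mul (contDiffAt_of_ball (contDiffOn_infty.1 hQ 2) hx)
      (contDiffAt_of_ball (contDiffOn_infty.1 hG 2) hx), kleinTr_add, kleinTr_add, kleinTr_add,
      kleinTr_smul, kleinTr_smul, h1, h2, (hasFDerivAt_one_sub_norm_sq_rpow m hx).fderiv]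
    have e1 : ∀ (c : ℝ) (φ : E d →L[ℝ] ℝ), (c • innerForm d x).smulRight φ =
        c • (innerForm d x).smulRight φ := fun c φ => by ext; simp [mul_assoc]
    have e2 : ∀ (c : ℝ) (φ : E d →L[ℝ] ℝ), φ.smulRight (c • innerForm d x) =
        c • φ.smulRight (innerForm d x) := fun c φ => by ext; simp; ring
    rw [e1, e2, kleinTr_smul, kleinTr_smul, kleinTr_smulRight_innerForm_left,
      kleinTr_smulRight_innerForm_right, h3]
    have h4 : (1 - ‖x‖ ^ 2) ^ m = (1 - ‖x‖ ^ 2) ^ (m - 1) * (1 - ‖x‖ ^ 2) := by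
      rw [← Real.rpow_add_one hq.ne']; congr 1; ring
    rw [h4, hm]
    ring
  exact key.congr fun x hx => by rw [poisson, L_pow_eq_rpow hx]

end Poisson

end CoMinkowski

namespace CoMinkowski

/-! ## The Dirichlet problem at infinity -/

section Dirichlet

variable {d : ℕ}

/-- The action of a linear isometry on the unit sphere. -/
noncomputable def sphereMap (R : E d ≃ₗᵢ[ℝ] E d) (η : Sphere d) : Sphere d :=
  ⟨R η, by rw [mem_sphere_zero_iff_norm, R.norm_map]; exact mem_sphere_zero_iff_norm.1 η.2⟩

theorem continuous_sphereMap (R : E d ≃ₗᵢ[ℝ] E d) : Continuous (sphereMap R) :=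
  Continuous.subtype_mk (R.continuous.comp continuous_subtype_val) _

open scoped Pointwise in
theorem map_sphereMap_toSphere (R : E d ≃ₗᵢ[ℝ] E d) :
    (volume : Measure (E d)).toSphere.map (sphereMap R) = (volume : Measure (E d)).toSphere := by
  have hm := (continuous_sphereMap R).measurable
  ext s hs
  rw [Measure.map_apply hm hs, Measure.toSphere_apply' _ (hm hs), Measure.toSphere_apply' _ hs]
  congr 1
  have h := R.measurePreserving.measure_preimage_equiv (f := R.toMeasurableEquiv)
    (Set.Ioo (0 : ℝ) 1 • ((↑) '' s : Set (E d)))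
  rw [← h]
  congr 1
  ext y
  simp only [Set.mem_smul, Set.mem_image, Set.mem_preimage]
  constructor
  · rintro ⟨t, ht, _, ⟨η, hη, rfl⟩, rfl⟩
    exact ⟨t, ht, _, ⟨sphereMap R η, hη, rfl⟩, (R.map_smul t _).symm⟩
  · rintro ⟨t, ht, _, ⟨η, hη, rfl⟩, hy⟩
    refine ⟨t, ht, _, ⟨sphereMap R.symm η, ?_, rfl⟩, ?_⟩
    · have : sphereMap R (sphereMap R.symm η) = η := Subtype.ext (R.apply_symm_apply _)
      rw [this]
      exact hη
    · apply R.injective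
      change R (t • R.symm η) = R y
      rw [R.map_smul, R.apply_symm_apply]
      exact hy

theorem norm_coe_sphere (η : Sphere d) : ‖(η : E d)‖ = 1 := mem_sphere_zero_iff_norm.1 η.2

theorem poisson_one_map (R : E d ≃ₗᵢ[ℝ] E d) {x : E d} (hx : x ∈ Metric.ball (0 : E d) 1) :
    poisson (fun η : Sphere d => (η : E d)) (fun _ => 1) (R x) =
      poisson (fun η : Sphere d => (η : E d)) (fun _ => 1) x := by
  have hRx : R x ∈ Metric.ball (0 : E d) 1 := by
    rw [mem_ball_zero_iff, R.norm_map]; exact mem_ball_zero_iff.1 hx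
  have hL : L (R x) = L x := by rw [L, L, R.norm_map]
  rw [poisson, poisson, hL, kernelInt, kernelInt]
  congr 1
  nth_rewrite 1 [← map_sphereMap_toSphere R]
  rw [integral_map (continuous_sphereMap R).aemeasurable]
  · congr 1
    ext η
    congr 4
    exact R.inner_map_map (η : E d) x
  · exact (continuous_kernel continuous_subtype_val norm_coe_sphere continuous_const d
      hRx).aestronglyMeasurable

/-- The normalization constant of the Poisson integral. -/
noncomputable def sphereArea (d : ℕ) : ℝ := (volume : Measure (E d)).toSphere.real Set.univ

theorem sphereArea_pos [NeZero d] : 0 < sphereArea d := by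
  have : Nontrivial (E d) := by infer_instance
  rw [sphereArea, measureReal_def]
  refine ENNReal.toReal_pos ?_ (measure_ne_top _ _)
  rw [Ne, Measure.measure_univ_eq_zero]
  exact Measure.toSphere_ne_zero _

/-- The integral is invariant under reflections, so constant on each sphere around the origin. The
maximum principle for it and its negative gives its value at the centre everywhere. -/
theorem poisson_one [NeZero d] {x : E d} (hx : x ∈ Metric.ball (0 : E d) 1) :
    poisson (fun η : Sphere d => (η : E d)) (fun _ => 1) x = sphereArea d := by
  set f := poisson (fun η : Sphere d => (η : E d)) (fun _ => 1) with hf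
  have hH : IsKleinHarmonic f :=
    isKleinHarmonic_poisson continuous_subtype_val norm_coe_sphere continuous_const
  have hrot : ∀ y : E d, ‖y‖ = ‖x‖ → f y = f x := by
    intro y hy
    have := poisson_one_map (Submodule.reflection (Submodule.span ℝ {x - y})ᗮ) hx
    rw [Submodule.reflection_sub hy.symm] at this
    exact this
  have h1 : f 0 ≤ f x := le_of_kleinOp_eq_zero (contDiffOn_infty.1 hH.contDiffOn 2)
    hH.kleinOp_eq_zero (mem_ball_zero_iff.1 hx) (fun y hy => (hrot y hy).le) (by simp)
  have hN := hH.const_mul (-1)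
  have h2 : -1 * f 0 ≤ -1 * f x := le_of_kleinOp_eq_zero (contDiffOn_infty.1 hN.contDiffOn 2)
    hN.kleinOp_eq_zero (mem_ball_zero_iff.1 hx) (fun y hy => by rw [hrot y hy]) (by simp)
  have h3 : f x = f 0 := by linarith
  rw [h3, hf, poisson, kernelInt, sphereArea]
  simp [L]

theorem sq_dist_div_two_le {x η : E d} (hx : ‖x‖ ≤ 1) (hη : ‖η‖ = 1) :
    ‖x - η‖ ^ 2 / 2 ≤ 1 - inner ℝ η x := by
  rw [norm_sub_sq_real, hη, real_inner_comm]
  nlinarith [norm_nonneg x]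

theorem abs_poisson_sub_le [NeZero d] {b : Sphere d → ℝ} (hb : Continuous b) (ξ : Sphere d)
    {ε : ℝ} (hε : 0 < ε) : ∃ δ > 0, ∃ K, ∀ x : Ball d, ‖(x : E d) - ξ‖ < δ →
      |poisson (fun η : Sphere d => (η : E d)) b x - sphereArea d * b ξ| ≤
        ε * sphereArea d + K * L (x : E d) ^ (d + 1) := by
  obtain ⟨C, hC⟩ := isCompact_univ.exists_bound_of_continuousOn hb.continuousOn
  obtain ⟨δ, hδ, hbδ⟩ := Metric.continuous_iff.1 hb ξ ε hε
  have hC0 : 0 ≤ C := (norm_nonneg _).trans (hC ξ (Set.mem_univ _))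
  -- For `η` at distance at least `δ` from `ξ` and `x` within `δ / 2`, one has `1 - ⟨η, x⟩ ≥ ‖x - η‖
  -- ^ 2 / 2 ≥ δ ^ 2 / 8`. The far part is thus bounded and is killed by `L ^ (d + 1)`; the near
  -- part is `ε` times the total mass.
  set K := ((δ ^ 2 / 8) ^ d)⁻¹ * (2 * C) with hK
  refine ⟨δ / 2, by positivity, K * sphereArea d, fun x hx => ?_⟩
  set ζ : Sphere d → E d := fun η => (η : E d)
  have hx1 : ‖(x : E d)‖ < 1 := mem_ball_zero_iff.1 x.2
  have hL := L_pos x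
  have hi : ∀ w : Sphere d → ℝ, Continuous w →
      Integrable (fun η => ((1 - inner ℝ (ζ η) (x : E d)) ^ d)⁻¹ • w η)
        (volume : Measure (E d)).toSphere := fun w hw =>
    integrable_kernel continuous_subtype_val norm_coe_sphere hw d x.2
  have h1 : poisson ζ b x - sphereArea d * b ξ =
      L (x : E d) ^ (d + 1) * kernelInt ζ d (fun η => b η - b ξ) x := by
    rw [← poisson_one x.2, poisson, poisson, kernelInt, kernelInt, kernelInt, mul_assoc,
      ← integral_mul_const, ← mul_sub, ← integral_sub (hi b hb)
      ((hi _ continuous_const).mul_const _)]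
    congr 2
    ext η
    simp only [smul_eq_mul]
    ring
  have h2 : ∀ η, ‖((1 - inner ℝ (ζ η) (x : E d)) ^ d)⁻¹ • (b η - b ξ)‖ ≤
      ε * (((1 - inner ℝ (ζ η) (x : E d)) ^ d)⁻¹ • 1) + K := by
    intro η
    have hs := one_sub_inner_pos (norm_coe_sphere η) x.2
    rw [norm_smul, Real.norm_of_nonneg (by positivity), smul_eq_mul, mul_one]
    rcases lt_or_ge (dist η ξ) δ with hlt | hge
    · have h3 : ‖b η - b ξ‖ ≤ ε := (hbδ η hlt).le
      have hK0 : 0 ≤ K := by positivity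
      have : ((1 - inner ℝ (ζ η) (x : E d)) ^ d)⁻¹ * ‖b η - b ξ‖ ≤
          ((1 - inner ℝ (ζ η) (x : E d)) ^ d)⁻¹ * ε := by gcongr
      linarith
    · have h3 : ‖b η - b ξ‖ ≤ 2 * C := (norm_sub_le _ _).trans (by
        linarith [hC η (Set.mem_univ _), hC ξ (Set.mem_univ _)])
      have h4 : δ / 2 ≤ ‖(x : E d) - η‖ := by
        have e : δ ≤ ‖(η : E d) - ξ‖ := by rw [← dist_eq_norm]; exact hge
        have e2 : ‖(η : E d) - ξ‖ ≤ ‖(x : E d) - ξ‖ + ‖(x : E d) - η‖ := by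
          have := norm_sub_le ((x : E d) - ξ) ((x : E d) - η)
          rwa [sub_sub_sub_cancel_left] at this
        linarith
      have h5 : δ ^ 2 / 8 ≤ 1 - inner ℝ (ζ η) (x : E d) := by
        refine le_trans ?_ (sq_dist_div_two_le hx1.le (norm_coe_sphere η))
        nlinarith
      have h6 : ((1 - inner ℝ (ζ η) (x : E d)) ^ d)⁻¹ * ‖b η - b ξ‖ ≤ K := by
        rw [hK]; gcongr
      have : 0 ≤ ε * ((1 - inner ℝ (ζ η) (x : E d)) ^ d)⁻¹ := by positivity
      linarith
  have h3 : ‖kernelInt ζ d (fun η => b η - b ξ) (x : E d)‖ ≤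
      ε * kernelInt ζ d (fun _ => (1 : ℝ)) (x : E d) + K * sphereArea d := by
    refine (norm_integral_le_of_norm_le (((hi _ continuous_const).const_mul ε).add
      (integrable_const K)) (Eventually.of_forall h2)).trans_eq ?_
    rw [integral_add' ((hi _ continuous_const).const_mul ε) (integrable_const K),
      integral_const_mul, integral_const, smul_eq_mul, mul_comm _ K]
    rfl
  have h4 := poisson_one x.2
  rw [poisson] at h4
  rw [h1, abs_mul, abs_of_pos (by positivity), ← h4]
  calc _ ≤ L (x : E d) ^ (d + 1) * (ε * kernelInt ζ d (fun _ => (1 : ℝ)) (x : E d) +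
        K * sphereArea d) := by
        have : |kernelInt ζ d (fun η => b η - b ξ) (x : E d)| ≤ _ := h3
        gcongr
    _ = _ := by rw [h4, ← h4]; ring

/-- The solution of the Dirichlet problem with boundary values `b`. -/
noncomputable def dirichlet (b : Sphere d → ℝ) (x : E d) : ℝ :=
  (sphereArea d)⁻¹ * poisson (fun η : Sphere d => (η : E d)) b x

theorem isKleinHarmonic_dirichlet {b : Sphere d → ℝ} (hb : Continuous b) :
    IsKleinHarmonic (dirichlet b) :=
  (isKleinHarmonic_poisson continuous_subtype_val norm_coe_sphere hb).const_mul _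

theorem extendsBy_dirichlet [NeZero d] {b : Sphere d → ℝ} (hb : Continuous b) :
    ExtendsBy (fun x : Ball d => dirichlet b x) b := by
  intro ξ
  have hc := sphereArea_pos (d := d)
  suffices h : Tendsto (fun x : Ball d => poisson (fun η : Sphere d => (η : E d)) b x)
      (comap (Subtype.val : Ball d → E d) (𝓝 (ξ : E d))) (𝓝 (sphereArea d * b ξ)) by
    have := h.const_mul (sphereArea d)⁻¹
    rwa [inv_mul_cancel_left₀ hc.ne'] at this
  rw [Metric.tendsto_nhds]
  intro ε hε
  obtain ⟨δ, hδ, K, hK⟩ := abs_poisson_sub_le hb ξ (show 0 < ε / (2 * sphereArea d) by positivity)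
  have h1 : Tendsto (fun x : Ball d => K * L (x : E d) ^ (d + 1))
      (comap (Subtype.val : Ball d → E d) (𝓝 (ξ : E d))) (𝓝 0) := by
    simpa using ((tendsto_L_comap ξ).pow (d + 1)).const_mul K
  filter_upwards [h1.eventually (gt_mem_nhds (show 0 < ε / 2 by positivity)),
    preimage_mem_comap (Metric.ball_mem_nhds (ξ : E d) hδ)] with x hx1 hx2
  have h2 := hK x (mem_ball_iff_norm.1 hx2)
  have h3 : ε / (2 * sphereArea d) * sphereArea d = ε / 2 := by field_simp
  rw [Real.dist_eq]
  linarith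

theorem one_sub_inner_sphere_smul (A : OPlus d) (x : Ball d) (η : Sphere d) :
    1 - inner ℝ (η : E d) ((A • x : Ball d) : E d) =
      (factor A x)⁻¹ * (factor A⁻¹ η * (1 - inner ℝ (sphereAct A⁻¹ η : E d) (x : E d))) := by
  have key : ∀ y z : E d, 1 - inner ℝ y z = -lor (hom y) (hom z) := fun y z => by
    simp [lor, hom]
  have h1 := factor_pos A x
  have h2 := factor_sphere_pos A⁻¹ η
  have h3 : lor (hom (η : E d)) (A.1 (hom (x : E d))) =
      lor ((A⁻¹).1 (hom (η : E d))) (hom (x : E d)) := by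
    rw [← A.2.1 ((A⁻¹).1 (hom (η : E d)))]
    congr 1
    exact (A.1.apply_symm_apply _).symm
  rw [apply_hom_eq_smul A h1, apply_hom_eq_smul A⁻¹ h2, lor_smul_left, lor_smul_right] at h3
  have e1 : hom ((A • x : Ball d) : E d) = hom (projAct A x) := rfl
  have e2 : hom (sphereAct A⁻¹ η : E d) = hom (projAct A⁻¹ η) := rfl
  rw [key, key, e1, e2]
  field_simp
  linarith

theorem continuous_sphereAct (A : OPlus d) : Continuous (sphereAct A) :=
  Continuous.subtype_mk (continuous_iff_continuousAt.2 fun η =>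
    ContinuousAt.comp (g := projAct A) (continuousAt_projAct A (factor_sphere_pos A η))
      continuous_subtype_val.continuousAt) _

/-- The powers of `factor A x` cancel: `d + 1` from `L`, `d` from the kernel, one in front. What
remains is a Poisson integral with moved nodes `A⁻¹ η`, so it solves the equation without any change
of variables on the sphere; hence the general `ζ` in `poisson`. -/
theorem factor_mul_poisson_smul (A : OPlus d) (b : Sphere d → ℝ) (x : Ball d) :
    factor A x * poisson (fun η : Sphere d => (η : E d)) b ((A • x : Ball d) : E d) =
      poisson (fun η => (sphereAct A⁻¹ η : E d))
        (fun η => ((factor A⁻¹ η) ^ d)⁻¹ * b η) (x : E d) := by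
  have h1 := factor_pos A x
  have h2 := L_pos x
  have h3 := L_pos (A • x)
  have h4 : L ((A • x : Ball d) : E d) = L (x : E d) * (factor A x)⁻¹ := by
    rw [factor_eq]; field_simp
  rw [poisson, poisson, h4, kernelInt, kernelInt, ← integral_const_mul, ← integral_const_mul,
    ← integral_const_mul]
  congr 1
  ext η
  have h5 := factor_sphere_pos A⁻¹ η
  have h6 := one_sub_inner_pos (norm_coe_sphere (sphereAct A⁻¹ η)) x.2
  rw [one_sub_inner_sphere_smul]
  simp only [smul_eq_mul]
  rw [mul_pow, mul_pow, mul_pow, pow_succ (factor A (x : E d))⁻¹]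
  field_simp

theorem exists_isKleinHarmonic_factor_mul (A : OPlus d) {b : Sphere d → ℝ} (hb : Continuous b) :
    ∃ f : E d → ℝ, IsKleinHarmonic f ∧
      ∀ x : Ball d, f x = factor A x * dirichlet b ((A • x : Ball d) : E d) := by
  refine ⟨fun x => (sphereArea d)⁻¹ * poisson (fun η => (sphereAct A⁻¹ η : E d))
    (fun η => ((factor A⁻¹ η) ^ d)⁻¹ * b η) x, (isKleinHarmonic_poisson
    (continuous_subtype_val.comp (continuous_sphereAct _)) (fun η => norm_coe_sphere _)
    (Continuous.mul (Continuous.inv₀ (((continuous_factor _).comp continuous_subtype_val).pow d)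
      fun η => (pow_pos (factor_sphere_pos _ η) d).ne') hb)).const_mul _, fun x => ?_⟩
  simp only [dirichlet, ← factor_mul_poisson_smul]
  ring

end Dirichlet

/-! ## Mean maps -/

section MeanMap

variable {d : ℕ} {Γ : Subgroup (OPlus d)}

/-- The transported solution and the solution plus the affine function of `A⁻¹ τ(A)` solve the same
equation with the same boundary values, by equivariance of `b_τ`. Uniqueness identifies them. -/
theorem isEquivariant_dirichlet [NeZero d] (hΓ : IsCompactOrientedQuotient Γ) (τ : Z1 Γ) :
    IsEquivariant τ fun x : Ball d => dirichlet (boundaryMap τ) x := by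
  have hb := continuous_boundaryMap hΓ τ
  have hH := isKleinHarmonic_dirichlet hb
  refine isEquivariant_iff.2 ⟨?_, fun A x => ?_⟩
  · exact continuousOn_iff_continuous_domRestrict.1 hH.contDiffOn.continuousOn
  obtain ⟨f, hf, hfeq⟩ := exists_isKleinHarmonic_factor_mul A.1 hb
  set v := (A.1⁻¹).1 (Z1.val τ A) with hv
  have hAv : A.1.1 v = Z1.val τ A := A.1.1.apply_symm_apply _
  have h1 : ExtendsBy (fun x : Ball d => f x)
      fun ξ => factor A.1 ξ * boundaryMap τ (sphereAct A.1 ξ) := by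
    intro ξ
    simp only [hfeq]
    exact (((continuous_factor A.1).tendsto _).comp tendsto_comap).mul
      ((extendsBy_dirichlet hb (sphereAct A.1 ξ)).comp (tendsto_smul_comap A.1 ξ))
  have h2 : ExtendsBy (fun x : Ball d => dirichlet (boundaryMap τ) x + lor (hom (x : E d)) v)
      fun ξ => factor A.1 ξ * boundaryMap τ (sphereAct A.1 ξ) := by
    intro ξ
    have h3 := factor_sphere_pos A.1 ξ
    have h4 := lor_hom_sphereAct A.1 ξ v
    rw [hAv] at h4
    have h5 : factor A.1 ξ * boundaryMap τ (sphereAct A.1 ξ) =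
        boundaryMap τ ξ + lor (hom (ξ : E d)) v := by
      rw [boundaryMap_sphereAct hΓ, h4]
      field_simp
    simp only [h5]
    exact (extendsBy_dirichlet hb ξ).add (((continuous_lor_hom v).tendsto _).comp tendsto_comap)
  have h6 := hf.eq_of_extendsBy (hH.add (isKleinHarmonic_lor_hom v)) h1 h2 x
  have h7 := lor_hom_smul A.1 x v
  have hL1 := L_pos x
  have hL2 := L_pos (A.1 • x)
  rw [hfeq, factor_eq] at h6
  rw [← hAv, h7]
  field_simp at h6 ⊢
  linarith

theorem isMeanMap_dirichlet [NeZero d] (hΓ : IsCompactOrientedQuotient Γ) (τ : Z1 Γ) :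
    IsMeanMap τ fun x : Ball d => dirichlet (boundaryMap τ) x := by
  refine isMeanMap_iff.2 ⟨?_, isEquivariant_dirichlet hΓ τ⟩
  exact (isKleinHarmonic_dirichlet (continuous_boundaryMap hΓ τ)).congr fun x hx =>
    ext0_coe (d := d) (fun x : Ball d => dirichlet (boundaryMap τ) x) ⟨x, hx⟩

theorem IsMeanMap.eq_dirichlet [NeZero d] (hΓ : IsCompactOrientedQuotient Γ) {τ : Z1 Γ}
    {h : Ball d → ℝ} (hh : IsMeanMap τ h) (x : Ball d) : h x = dirichlet (boundaryMap τ) x := by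
  obtain ⟨h1, h2⟩ := isMeanMap_iff.1 hh
  have hb := continuous_boundaryMap hΓ τ
  have := h1.eq_of_extendsBy (isKleinHarmonic_dirichlet hb)
    (by simpa only [ext0_coe] using h2.extendsBy hΓ) (extendsBy_dirichlet hb) x
  rwa [ext0_coe] at this

theorem existsUnique_isMeanMap [NeZero d] (hΓ : IsCompactOrientedQuotient Γ) (τ : Z1 Γ) :
    ∃! h : Ball d → ℝ, IsMeanMap τ h :=
  ⟨_, isMeanMap_dirichlet hΓ τ, fun _ hh => funext fun x => hh.eq_dirichlet hΓ x⟩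

theorem isMeanMap_hMean [NeZero d] (hΓ : IsCompactOrientedQuotient Γ) (τ : Z1 Γ) :
    IsMeanMap τ (hMean τ) :=
  Classical.epsilon_spec (existsUnique_isMeanMap hΓ τ).exists

theorem hMean_eq [NeZero d] (hΓ : IsCompactOrientedQuotient Γ) (τ : Z1 Γ) (x : Ball d) :
    hMean τ x = dirichlet (boundaryMap τ) x :=
  (isMeanMap_hMean hΓ τ).eq_dirichlet hΓ x

theorem dirichlet_neg (b : Sphere d → ℝ) (x : E d) : dirichlet (-b) x = -dirichlet b x := by
  simp [dirichlet, poisson, kernelInt, integral_neg]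

theorem dirichlet_add_lor_hom [NeZero d] {b : Sphere d → ℝ} (hb : Continuous b) (w : Mink d)
    (x : Ball d) : dirichlet (b + fun ξ : Sphere d => lor (hom (ξ : E d)) w) x =
      dirichlet b x + lor (hom (x : E d)) w := by
  have hb' : Continuous (b + fun ξ : Sphere d => lor (hom (ξ : E d)) w) :=
    hb.add ((continuous_lor_hom w).comp continuous_subtype_val)
  exact (isKleinHarmonic_dirichlet hb').eq_of_extendsBy
    ((isKleinHarmonic_dirichlet hb).add (isKleinHarmonic_lor_hom w)) (extendsBy_dirichlet hb')
    (fun ξ => (extendsBy_dirichlet hb ξ).add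
      (((continuous_lor_hom w).tendsto _).comp tendsto_comap)) x

end MeanMap

end CoMinkowski

namespace CoMinkowski

/-! ## The norm on cohomology -/

section Norm

variable {d : ℕ} {Γ : Subgroup (OPlus d)}

theorem cls_surjective : Function.Surjective (cls : Z1 Γ → H1 Γ) := fun c =>
  groupCohomology.H1_induction_on (C := fun c => ∃ τ : Z1 Γ, cls τ = c) c fun τ => ⟨τ, rfl⟩

theorem cls_add (τ τ' : Z1 Γ) : cls (τ + τ') = cls τ + cls τ' :=
  map_add (groupCohomology.H1π (Rep.of (minkRep Γ))).hom τ τ'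

theorem cls_smul (α : ℝ) (τ : Z1 Γ) : cls (α • τ) = α • cls τ :=
  map_smul (groupCohomology.H1π (Rep.of (minkRep Γ))).hom α τ

theorem cls_neg (τ : Z1 Γ) : cls (-τ) = -cls τ :=
  map_neg (groupCohomology.H1π (Rep.of (minkRep Γ))).hom τ

theorem cls_eq_zero_iff {τ : Z1 Γ} :
    cls τ = 0 ↔ ∃ w : Mink d, ∀ A : Γ, Z1.val τ A = w - A.1.1 w := by
  refine (groupCohomology.H1π_eq_zero_iff τ).trans ⟨?_, ?_⟩
  · rintro ⟨w, hw⟩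
    -- The coboundary of `w` is `A w - w`, opposite to the sign convention of the statement.
    refine ⟨-(w : Mink d), fun A => ?_⟩
    have h : A.1.1 (w : Mink d) - w = Z1.val τ A := congrFun hw A
    rw [← h, map_neg]
    abel
  · rintro ⟨w, hw⟩
    refine ⟨(-w : Mink d), funext fun A => ?_⟩
    have h : A.1.1 (-w) - (-w) = Z1.val τ A := by rw [hw, map_neg]; abel
    exact h

/-- Cohomologous cocycles differ by a coboundary, whose boundary map is affine. Both hulls and the
mean map then shift by that affine function, leaving their differences unchanged. -/
theorem exists_boundaryMap_eq_add (hΓ : IsCompactOrientedQuotient Γ) {τ τ' : Z1 Γ}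
    (h : cls τ' = cls τ) : ∃ w : Mink d,
      boundaryMap τ' = boundaryMap τ + fun ξ : Sphere d => lor (hom (ξ : E d)) w := by
  have h0 : cls (τ' + -τ) = 0 := by rw [cls_add, cls_neg, h, add_neg_cancel]
  obtain ⟨w, hw⟩ := cls_eq_zero_iff.1 h0
  refine ⟨w, ?_⟩
  rw [← boundaryMap_of_eq_sub hΓ hw, ← boundaryMap_add hΓ]
  congr 1
  exact (add_neg_cancel_comm_assoc τ τ').symm

theorem upperHull_add_lor_hom [NeZero d] {b : Sphere d → ℝ} (hb : Continuous b) (w : Mink d)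
    (x : Ball d) : upperHull (b + fun ξ : Sphere d => lor (hom (ξ : E d)) w) x =
      upperHull b x + lor (hom (x : E d)) w := by
  have h := lowerHull_add_lor_hom hb.neg (-w) x
  have e : (-b + fun ξ : Sphere d => lor (hom (ξ : E d)) (-w)) =
      -(b + fun ξ : Sphere d => lor (hom (ξ : E d)) w) := by
    ext ξ
    simp only [Pi.add_apply, Pi.neg_apply, lor_neg_right]
    ring
  rw [e, lor_neg_right] at h
  rw [upperHull, upperHull, h]
  ring

/-- The integral over `ℍ^d / Γ` of the width of the convex core. -/
noncomputable def width (τ : Z1 Γ) : ℝ :=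
  ∫ q, descend Γ (fun x => hPlus τ x - hMinus τ x) q ∂(quotientMeasure Γ (hypVolume d))

theorem width_congr [NeZero d] (hΓ : IsCompactOrientedQuotient Γ) {τ τ' : Z1 Γ}
    (h : cls τ' = cls τ) : width τ' = width τ := by
  obtain ⟨w, hw⟩ := exists_boundaryMap_eq_add hΓ h
  have hb := continuous_boundaryMap hΓ τ
  have : (fun x => hPlus τ' x - hMinus τ' x) = fun x => hPlus τ x - hMinus τ x := by
    ext x
    rw [hPlus, hMinus, hw, upperHull_add_lor_hom hb, lowerHull_add_lor_hom hb, hPlus, hMinus]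
    ring
  rw [width, this, width]

theorem S1_congr [NeZero d] (hΓ : IsCompactOrientedQuotient Γ) {τ τ' : Z1 Γ}
    (h : cls τ' = cls τ) : S1 τ' = S1 τ := by
  obtain ⟨w, hw⟩ := exists_boundaryMap_eq_add hΓ h
  have hb := continuous_boundaryMap hΓ τ
  have : (fun x => hMean τ' x - hMinus τ' x) = fun x => hMean τ x - hMinus τ x := by
    ext x
    rw [hMean_eq hΓ, hMean_eq hΓ, hMinus, hw, dirichlet_add_lor_hom hb, lowerHull_add_lor_hom hb,
      hMinus]
    ring
  rw [S1, this, S1]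

variable [NeZero d]

theorem isGammaInvariant_hPlus_sub_hMinus (hΓ : IsCompactOrientedQuotient Γ) (τ : Z1 Γ) :
    IsGammaInvariant Γ fun x => hPlus τ x - hMinus τ x :=
  (isEquivariant_hPlus hΓ τ).sub_isGammaInvariant (isEquivariant_hMinus hΓ τ)

theorem integrable_hPlus_sub_hMinus (hΓ : IsCompactOrientedQuotient Γ) (τ : Z1 Γ) :
    Integrable (descend Γ fun x => hPlus τ x - hMinus τ x) (quotientMeasure Γ (hypVolume d)) :=
  integrable_descend hΓ ((isEquivariant_hPlus hΓ τ).1.sub (isEquivariant_hMinus hΓ τ).1)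
    (isGammaInvariant_hPlus_sub_hMinus hΓ τ)

theorem isGammaInvariant_hMean_sub_hMinus (hΓ : IsCompactOrientedQuotient Γ) (τ : Z1 Γ) :
    IsGammaInvariant Γ fun x => hMean τ x - hMinus τ x :=
  (isMeanMap_hMean hΓ τ).2.1.sub_isGammaInvariant (isEquivariant_hMinus hΓ τ)

theorem integrable_hMean_sub_hMinus (hΓ : IsCompactOrientedQuotient Γ) (τ : Z1 Γ) :
    Integrable (descend Γ fun x => hMean τ x - hMinus τ x) (quotientMeasure Γ (hypVolume d)) :=
  integrable_descend hΓ ((isMeanMap_hMean hΓ τ).2.1.1.sub (isEquivariant_hMinus hΓ τ).1)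
    (isGammaInvariant_hMean_sub_hMinus hΓ τ)

theorem width_nonneg (hΓ : IsCompactOrientedQuotient Γ) (τ : Z1 Γ) : 0 ≤ width τ :=
  integral_nonneg fun _ => mul_nonneg (inv_nonneg.2 (L_pos _).le)
    (sub_nonneg.2 (hMinus_le_hPlus hΓ τ _))

theorem toReal_coreVolume (hΓ : IsCompactOrientedQuotient Γ) (τ : Z1 Γ) :
    (coreVolume τ).toReal = width τ := by
  rw [coreVolume_eq hΓ]
  exact ENNReal.toReal_ofReal (width_nonneg hΓ τ)

/-- Hulls are positively homogeneous, and a negative factor exchanges the two of them up to sign. -/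
theorem hPlus_sub_hMinus_smul (hΓ : IsCompactOrientedQuotient Γ) (α : ℝ) (τ : Z1 Γ) (x : Ball d) :
    hPlus (α • τ) x - hMinus (α • τ) x = |α| * (hPlus τ x - hMinus τ x) := by
  have hb := continuous_boundaryMap hΓ τ
  have key : ∀ (c : ℝ) (b : Sphere d → ℝ), Continuous b → 0 ≤ c →
      upperHull (c • b) x - lowerHull (c • b) x = c * (upperHull b x - lowerHull b x) := by
    intro c b hb hc
    rw [upperHull, upperHull, ← smul_neg, lowerHull_smul hb hc, lowerHull_smul hb.neg hc]
    ring
  rw [hPlus, hMinus, boundaryMap_smul hΓ]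
  rcases le_total 0 α with h | h
  · rw [key α _ hb h, abs_of_nonneg h]
    rfl
  · have e : α • boundaryMap τ = (-α) • -boundaryMap τ := by rw [smul_neg, neg_smul, neg_neg]
    rw [e, key (-α) _ hb.neg (neg_nonneg.2 h), upperHull_neg, abs_of_nonpos h, hPlus, hMinus,
      upperHull]
    ring

theorem width_smul (hΓ : IsCompactOrientedQuotient Γ) (α : ℝ) (τ : Z1 Γ) :
    width (α • τ) = |α| * width τ := by
  have h : descend Γ (fun x => hPlus (α • τ) x - hMinus (α • τ) x) =
      fun q => |α| * descend Γ (fun x => hPlus τ x - hMinus τ x) q := by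
    ext q
    rw [descend, descend, hPlus_sub_hMinus_smul hΓ]
    ring
  rw [width, h]
  exact integral_const_mul _ _

theorem width_add_le (hΓ : IsCompactOrientedQuotient Γ) (τ τ' : Z1 Γ) :
    width (τ + τ') ≤ width τ + width τ' := by
  refine le_trans ?_ (integral_add (integrable_hPlus_sub_hMinus hΓ τ)
    (integrable_hPlus_sub_hMinus hΓ τ')).le
  refine integral_mono (integrable_hPlus_sub_hMinus hΓ _)
    ((integrable_hPlus_sub_hMinus hΓ τ).add (integrable_hPlus_sub_hMinus hΓ τ')) fun q => ?_
  have hb := continuous_boundaryMap hΓ τ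
  have hb' := continuous_boundaryMap hΓ τ'
  simp only [descend, ← mul_add]
  refine mul_le_mul_of_nonneg_left ?_ (inv_nonneg.2 (L_pos _).le)
  have h1 := lowerHull_add_le hb hb' q.out
  have h2 := lowerHull_add_le hb.neg hb'.neg q.out
  rw [← neg_add] at h2
  simp only [hPlus, hMinus, upperHull, boundaryMap_add hΓ]
  linarith

/-- The hulls coincide, so they are affine; an equivariant affine map exhibits `τ` as a coboundary.
-/
theorem cls_eq_zero_of_width_eq_zero (hΓ : IsCompactOrientedQuotient Γ) {τ : Z1 Γ}
    (h : width τ = 0) : cls τ = 0 := by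
  have h1 : ∀ x, hPlus τ x - hMinus τ x = 0 := eq_zero_of_integral_descend_eq_zero hΓ
    ((isEquivariant_hPlus hΓ τ).1.sub (isEquivariant_hMinus hΓ τ).1)
    (isGammaInvariant_hPlus_sub_hMinus hΓ τ) (fun x => sub_nonneg.2 (hMinus_le_hPlus hΓ τ x)) h
  obtain ⟨w, hw⟩ := exists_lowerHull_eq_lor_hom (continuous_boundaryMap hΓ τ)
    fun x => (sub_eq_zero.1 (h1 x)).symm
  have h2 : hMinus τ = fun x : Ball d => lor (hom (x : E d)) w := funext hw
  have h3 := isEquivariant_hMinus hΓ τ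
  rw [h2] at h3
  exact cls_eq_zero_iff.2 ⟨w, isEquivariant_lor_hom_iff.1 h3⟩

/-- Pointwise, `h⁺_τ = -h⁻_{-τ}`, and the mean maps of `τ` and `-τ` cancel since the Dirichlet
solution is odd in its boundary values. -/
theorem width_eq_S1_add_S1_neg (hΓ : IsCompactOrientedQuotient Γ) (τ : Z1 Γ) :
    width τ = S1 τ + S1 (-τ) := by
  refine Eq.trans ?_ (integral_add (integrable_hMean_sub_hMinus hΓ τ)
    (integrable_hMean_sub_hMinus hΓ (-τ)))
  rw [width]
  congr 1
  ext q
  simp only [descend, hPlus_eq hΓ τ, hMean_eq hΓ, boundaryMap_neg hΓ, dirichlet_neg]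
  ring

/-- The volume of the convex core, as a function on `H¹(Γ, ℝ^{d,1})`. -/
noncomputable def volNorm (c : H1 Γ) : ℝ := width (Function.surjInv cls_surjective c)

/-- The `S₁` norm on `H¹(Γ, ℝ^{d,1})`. -/
noncomputable def sOneNorm (c : H1 Γ) : ℝ := S1 (Function.surjInv cls_surjective c)

theorem volNorm_cls (hΓ : IsCompactOrientedQuotient Γ) (τ : Z1 Γ) : volNorm (cls τ) = width τ :=
  width_congr hΓ (Function.surjInv_eq cls_surjective (cls τ))

theorem sOneNorm_cls (hΓ : IsCompactOrientedQuotient Γ) (τ : Z1 Γ) : sOneNorm (cls τ) = S1 τ :=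
  S1_congr hΓ (Function.surjInv_eq cls_surjective (cls τ))

theorem volNorm_nonneg (hΓ : IsCompactOrientedQuotient Γ) (c : H1 Γ) : 0 ≤ volNorm c :=
  width_nonneg hΓ _

theorem volNorm_smul (hΓ : IsCompactOrientedQuotient Γ) (α : ℝ) (c : H1 Γ) :
    volNorm (α • c) = |α| * volNorm c := by
  obtain ⟨τ, rfl⟩ := cls_surjective c
  rw [← cls_smul, volNorm_cls hΓ, volNorm_cls hΓ, width_smul hΓ]

theorem volNorm_eq_zero_iff (hΓ : IsCompactOrientedQuotient Γ) (c : H1 Γ) :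
    volNorm c = 0 ↔ c = 0 := by
  refine ⟨fun h => ?_, fun h => ?_⟩
  · obtain ⟨τ, rfl⟩ := cls_surjective c
    rw [volNorm_cls hΓ] at h
    exact cls_eq_zero_of_width_eq_zero hΓ h
  · have := volNorm_smul hΓ 0 (0 : H1 Γ)
    rwa [abs_zero, zero_mul, smul_zero, ← h] at this

theorem volNorm_add_le (hΓ : IsCompactOrientedQuotient Γ) (c c' : H1 Γ) :
    volNorm (c + c') ≤ volNorm c + volNorm c' := by
  obtain ⟨τ, rfl⟩ := cls_surjective c
  obtain ⟨τ', rfl⟩ := cls_surjective c'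
  rw [← cls_add, volNorm_cls hΓ, volNorm_cls hΓ, volNorm_cls hΓ]
  exact width_add_le hΓ τ τ'

theorem volNorm_eq_sOneNorm_add (hΓ : IsCompactOrientedQuotient Γ) (c : H1 Γ) :
    volNorm c = sOneNorm c + sOneNorm (-c) := by
  obtain ⟨τ, rfl⟩ := cls_surjective c
  rw [← cls_neg, volNorm_cls hΓ, sOneNorm_cls hΓ, sOneNorm_cls hΓ]
  exact width_eq_S1_add_S1_neg hΓ τ

end Norm

end CoMinkowski

/-! ### The theorem -/

theorem mainTheorem3 (d : ℕ) (hd : 1 ≤ d) (Γ : Subgroup (OPlus d))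
    (hΓ : IsCompactOrientedQuotient Γ) :
    (∀ τ : Z1 Γ,
      (∃! b : Sphere d → ℝ, IsBoundaryMap τ b) ∧
      (∃! h : Ball d → ℝ, IsMeanMap τ h) ∧
      IsLeast (convexSets τ) (convexCore τ) ∧
      IsGammaInvariant Γ (fun x => hPlus τ x - hMinus τ x) ∧
      Integrable (descend Γ fun x => hPlus τ x - hMinus τ x)
        (quotientMeasure Γ (hypVolume d)) ∧
      coreVolume τ = ENNReal.ofReal
        (∫ q, descend Γ (fun x => hPlus τ x - hMinus τ x) q ∂(quotientMeasure Γ (hypVolume d))) ∧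
      IsGammaInvariant Γ (fun x => hMean τ x - hMinus τ x) ∧
      Integrable (descend Γ fun x => hMean τ x - hMinus τ x)
        (quotientMeasure Γ (hypVolume d))) ∧
    ∃ (vol : H1 Γ → ℝ) (s1 : H1 Γ → ℝ),
      (∀ τ : Z1 Γ, vol (cls τ) = (coreVolume τ).toReal) ∧
      (∀ τ : Z1 Γ, s1 (cls τ) = S1 τ) ∧
      (∀ c, 0 ≤ vol c) ∧
      (∀ c, vol c = 0 ↔ c = 0) ∧
      (∀ (α : ℝ) (c : H1 Γ), vol (α • c) = |α| * vol c) ∧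
      (∀ c c' : H1 Γ, vol (c + c') ≤ vol c + vol c') ∧
      (∀ c, vol c = s1 c + s1 (-c)) := by
  have : NeZero d := ⟨by omega⟩
  refine ⟨fun τ => ⟨existsUnique_isBoundaryMap hΓ τ, existsUnique_isMeanMap hΓ τ,
    isLeast_convexCore hΓ τ, isGammaInvariant_hPlus_sub_hMinus hΓ τ,
    integrable_hPlus_sub_hMinus hΓ τ, coreVolume_eq hΓ τ, isGammaInvariant_hMean_sub_hMinus hΓ τ,
    integrable_hMean_sub_hMinus hΓ τ⟩, ?_⟩
  exact ⟨volNorm, sOneNorm, fun τ => (volNorm_cls hΓ τ).trans (toReal_coreVolume hΓ τ).symm,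
    sOneNorm_cls hΓ, volNorm_nonneg hΓ, volNorm_eq_zero_iff hΓ, volNorm_smul hΓ,
    volNorm_add_le hΓ, volNorm_eq_sOneNorm_add hΓ⟩
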